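/- **Setting.** A *perfect network* $\mathcal N$ on the torus $T=\mathbb R^2/\mathbb Z^2$ is a finite directed graph (loops and multiple edges allowed) embedded in $T$, whose edges are regular $C^1$ arcs and in which every vertex has degree 3 and is either white (one incoming, two outgoing edges) or black (two incoming, one outgoing edge); directed paths have no cusps at the vertices. Let $\rho$ (the *cut*) and $\gamma$ (the *rim*) be two simple closed curves on $T$ that meet once, transversally, normalized as $\rho=\{y\in\mathbb Z\}$, $\gamma=\{x\in\mathbb Z\}$. They contain no vertices, meet every edge transversally in finitely many points, and no edge passes through $\rho\cap\gamma$. The rim is *ideal* if all edges cross it in the same direction; $\gamma$ is oriented so that these crossings count as $+1$. For weights $(w_e)$ of the edges and a simple directed cycle $C$ put $w(C)=(-1)^{d_\lambda+d_z}\lambda^{d_\lambda}z^{d_z}\prod_{e\in C}w_e$, where $d_\lambda$, $d_z$ are the intersection indices of $C$ with $\rho$ and $\gamma$, and $$\mathfrak P_{\mathcal N}(\lambda,z)=\sum_{\mathcal C}(-1)^{|\mathcal C|}\prod_{C\in\mathcal C}w(C),$$ the sum over all collections $\mathcal C$ of pairwise (vertex-)disjoint simple directed cycles. If $\gamma$ is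 ideal, cutting $T$ along $\gamma$ gives a network on a cylinder; each of the $m$ intersection points of $\gamma$ with edges becomes a source on the left and a sink on the right boundary circle, and each edge is cut into pieces, whose weights $u$ are arbitrary with product $w_e$. Let $M(\lambda)$ be its $m\times m$ boundary measurement matrix: $M_{pq}$ is the sum over all (not necessarily simple) directed paths $P$ on the cylinder from source $p$ to sink $q$ of $(-1)^{r(P)-1}\lambda^{d(P)}\prod_{a\in P}u_a$. Here $d(P)$ is the intersection index of $P$ with $\rho$, and $r(P)$ is the rotation number, with the cylinder embedded as a plane annulus, of the loop formed by $P$, an arc of the right boundary circle, the cut and an arc of the left boundary circle. The entries are formal power series in the weights $u$. **Proposition.** Let $\mathcal N$ be a perfect network on the torus in which no simple directed cycle is contractible, and let $\gamma$ be an ideal rim. Let $K$ be a field and $\lambda\in K^\times$ (for instance $K=\mathbb R(\lambda)$). Then $\mathfrak P_{\mathcal N}(\lambda,0)$ is an invertible formal power series in the weights $u$, and $$\det(I_m+zM(\lambda))=\frac{\mathfrak P_{\mathcal N}(\lambda,z)}{\mathfrak P_{\mathcal N}(\lambda,0)}$$ as an identity of polynomials in $z$ whose coefficients are power series in $u$ over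 $K$. Moreover, for all weights $u$ in $K$ with $\mathfrak P_{\mathcal N}(\lambda,0)\ne0$, the entries of $M(\lambda)$ are expansions of rational functions of the weights that are defined at $u$, and the identity holds in $K[z]$ for the values of these functions at $u$. **Corollary.** Let $2\le k\le n$, let $K$ be a field and $x_i,y_i\in K$ for $1\le i\le n$. Let $\bar{\mathcal N}_{k,n}$ be the network on the torus with vertices $UL_i,LR_i$ (black), $UR_i,LL_i$ (white), $i\in\mathbb Z/n$, and edges $LL_i\to UL_i$ of weight $x_i$, $LL_i\to LR_i$ of weight $y_i$, and $UL_i\to UR_i$, $UR_i\to LR_i$, $LR_i\to UL_{i+1}$, $UR_i\to LL_{i+k-1}$ of weight 1. In $\mathbb R^2/\mathbb Z^2$ the four vertices with index $i$ lie in $[\frac{i-1}n,\frac in]\times[0,1]$ and the edges are straight segments; precisely the white–white edges cross $\rho$, once each, and precisely the edges $LR_n\to UL_1$ and $UR_j\to LL_{j+k-1}$ with $n-k+2\le j\le n$ cross $\gamma$, once each. Then $\gamma$ is an ideal rim and $\bar{\mathcal N}_{k,n}$ has no contractible simple directed cycles. Let $M_{k,n}(\lambda)=L_1(\lambda)\cdots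 L_n(\lambda)$, where for $k=2$ $$L_i(\lambda)=\begin{pmatrix}-\lambda x_i&x_i+y_i\\-\lambda&1\end{pmatrix},$$ and for $k\ge3$ the nonzero entries of the $k\times k$ matrix $L_i(\lambda)$ are $(1,k-1)\colon x_i$; $(1,k)\colon x_i+y_i$; $(2,1)\colon-\lambda$; $(a,a-1)\colon1$ for $3\le a\le k$; $(k,k)\colon1$. Let $A_{k,n}(z)=Z(D_x+D_yZ)Z^{k-2}(I_n-Z)^{-1}$ with $Z=-z\,e_{n1}+\sum_{i=1}^{n-1}e_{i,i+1}$, $D_x=\operatorname{diag}(x_i)$, $D_y=\operatorname{diag}(y_i)$. Then $$\det(I_k+zM_{k,n}(\lambda))=(1+z)\det(I_n+\lambda A_{k,n}(z))=\mathfrak P_{\bar{\mathcal N}_{k,n}}(\lambda,z)$$ for all $\lambda,z\in K$ (the middle term requires $1+z\ne0$, so that $I_n-Z$ is invertible). -/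

import Mathlib

noncomputable section

/-! ### Perfect networks on the torus -/

/-- Congruence modulo the lattice `ℤ + ℤ i`, that is, equality of points of the torus
`ℂ / (ℤ + ℤ i)`. -/
def LatticeEq (a b : ℂ) : Prop := ∃ m n : ℤ, a - b = (m : ℂ) + (n : ℂ) * Complex.I

/-- A perfect network (without its edge weights, which vary) with vertex set `V` and edge set `E`
on the torus `ℂ / (ℤ + ℤ i)`, with respect to the closed curves

* `γ` = image of the vertical line `re = 0` (the rim), oriented upwards,
* `ρ` = image of the horizontal line `im = 0` (the cut), oriented to the right,

which meet once, transversally. The edges are regular arcs of class `C¹`, described by lifts to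
the universal cover `ℂ`. -/
structure PerfectTorusNetwork (V E : Type*) [Fintype V] [Fintype E] where
  /-- tail of an edge -/
  src : E → V
  /-- head of an edge -/
  tgt : E → V
  /-- a lift of the position of a vertex -/
  pos : V → ℂ
  /-- a lift of an edge, parametrized by `[0, 1]` in the direction of the edge -/
  curve : E → ℝ → ℂ
  /-- absolute value of the velocity -/
  speed : E → ℝ → ℝ
  /-- a continuous argument of the velocity -/
  angle : E → ℝ → ℝ
  speed_pos : ∀ e, ∀ t ∈ Set.Icc (0 : ℝ) 1, 0 < speed e t
  speed_cont : ∀ e, ContinuousOn (speed e) (Set.Icc 0 1)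
  angle_cont : ∀ e, ContinuousOn (angle e) (Set.Icc 0 1)
  hasDeriv : ∀ e, ∀ t ∈ Set.Icc (0 : ℝ) 1, HasDerivWithinAt (curve e)
    ((speed e t : ℂ) * Complex.exp ((angle e t : ℂ) * Complex.I)) (Set.Icc 0 1) t
  curve_zero : ∀ e, LatticeEq (curve e 0) (pos (src e))
  curve_one : ∀ e, LatticeEq (curve e 1) (pos (tgt e))
  -- the graph is embedded in the torus
  pos_inj : ∀ v v', LatticeEq (pos v) (pos v') → v = v'
  curve_avoid : ∀ e, ∀ t ∈ Set.Ioo (0 : ℝ) 1, ∀ v, ¬ LatticeEq (curve e t) (pos v)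
  curve_inj : ∀ e e', ∀ t ∈ Set.Ioo (0 : ℝ) 1, ∀ t' ∈ Set.Ioo (0 : ℝ) 1,
    LatticeEq (curve e t) (curve e' t') → e = e' ∧ t = t'
  -- every vertex is white (one incoming, two outgoing edges) or black (two incoming, one outgoing)
  perfect : ∀ v,
    ({e | tgt e = v}.ncard = 1 ∧ {e | src e = v}.ncard = 2) ∨
    ({e | tgt e = v}.ncard = 2 ∧ {e | src e = v}.ncard = 1)
  -- directed paths have no cusps at the vertices, so that they have rotation numbers
  no_cusp : ∀ e f, tgt e = src f → Real.cos (angle f 0 - angle e 1) ≠ -1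
  -- `γ` and `ρ` do not contain vertices, and no edge passes through `γ ∩ ρ`
  pos_rim : ∀ v, ∀ m : ℤ, (pos v).re ≠ m
  pos_cut : ∀ v, ∀ m : ℤ, (pos v).im ≠ m
  avoid_corner : ∀ e, ∀ t ∈ Set.Ioo (0 : ℝ) 1, ∀ m n : ℤ,
    (curve e t).re = m → (curve e t).im ≠ n
  -- `γ` and `ρ` intersect every edge transversally and at finitely many points
  rim_transversal : ∀ e, ∀ t ∈ Set.Ioo (0 : ℝ) 1, ∀ m : ℤ,
    (curve e t).re = m → Real.cos (angle e t) ≠ 0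
  cut_transversal : ∀ e, ∀ t ∈ Set.Ioo (0 : ℝ) 1, ∀ m : ℤ,
    (curve e t).im = m → Real.sin (angle e t) ≠ 0
  rim_finite : ∀ e, {t : ℝ | t ∈ Set.Ioo (0 : ℝ) 1 ∧ ∃ m : ℤ, (curve e t).re = m}.Finite
  cut_finite : ∀ e, {t : ℝ | t ∈ Set.Ioo (0 : ℝ) 1 ∧ ∃ m : ℤ, (curve e t).im = m}.Finite

/-- The exterior angle in `(-π, π]` at a corner where the direction changes from `a` to `b`. -/
def exteriorAngle (a b : ℝ) : ℝ := ((b - a : ℝ) : Real.Angle).toReal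

namespace PerfectTorusNetwork

variable {V E : Type*} [Fintype V] [Fintype E] (N : PerfectTorusNetwork V E)

/-- The parameters of the intersection points of the edge `e` with the rim `γ`. -/
def rimTimes (e : E) : Finset ℝ := (N.rim_finite e).toFinset

/-- The parameters of the intersection points of the edge `e` with the cut `ρ`. -/
def cutTimes (e : E) : Finset ℝ := (N.cut_finite e).toFinset

/-- The intersection index `d_z` of the edge `e` with `γ`: a crossing from left to right counts
as `+1`, a crossing from right to left as `-1`. -/
def rimIndex (e : E) : ℤ := ∑ t ∈ N.rimTimes e, (SignType.sign (Real.cos (N.angle e t)) : ℤ)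

/-- The intersection index `d_λ` of the edge `e` with `ρ`: a crossing upwards counts as `+1`,
a crossing downwards as `-1`. -/
def cutIndex (e : E) : ℤ := ∑ t ∈ N.cutTimes e, (SignType.sign (Real.sin (N.angle e t)) : ℤ)

/-- The rim `γ` is ideal: all its intersections with edges define the same orientation of the
torus (`γ` being oriented so that they are positive). -/
def IsIdealRim : Prop :=
  ∀ e, ∀ t ∈ N.rimTimes e, 0 < Real.cos (N.angle e t)

/-! ### Cycles and the partition function -/

/-- `S` is the edge set of a simple directed cycle. -/
def IsSimpleCycle (S : Finset E) : Prop :=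
  ∃ (m : ℕ) (c : Fin (m + 1) → E), Function.Injective (fun i => N.src (c i)) ∧
    (∀ i, N.tgt (c i) = N.src (c (i + 1))) ∧ ∀ e, e ∈ S ↔ ∃ i, c i = e

/-- No simple directed cycle is contractible on the torus, that is, no simple directed cycle lifts
to a closed curve in the universal cover. -/
def NoContractibleCycles : Prop :=
  ∀ S : Finset E, N.IsSimpleCycle S → ∑ e ∈ S, (N.curve e 1 - N.curve e 0) ≠ 0

/-- A collection of simple directed cycles which are pairwise disjoint (have no common vertex). -/
def IsDisjointCollection (𝒞 : Finset (Finset E)) : Prop :=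
  (∀ S ∈ 𝒞, N.IsSimpleCycle S) ∧
  ∀ S ∈ 𝒞, ∀ S' ∈ 𝒞, S ≠ S' → ∀ e ∈ S, ∀ e' ∈ S', N.src e ≠ N.src e'

section Partition

variable {K : Type*} [Field K] {A : Type*} [CommRing A] [Algebra K A]

/-- The weight `(-1)^(d_λ + d_z) λ^d_λ z^d_z ∏ w_e` of a simple directed cycle. (The index `d_z` is
nonnegative for an ideal rim, so that the weight makes sense for `z = 0`, too.) -/
def cycleWeight (lam : K) (z : A) (w : E → A) (S : Finset E) : A :=
  ((-1) ^ (∑ e ∈ S, (N.cutIndex e + N.rimIndex e)).natAbs : A) *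
    algebraMap K A (lam ^ (∑ e ∈ S, N.cutIndex e)) *
    z ^ (∑ e ∈ S, N.rimIndex e).toNat * ∏ e ∈ S, w e

open Classical in
/-- The partition function `𝔓_N(λ, z)`: the sum of `(-1)^|𝒞| ∏ w(C)` over all collections `𝒞` of
disjoint simple cycles. -/
def partitionFunction (lam : K) (z : A) (w : E → A) : A :=
  ∑ 𝒞 ∈ (Finset.univ : Finset (Finset (Finset E))).filter N.IsDisjointCollection,
    (-1) ^ 𝒞.card * ∏ S ∈ 𝒞, N.cycleWeight lam z w S

end Partition

/-! ### The network on the cylinder and its boundary measurement matrix -/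

/-- The intersection points of `γ` with the edges. Each of them becomes a source on the left and
a sink on the right boundary circle when the torus is cut along `γ`. -/
def RimPoint : Type _ := Σ e : E, {t : ℝ // t ∈ N.rimTimes e}

instance : Fintype N.RimPoint :=
  inferInstanceAs (Fintype (Σ e : E, {t : ℝ // t ∈ N.rimTimes e}))

instance : DecidableEq N.RimPoint := Classical.decEq _

/-- The edges of the network on the cylinder are the pieces into which `γ` cuts the edges:
`Sum.inl e` is the piece that starts at the tail of `e`, and `Sum.inr p` is the piece that starts
at the source `p`. -/
abbrev Piece : Type _ := E ⊕ N.RimPoint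

/-- The edge of the torus network that contains the piece. -/
def pieceEdge : N.Piece → E
  | Sum.inl e => e
  | Sum.inr p => p.1

/-- The parameter at which a piece starts. -/
def startTime : N.Piece → ℝ
  | Sum.inl _ => 0
  | Sum.inr p => p.2.1

/-- The parameters of the later intersections with `γ` of the edge that contains the piece. -/
def laterRimTimes (a : N.Piece) : Finset ℝ :=
  (N.rimTimes (N.pieceEdge a)).filter (fun t => N.startTime a < t)

/-- The parameter at which a piece ends: that of the next intersection with `γ`, if there is one,
and `1` otherwise. -/
def endTime (a : N.Piece) : ℝ :=
  if h : (N.laterRimTimes a).Nonempty then (N.laterRimTimes a).min' h else 1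

/-- The initial vertex of a piece: a vertex of the torus network or a source. -/
def pieceStart : N.Piece → V ⊕ N.RimPoint
  | Sum.inl e => Sum.inl (N.src e)
  | Sum.inr p => Sum.inr p

/-- The final vertex of a piece: a vertex of the torus network or a sink. -/
def pieceEnd (a : N.Piece) : V ⊕ N.RimPoint :=
  if h : (N.laterRimTimes a).Nonempty then
    Sum.inr ⟨N.pieceEdge a, (N.laterRimTimes a).min' h,
      (Finset.mem_filter.mp ((N.laterRimTimes a).min'_mem h)).1⟩
  else Sum.inl (N.tgt (N.pieceEdge a))

/-- `P` is a (not necessarily simple) directed path on the cylinder from the source `p` to the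
sink `q`. -/
def IsPath (p q : N.RimPoint) (P : List N.Piece) : Prop :=
  P.head?.map N.pieceStart = some (Sum.inr p) ∧
  P.getLast?.map N.pieceEnd = some (Sum.inr q) ∧
  P.IsChain (fun a b => ∃ v : V, N.pieceEnd a = Sum.inl v ∧ N.pieceStart b = Sum.inl v)

/-- The intersection index of a piece with `ρ`. -/
def pieceCutIndex (a : N.Piece) : ℤ :=
  ∑ t ∈ (N.cutTimes (N.pieceEdge a)).filter (fun t => N.startTime a < t ∧ t < N.endTime a),
    (SignType.sign (Real.sin (N.angle (N.pieceEdge a) t)) : ℤ)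

/-- The intersection index of a path with `ρ`. -/
def pathCutIndex (P : List N.Piece) : ℤ := (P.map N.pieceCutIndex).sum

/-- The total turning of the tangent along a path, including the exterior angles at vertices. -/
def turning : List N.Piece → ℝ
  | [] => 0
  | [a] => N.angle (N.pieceEdge a) (N.endTime a) - N.angle (N.pieceEdge a) (N.startTime a)
  | a :: b :: P =>
      (N.angle (N.pieceEdge a) (N.endTime a) - N.angle (N.pieceEdge a) (N.startTime a)) +
      exteriorAngle (N.angle (N.pieceEdge a) (N.endTime a))
        (N.angle (N.pieceEdge b) (N.startTime b)) +
      turning (b :: P)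

/-- The increase of the vertical coordinate along the lift of a path to the universal cover. -/
def pathRise (P : List N.Piece) : ℝ :=
  (P.map fun a => (N.curve (N.pieceEdge a) (N.endTime a)).im -
    (N.curve (N.pieceEdge a) (N.startTime a)).im).sum

/-- The total turning, in the flat cylinder, of the loop `C_P` formed by the path `P` from `p` to
`q`, the arc of the right boundary circle that goes upwards from `q` to the endpoint of the cut, the
cut traversed from right to left, and the arc of the left boundary circle that goes upwards from
the endpoint of the cut to `p`. The loop has corners at `q`, at both endpoints of the cut and
at `p`. -/
def loopTurning (p q : N.RimPoint) (P : List N.Piece) : ℝ :=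
  N.turning P + exteriorAngle (N.angle q.1 q.2.1) (Real.pi / 2) +
    exteriorAngle (Real.pi / 2) Real.pi + exteriorAngle Real.pi (Real.pi / 2) +
    exteriorAngle (Real.pi / 2) (N.angle p.1 p.2.1)

/-- The winding number of the loop `C_P` around the cylinder. The lift of `P` goes from height `y`
to height `y + pathRise P`, the first arc ends at the next integer height, and the second arc ends
at the next height that is congruent to `y`. -/
def loopWinding (p : N.RimPoint) (P : List N.Piece) : ℤ :=
  ⌈(N.curve p.1 p.2.1).im + N.pathRise P⌉ - ⌊(N.curve p.1 p.2.1).im⌋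

/-- The rotation number of the loop `C_P` in the plane, where the cylinder `[0, 1] × ℝ/ℤ` is
identified with a plane annulus through `(x, y) ↦ (1 + x) exp(2πiy)`. A tangent vector with argument
`θ` at `(x, y)` has argument `θ + 2πy` in the plane. (The rounded number is an integer.) -/
def rotationNumber (p q : N.RimPoint) (P : List N.Piece) : ℤ :=
  round (N.loopTurning p q P / (2 * Real.pi)) + N.loopWinding p P

/-- The sign `(-1)^(r - 1)` of a path `P`, where `r` is the rotation number of the loop `C_P`. -/
def pathSign (p q : N.RimPoint) (P : List N.Piece) : ℤ :=
  (-1) ^ (N.rotationNumber p q P - 1).natAbs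

/-- The weights of the edges of the torus network, if `u` gives the weights of the edges of the
network on the cylinder: the product of the weights of the pieces. -/
def edgeWeight {A : Type*} [CommRing A] (u : N.Piece → A) (e : E) : A :=
  u (Sum.inl e) * ∏ t : {t : ℝ // t ∈ N.rimTimes e}, u (Sum.inr ⟨e, t⟩)

open Classical in
/-- The boundary measurement matrix `M(λ)` of the network on the cylinder as a matrix of formal
power series in the weights of the edges of that network: the entry with index `(p, q)` is the sum
over all paths `P` from `p` to `q` of the sign of `P` times `λ^d` times the product of the
weights of the edges of `P`, where `d` is the intersection index of `P` with the cut `ρ`.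
(The coefficient of the monomial with exponent vector `α` is a sum over the finitely many paths in
which each edge `a` is used exactly `α a` times.) -/
def boundaryMeasurement {K : Type*} [Field K] (lam : K) :
    Matrix N.RimPoint N.RimPoint (MvPowerSeries N.Piece K) :=
  Matrix.of fun p q => fun α =>
    ∑ P ∈ (Finsupp.toMultiset α).lists.toFinset.filter (N.IsPath p q),
      (N.pathSign p q P : K) * lam ^ N.pathCutIndex P

/-- `m` is the value of the boundary measurement matrix for the edge weights `u`: every entry of the
boundary measurement matrix is the expansion of a rational function `F / G` of the weights, whose
denominator does not vanish at `u`, and the entry of `m` is the value of `F / G` at `u`. -/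
def IsBoundaryMeasurementAt {K : Type*} [Field K] (lam : K) (u : N.Piece → K)
    (m : Matrix N.RimPoint N.RimPoint K) : Prop :=
  ∀ p q, ∃ F G : MvPolynomial N.Piece K,
    (G : MvPowerSeries N.Piece K) * N.boundaryMeasurement lam p q = (F : MvPowerSeries N.Piece K) ∧
    MvPolynomial.eval u G ≠ 0 ∧
    m p q = MvPolynomial.eval u F / MvPolynomial.eval u G

end PerfectTorusNetwork

/-! ### The networks `N̄_{k,n}` -/

/-- The vertices of one piece of `N̄_{k,n}`, which are the corners of a quadrilateral face: upper left
(black), upper right (white), lower left (white) and lower right (black). -/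
inductive CornerKind
  | ul | ur | ll | lr
  deriving DecidableEq

/-- The edges of one piece of `N̄_{k,n}`: the left (`ll → ul`), lower (`ll → lr`), upper (`ul → ur`) and
right (`ur → lr`) edge of the quadrilateral, the black-black edge from `lr` to `ul` of the next
piece, and the white-white edge from `ur` to `ll` of the piece which is `k - 1` steps further. -/
inductive EdgeKind
  | left | lower | upper | right | bb | ww
  deriving DecidableEq

instance : Fintype CornerKind where
  elems := {CornerKind.ul, CornerKind.ur, CornerKind.ll, CornerKind.lr}
  complete x := by cases x <;> simp

instance : Fintype EdgeKind where
  elems := {EdgeKind.left, EdgeKind.lower, EdgeKind.upper, EdgeKind.right, EdgeKind.bb, EdgeKind.ww}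
  complete x := by cases x <;> simp

namespace Nbar

/-- The cyclic shift by `m`. -/
def shift {n : ℕ} (m : ℕ) (i : Fin n) : Fin n :=
  ⟨(i.val + m) % n, Nat.mod_lt _ (Nat.lt_of_le_of_lt (Nat.zero_le _) i.isLt)⟩

/-- The tail of an edge. -/
def src {n : ℕ} : Fin n × EdgeKind → Fin n × CornerKind
  | (i, .left) => (i, .ll)
  | (i, .lower) => (i, .ll)
  | (i, .upper) => (i, .ul)
  | (i, .right) => (i, .ur)
  | (i, .bb) => (i, .lr)
  | (i, .ww) => (i, .ur)

/-- The head of an edge. -/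
def tgt (k : ℕ) {n : ℕ} : Fin n × EdgeKind → Fin n × CornerKind
  | (i, .left) => (i, .ul)
  | (i, .lower) => (i, .lr)
  | (i, .upper) => (i, .ur)
  | (i, .right) => (i, .lr)
  | (i, .bb) => (shift 1 i, .ul)
  | (i, .ww) => (shift (k - 1) i, .ll)

/-- The horizontal position of a vertex in its cell, relative to the width `1 / n` of the cell. -/
def cx : CornerKind → ℝ
  | .ul => 1 / 4
  | .ur => 1 / 2
  | .ll => 1 / 2
  | .lr => 3 / 4

/-- The vertical position of a vertex. -/
def cy : CornerKind → ℝ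
  | .ul => 9 / 20
  | .ur => 7 / 10
  | .ll => 1 / 5
  | .lr => 9 / 20

/-- The horizontal component of an edge, relative to the width `1 / n` of a cell. -/
def ex (k : ℕ) : EdgeKind → ℝ
  | .left => -1 / 4
  | .lower => 1 / 4
  | .upper => 1 / 4
  | .right => 1 / 4
  | .bb => 1 / 2
  | .ww => ((k - 1 : ℕ) : ℝ)

/-- The vertical component of an edge. -/
def ey : EdgeKind → ℝ
  | .left => 1 / 4
  | .lower => 1 / 4
  | .upper => 1 / 4
  | .right => -1 / 4
  | .bb => 0
  | .ww => 1 / 2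

/-- The position of a vertex. The `i`-th piece lies in the cell `[i / n, (i + 1) / n] × [0, 1]`. -/
def pos {n : ℕ} (v : Fin n × CornerKind) : ℂ := ⟨((v.1.val : ℝ) + cx v.2) / n, cy v.2⟩

/-- The vector from the tail to the head of an edge in the universal cover. -/
def vec (k : ℕ) {n : ℕ} (e : Fin n × EdgeKind) : ℂ := ⟨ex k e.2 / n, ey e.2⟩

/-- All edges are line segments in the universal cover. -/
def curve (k : ℕ) {n : ℕ} (e : Fin n × EdgeKind) (t : ℝ) : ℂ := pos (src e) + (t : ℂ) * vec k e

theorem n_pos {n : ℕ} (i : Fin n) : (0 : ℝ) < n := by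
  have := i.isLt
  exact_mod_cast (by omega : 0 < n)

theorem curve_re (k : ℕ) {n : ℕ} (e : Fin n × EdgeKind) (t : ℝ) :
    (curve k e t).re = ((e.1.val : ℝ) + cx (src e).2 + t * ex k e.2) / n := by
  have h1 : (src e).1 = e.1 := by rcases e with ⟨i, _ | _ | _ | _ | _ | _⟩ <;> rfl
  simp only [curve, Complex.add_re, Complex.mul_re, Complex.ofReal_re, Complex.ofReal_im, pos, vec,
    h1]
  ring

theorem curve_im (k : ℕ) {n : ℕ} (e : Fin n × EdgeKind) (t : ℝ) :
    (curve k e t).im = cy (src e).2 + t * ey e.2 := by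
  simp [curve, pos, vec]

theorem latticeEq_iff (a b : ℂ) :
    LatticeEq a b ↔ ∃ m n : ℤ, a.re - b.re = m ∧ a.im - b.im = n := by
  unfold LatticeEq
  constructor
  · rintro ⟨m, n, h⟩
    refine ⟨m, n, ?_, ?_⟩
    · simpa using congrArg Complex.re h
    · simpa using congrArg Complex.im h
  · rintro ⟨m, n, h1, h2⟩
    refine ⟨m, n, Complex.ext ?_ ?_⟩
    · simpa using h1
    · simpa using h2

/-- Lattice equality for points given by their cell coordinates. -/
theorem cell_eq {n : ℕ} {i j : Fin n} {a b : ℝ} {m : ℤ}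
    (h : ((i.val : ℝ) + a) / n - ((j.val : ℝ) + b) / n = m) :
    ∃ J : ℤ, (J : ℝ) + a - b = 0 ∧ (J = 0 → i = j) := by
  have hn := n_pos i
  refine ⟨(i.val : ℤ) - j.val - n * m, ?_, ?_⟩
  · push_cast
    field_simp at h
    linarith
  · intro h0
    have hi := i.isLt
    have hj := j.isLt
    apply Fin.ext
    have hd : (n : ℤ) ∣ (i.val : ℤ) - j.val := ⟨m, by linarith⟩
    have := Int.eq_zero_of_abs_lt_dvd hd (by rw [abs_lt]; constructor <;> omega)
    omega

theorem int_eq_zero {m : ℤ} (h1 : (-1 : ℝ) < m) (h2 : (m : ℝ) < 1) : m = 0 := by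
  have h1' : -1 < m := by exact_mod_cast h1
  have h2' : m < 1 := by exact_mod_cast h2
  omega

theorem int_not_between {m : ℤ} (a : ℤ) (h1 : (a : ℝ) < m) (h2 : (m : ℝ) < a + 1) : False := by
  have h1' : a < m := by exact_mod_cast h1
  have h2' : m < a + 1 := by exact_mod_cast h2
  omega

theorem int_three {m : ℤ} (h1 : (-2 : ℝ) < m) (h2 : (m : ℝ) < 2) : m = -1 ∨ m = 0 ∨ m = 1 := by
  have h1' : -2 < m := by exact_mod_cast h1
  have h2' : m < 2 := by exact_mod_cast h2
  omega

theorem vec_ne (k : ℕ) {n : ℕ} (e : Fin n × EdgeKind) : vec k e ≠ 0 := by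
  have hn := n_pos e.1
  intro h
  have hr : ex k e.2 / n = 0 := congrArg Complex.re h
  have hi : ey e.2 = 0 := congrArg Complex.im h
  rcases e with ⟨i, _ | _ | _ | _ | _ | _⟩ <;> norm_num [ex, ey] at hr hi
  exact hn.ne' (by exact_mod_cast hr)

theorem shift_bijective {n : ℕ} (m : ℕ) : Function.Bijective (shift m : Fin n → Fin n) := by
  rw [← Finite.injective_iff_bijective]
  intro i j h
  have h' : (i.val + m) % n = (j.val + m) % n := congrArg Fin.val h
  have := Nat.ModEq.add_right_cancel' m h'
  exact Fin.ext (by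
    have h2 : i.val % n = j.val % n := this
    rwa [Nat.mod_eq_of_lt i.isLt, Nat.mod_eq_of_lt j.isLt] at h2)

theorem shift_latticeEq {n : ℕ} (i : Fin n) (m : ℕ) (a : ℝ) :
    ∃ q : ℤ, ((i.val : ℝ) + m + a) / n - (((shift m i).val : ℝ) + a) / n = q := by
  have hn := n_pos i
  refine ⟨((i.val + m) / n : ℕ), ?_⟩
  have h : (i.val + m) % n + n * ((i.val + m) / n) = i.val + m := Nat.mod_add_div _ _
  have h' : (((i.val + m) % n : ℕ) : ℝ) + n * (((i.val + m) / n : ℕ) : ℝ) = i.val + m := by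
    exact_mod_cast h
  rw [← sub_div, div_eq_iff hn.ne']
  simp only [shift, Int.cast_natCast]
  linarith

theorem linear_finite (a b : ℝ) (h : b = 0 → ∀ m : ℤ, a ≠ m) :
    {t : ℝ | t ∈ Set.Ioo (0 : ℝ) 1 ∧ ∃ m : ℤ, a + t * b = m}.Finite := by
  by_cases hb : b = 0
  · convert Set.finite_empty
    ext t
    simp only [Set.mem_ofPred_eq, Set.mem_empty_iff_false, iff_false]
    rintro ⟨-, m, hm⟩
    exact h hb m (by rw [← hm, hb]; ring)
  · have hinj : Set.InjOn (fun t : ℝ => a + t * b)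
        {t : ℝ | t ∈ Set.Ioo (0 : ℝ) 1 ∧ ∃ m : ℤ, a + t * b = m} := by
      intro s _ t _ hst
      simpa [hb] using hst
    refine Set.Finite.of_finite_image (Set.Finite.subset
      ((Set.finite_Icc (⌊a - |b|⌋) (⌈a + |b|⌉)).image (fun m : ℤ => (m : ℝ))) ?_) hinj
    rintro _ ⟨t, ⟨⟨h0, h1⟩, m, hm⟩, rfl⟩
    refine ⟨m, ⟨?_, ?_⟩, hm.symm⟩
    · have : a - |b| ≤ m := by
        rw [← hm]; nlinarith [neg_abs_le b, abs_nonneg b]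
      exact_mod_cast (Int.floor_le _).trans this
    · have : (m : ℝ) ≤ a + |b| := by
        rw [← hm]; nlinarith [le_abs_self b, abs_nonneg b]
      exact_mod_cast this.trans (Int.le_ceil _)

theorem has_deriv (k : ℕ) {n : ℕ} (e : Fin n × EdgeKind) (t : ℝ) (_ : t ∈ Set.Icc (0 : ℝ) 1) :
    HasDerivWithinAt (curve k e)
      ((‖vec k e‖ : ℂ) * Complex.exp ((Complex.arg (vec k e) : ℂ) * Complex.I))
      (Set.Icc 0 1) t := by
  rw [Complex.norm_mul_exp_arg_mul_I]
  have h : HasDerivAt (fun s : ℝ => pos (src e) + (s : ℂ) * vec k e) (1 * vec k e) t :=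
    ((Complex.ofRealCLM.hasDerivAt (x := t)).mul_const (vec k e)).const_add _
  rw [one_mul] at h
  exact h.hasDerivWithinAt

theorem curve_one (k : ℕ) {n : ℕ} (e : Fin n × EdgeKind) :
    LatticeEq (curve k e 1) (pos (tgt k e)) := by
  rw [latticeEq_iff, curve_re, curve_im]
  rcases e with ⟨i, _ | _ | _ | _ | _ | _⟩
  · exact ⟨0, 0, by simp only [src, tgt, pos, cx, ex]; push_cast; ring,
      by norm_num [src, tgt, pos, cy, ey]⟩
  · exact ⟨0, 0, by simp only [src, tgt, pos, cx, ex]; push_cast; ring,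
      by norm_num [src, tgt, pos, cy, ey]⟩
  · exact ⟨0, 0, by simp only [src, tgt, pos, cx, ex]; push_cast; ring,
      by norm_num [src, tgt, pos, cy, ey]⟩
  · exact ⟨0, 0, by simp only [src, tgt, pos, cx, ex]; push_cast; ring,
      by norm_num [src, tgt, pos, cy, ey]⟩
  · obtain ⟨q, hq⟩ := shift_latticeEq i 1 (1 / 4)
    refine ⟨q, 0, ?_, by norm_num [src, tgt, pos, cy, ey]⟩
    rw [← hq]
    simp only [src, tgt, pos, cx, ex]
    push_cast
    ring
  · obtain ⟨q, hq⟩ := shift_latticeEq i (k - 1) (1 / 2)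
    refine ⟨q, 1, ?_, by norm_num [src, tgt, pos, cy, ey]⟩
    rw [← hq]
    simp only [src, tgt, pos, cx, ex]
    ring

theorem pos_inj {n : ℕ} (v v' : Fin n × CornerKind) (h : LatticeEq (pos v) (pos v')) :
    v = v' := by
  rw [latticeEq_iff] at h
  obtain ⟨m, m', h1, h2⟩ := h
  rcases v with ⟨i, a⟩
  rcases v' with ⟨j, b⟩
  obtain ⟨J, hJ, hJ'⟩ := cell_eq h1
  have h2' : cy a - cy b = m' := h2
  have hm : m' = 0 := by
    apply int_eq_zero <;> rw [← h2'] <;> cases a <;> cases b <;> norm_num [cy]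
  rw [hm] at h2'
  have hJ0 : J = 0 := by
    apply int_eq_zero
    · cases a <;> cases b <;> simp only [cx] at hJ <;> linarith
    · cases a <;> cases b <;> simp only [cx] at hJ <;> linarith
  obtain rfl : i = j := hJ' hJ0
  rw [hJ0] at hJ
  cases a <;> cases b <;> first | rfl | (exfalso; simp only [cx, cy] at hJ h2'; push_cast at hJ h2'; linarith)

theorem curve_avoid (k : ℕ) {n : ℕ} (e : Fin n × EdgeKind) (t : ℝ) (ht : t ∈ Set.Ioo (0 : ℝ) 1)
    (v : Fin n × CornerKind) : ¬ LatticeEq (curve k e t) (pos v) := by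
  intro h
  rw [latticeEq_iff, curve_re, curve_im] at h
  obtain ⟨m, m', h1, h2⟩ := h
  obtain ⟨h0, h0'⟩ := ht
  rcases v with ⟨j, b⟩
  rcases e with ⟨i, a⟩
  simp only [pos] at h1 h2
  rw [add_assoc] at h1
  obtain ⟨J, hJ, -⟩ := cell_eq h1
  have hw : a ≠ .ww := by
    rintro rfl
    apply int_not_between (m := m') 0 <;> rw [← h2] <;> cases b <;> simp only [src, cy, ey] <;>
      push_cast <;> linarith
  have hm : m' = 0 := by
    apply int_eq_zero <;> rw [← h2] <;> cases a <;> cases b <;>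
      first | exact absurd rfl hw | (simp only [src, cy, ey]; linarith)
  rw [hm] at h2
  have hJ3 : J = -1 ∨ J = 0 ∨ J = 1 := by
    apply int_three
    · cases a <;> cases b <;> first | exact absurd rfl hw | (simp only [src, cx, ex] at hJ; linarith)
    · cases a <;> cases b <;> first | exact absurd rfl hw | (simp only [src, cx, ex] at hJ; linarith)
  rcases hJ3 with rfl | rfl | rfl <;> cases a <;> cases b <;>
    first
    | exact absurd rfl hw
    | (simp only [src, cx, cy, ex, ey] at hJ h2; push_cast at hJ h2; linarith)

theorem curve_inj (k : ℕ) {n : ℕ} (e e' : Fin n × EdgeKind) (t : ℝ) (ht : t ∈ Set.Ioo (0 : ℝ) 1)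
    (t' : ℝ) (ht' : t' ∈ Set.Ioo (0 : ℝ) 1) (h : LatticeEq (curve k e t) (curve k e' t')) :
    e = e' ∧ t = t' := by
  rw [latticeEq_iff, curve_re, curve_im, curve_re, curve_im] at h
  obtain ⟨m, m', h1, h2⟩ := h
  obtain ⟨h0, h0'⟩ := ht
  obtain ⟨k0, k0'⟩ := ht'
  rcases e with ⟨i, a⟩
  rcases e' with ⟨j, b⟩
  simp only [add_assoc] at h1
  obtain ⟨J, hJ, hJ'⟩ := cell_eq h1
  by_cases hab : a = .ww ∨ b = .ww
  · have hab' : a = .ww ∧ b = .ww := by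
      rcases hab with rfl | rfl
      · refine ⟨rfl, ?_⟩
        by_contra hb
        apply int_not_between (m := m') 0 <;> rw [← h2] <;> cases b <;>
          first | exact absurd rfl hb | (simp only [src, cy, ey]; push_cast; linarith)
      · refine ⟨?_, rfl⟩
        by_contra hb
        apply int_not_between (m := m') (-1) <;> rw [← h2] <;> cases a <;>
          first | exact absurd rfl hb | (simp only [src, cy, ey]; push_cast; linarith)
    obtain ⟨rfl, rfl⟩ := hab'
    have hm : m' = 0 := by
      apply int_eq_zero <;> rw [← h2] <;> simp only [src, cy, ey] <;> linarith
    rw [hm] at h2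
    have htt : t = t' := by
      simp only [src, cy, ey] at h2
      push_cast at h2
      linarith
    subst htt
    have hJ0 : (J : ℝ) = 0 := by simp only [src] at hJ; linarith
    exact ⟨by rw [hJ' (by exact_mod_cast hJ0)], rfl⟩
  · rw [not_or] at hab
    obtain ⟨ha, hb⟩ := hab
    clear h1
    have hx : ∀ (i : Fin n) (c : EdgeKind), cx (src (i, c)).2 = match c with
        | .left => 1 / 2 | .lower => 1 / 2 | .upper => 1 / 4
        | .right => 1 / 2 | .bb => 3 / 4 | .ww => 1 / 2 := by
      intro i c; cases c <;> rfl
    have hy : ∀ (i : Fin n) (c : EdgeKind), cy (src (i, c)).2 = match c with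
        | .left => 1 / 5 | .lower => 1 / 5 | .upper => 9 / 20
        | .right => 7 / 10 | .bb => 9 / 20 | .ww => 7 / 10 := by
      intro i c; cases c <;> rfl
    simp only [hx] at hJ
    simp only [hy] at h2
    clear hx hy
    have hm : m' = 0 := by
      apply int_eq_zero <;> rw [← h2] <;> clear hJ hJ' h2 <;> cases a <;>
        first
        | exact absurd rfl ha
        | (clear ha
           cases b <;> first
            | exact absurd rfl hb
            | (simp only [ey]; linarith))
    rw [hm, Int.cast_zero] at h2
    clear hm
    have hJ3 : J = -1 ∨ J = 0 ∨ J = 1 := by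
      apply int_three <;> clear h2 hJ' <;> cases a <;>
        first
        | exact absurd rfl ha
        | (clear ha
           cases b <;> first
            | exact absurd rfl hb
            | (simp only [ex] at hJ; linarith))
    have hJt : J = 0 ∧ a = b ∧ t = t' := by
      clear hJ'
      rcases hJ3 with rfl | rfl | rfl <;> push_cast at hJ <;> cases a <;>
        first
        | exact absurd rfl ha
        | (clear ha
           cases b <;> first
            | exact absurd rfl hb
            | (exfalso; simp only [ex, ey] at hJ h2; linarith)
            | (refine ⟨rfl, rfl, ?_⟩; simp only [ex, ey] at hJ h2; linarith))
    obtain ⟨hJ0, rfl, rfl⟩ := hJt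
    exact ⟨by rw [hJ' hJ0], rfl⟩

theorem ncard_one {α : Type*} {s : Set α} (a : α) (h : ∀ x, x ∈ s ↔ x = a) : s.ncard = 1 := by
  rw [Set.ncard_eq_one]
  exact ⟨a, Set.ext h⟩

theorem ncard_two {α : Type*} {s : Set α} (a b : α) (hab : a ≠ b)
    (h : ∀ x, x ∈ s ↔ x = a ∨ x = b) : s.ncard = 2 := by
  rw [Set.ncard_eq_two]
  exact ⟨a, b, hab, Set.ext h⟩

theorem perfect (k : ℕ) {n : ℕ} (v : Fin n × CornerKind) :
    ({e : Fin n × EdgeKind | tgt k e = v}.ncard = 1 ∧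
      {e : Fin n × EdgeKind | src e = v}.ncard = 2) ∨
    ({e : Fin n × EdgeKind | tgt k e = v}.ncard = 2 ∧
      {e : Fin n × EdgeKind | src e = v}.ncard = 1) := by
  rcases v with ⟨i, _ | _ | _ | _⟩
  · right
    obtain ⟨j, hj⟩ := (shift_bijective 1).2 i
    refine ⟨ncard_two (i, .left) (j, .bb) (by simp) ?_, ncard_one (i, .upper) ?_⟩
    · rintro ⟨i', _ | _ | _ | _ | _ | _⟩ <;> simp [tgt, ← hj, (shift_bijective 1).1.eq_iff]
    · rintro ⟨i', _ | _ | _ | _ | _ | _⟩ <;> simp [src]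
  · left
    refine ⟨ncard_one (i, .upper) ?_, ncard_two (i, .right) (i, .ww) (by simp) ?_⟩
    · rintro ⟨i', _ | _ | _ | _ | _ | _⟩ <;> simp [tgt]
    · rintro ⟨i', _ | _ | _ | _ | _ | _⟩ <;> simp [src]
  · left
    obtain ⟨j, hj⟩ := (shift_bijective (k - 1)).2 i
    refine ⟨ncard_one (j, .ww) ?_, ncard_two (i, .left) (i, .lower) (by simp) ?_⟩
    · rintro ⟨i', _ | _ | _ | _ | _ | _⟩ <;> simp [tgt, ← hj, (shift_bijective (k - 1)).1.eq_iff]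
    · rintro ⟨i', _ | _ | _ | _ | _ | _⟩ <;> simp [src]
  · right
    refine ⟨ncard_two (i, .lower) (i, .right) (by simp) ?_, ncard_one (i, .bb) ?_⟩
    · rintro ⟨i', _ | _ | _ | _ | _ | _⟩ <;> simp [tgt]
    · rintro ⟨i', _ | _ | _ | _ | _ | _⟩ <;> simp [src]

theorem cos_arg_sub {a b : ℂ} (ha : a ≠ 0) (hb : b ≠ 0)
    (h : Real.cos (Complex.arg a - Complex.arg b) = -1) :
    a.re * b.im = a.im * b.re ∧ a.re * b.re + a.im * b.im < 0 := by
  have hna := norm_pos_iff.mpr ha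
  have hnb := norm_pos_iff.mpr hb
  have hs : Real.sin (Complex.arg a - Complex.arg b) = 0 := by
    have := Real.sin_sq_add_cos_sq (Complex.arg a - Complex.arg b)
    rw [h] at this
    nlinarith
  rw [Real.sin_sub, Complex.sin_arg, Complex.sin_arg, Complex.cos_arg ha, Complex.cos_arg hb] at hs
  rw [Real.cos_sub, Complex.sin_arg, Complex.sin_arg, Complex.cos_arg ha, Complex.cos_arg hb] at h
  field_simp at hs h
  constructor
  · linarith
  · nlinarith [mul_pos hna hnb]

theorem no_cusp (k : ℕ) {n : ℕ} (e f : Fin n × EdgeKind) (h : tgt k e = src f) :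
    Real.cos (Complex.arg (vec k f) - Complex.arg (vec k e)) ≠ -1 := by
  intro hc
  obtain ⟨h1, h2⟩ := cos_arg_sub (vec_ne k f) (vec_ne k e) hc
  have hn := n_pos e.1
  simp only [vec] at h1 h2
  have hk : (0 : ℝ) ≤ ((k - 1 : ℕ) : ℝ) := Nat.cast_nonneg _
  set c : ℝ := ((k - 1 : ℕ) : ℝ) with hcdef
  have hn' : (0 : ℝ) < 1 / n := by positivity
  have hck : 0 ≤ c / n := by positivity
  set d : ℝ := 1 / (n : ℝ) with hd
  have hdiv : ∀ x : ℝ, x / n = x * d := fun x => by rw [hd]; ring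
  rcases e with ⟨i, _ | _ | _ | _ | _ | _⟩ <;> rcases f with ⟨j, _ | _ | _ | _ | _ | _⟩ <;>
    simp [tgt, src] at h <;> simp only [ex, ey, hdiv] at h1 h2 hck <;> nlinarith [mul_pos hn' hn']

theorem pos_rim {n : ℕ} (v : Fin n × CornerKind) (m : ℤ) : (pos v).re ≠ m := by
  intro h
  have hn := n_pos v.1
  simp only [pos] at h
  rw [div_eq_iff hn.ne'] at h
  have h' : cx v.2 = ((m * n - v.1.val : ℤ) : ℝ) := by push_cast; linarith
  apply int_not_between (m := m * n - v.1.val) 0 <;> rw [← h'] <;> cases v.2 <;> norm_num [cx]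

theorem pos_cut {n : ℕ} (v : Fin n × CornerKind) (m : ℤ) : (pos v).im ≠ m := by
  intro h
  simp only [pos] at h
  apply int_not_between (m := m) 0 <;> rw [← h] <;> cases v.2 <;> norm_num [cy]

theorem eq_ww_of_im (k : ℕ) {n : ℕ} (e : Fin n × EdgeKind) (t : ℝ) (ht : t ∈ Set.Ioo (0 : ℝ) 1)
    (m : ℤ) (h : (curve k e t).im = m) : e.2 = .ww ∧ t = 3 / 5 := by
  obtain ⟨h0, h0'⟩ := ht
  rw [curve_im] at h
  rcases e with ⟨i, a⟩
  by_cases ha : a = .ww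
  · subst ha
    refine ⟨rfl, ?_⟩
    have hm : m - 1 = 0 := by
      apply int_eq_zero <;> push_cast <;> rw [← h] <;> simp only [src, cy, ey] <;> linarith
    have hm' : m = 1 := by omega
    rw [hm'] at h
    simp only [src, cy, ey] at h
    push_cast at h
    linarith
  · exfalso
    apply int_not_between (m := m) 0 <;> rw [← h] <;> cases a <;>
      first | exact absurd rfl ha | (simp only [src, cy, ey]; push_cast; linarith)

theorem avoid_corner (k : ℕ) {n : ℕ} (e : Fin n × EdgeKind) (t : ℝ) (ht : t ∈ Set.Ioo (0 : ℝ) 1)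
    (m m' : ℤ) (h : (curve k e t).re = m) : (curve k e t).im ≠ m' := by
  intro h'
  obtain ⟨h1, rfl⟩ := eq_ww_of_im k e t ht m' h'
  have hn := n_pos e.1
  rcases e with ⟨i, a⟩
  obtain rfl : a = .ww := h1
  rw [curve_re, div_eq_iff hn.ne'] at h
  simp only [src, cx, ex] at h
  have h2 : (10 * i.val + 5 + 6 * (k - 1 : ℕ) : ℝ) = 10 * (m * n) := by linarith
  have h3 : (10 * (i.val : ℤ) + 5 + 6 * ((k - 1 : ℕ) : ℤ)) = 10 * (m * n) := by exact_mod_cast h2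
  omega

theorem re_pos_of_re (k : ℕ) {n : ℕ} (e : Fin n × EdgeKind) (t : ℝ)
    (ht : t ∈ Set.Ioo (0 : ℝ) 1) (m : ℤ) (h : (curve k e t).re = m) : 0 < (vec k e).re := by
  obtain ⟨h0, h0'⟩ := ht
  have hn := n_pos e.1
  rw [curve_re, div_eq_iff hn.ne'] at h
  rcases e with ⟨i, a⟩
  have h' : cx (src (i, a)).2 + t * ex k a = ((m * n - i.val : ℤ) : ℝ) := by
    push_cast
    simp only at h
    linarith
  simp only [vec]
  cases a
  case left => exact (int_not_between (m := m * n - i.val) 0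
    (by rw [← h']; simp only [src, cx, ex]; push_cast; linarith)
    (by rw [← h']; simp only [src, cx, ex]; push_cast; linarith)).elim
  case ww =>
    rcases Nat.eq_zero_or_pos (k - 1) with hk | hk
    · exact (int_not_between (m := m * n - i.val) 0
        (by rw [← h']; simp only [src, cx, ex, hk]; push_cast; linarith)
        (by rw [← h']; simp only [src, cx, ex, hk]; push_cast; linarith)).elim
    · simp only [ex]
      have : (0 : ℝ) < ((k - 1 : ℕ) : ℝ) := by exact_mod_cast hk
      positivity
  all_goals simp only [ex]; positivity

theorem rim_transversal (k : ℕ) {n : ℕ} (e : Fin n × EdgeKind) (t : ℝ)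
    (ht : t ∈ Set.Ioo (0 : ℝ) 1) (m : ℤ) (h : (curve k e t).re = m) :
    Real.cos (Complex.arg (vec k e)) ≠ 0 := by
  rw [Complex.cos_arg (vec_ne k e)]
  exact (div_pos (re_pos_of_re k e t ht m h) (norm_pos_iff.mpr (vec_ne k e))).ne'

theorem cut_transversal (k : ℕ) {n : ℕ} (e : Fin n × EdgeKind) (t : ℝ)
    (ht : t ∈ Set.Ioo (0 : ℝ) 1) (m : ℤ) (h : (curve k e t).im = m) :
    Real.sin (Complex.arg (vec k e)) ≠ 0 := by
  rw [Complex.sin_arg]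
  obtain ⟨h1, -⟩ := eq_ww_of_im k e t ht m h
  have : (0 : ℝ) < (vec k e).im := by simp only [vec, h1, ey]; norm_num
  exact (div_pos this (norm_pos_iff.mpr (vec_ne k e))).ne'

theorem rim_finite (k : ℕ) {n : ℕ} (e : Fin n × EdgeKind) :
    {t : ℝ | t ∈ Set.Ioo (0 : ℝ) 1 ∧ ∃ m : ℤ, (curve k e t).re = m}.Finite := by
  have hn := n_pos e.1
  have h := linear_finite (pos (src e)).re (vec k e).re (fun _ m => pos_rim _ m)
  refine h.subset ?_
  rintro t ⟨ht, m, hm⟩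
  exact ⟨ht, m, by rw [← hm]; simp [curve]⟩

theorem cut_finite (k : ℕ) {n : ℕ} (e : Fin n × EdgeKind) :
    {t : ℝ | t ∈ Set.Ioo (0 : ℝ) 1 ∧ ∃ m : ℤ, (curve k e t).im = m}.Finite := by
  have h := linear_finite (pos (src e)).im (vec k e).im (fun _ m => pos_cut _ m)
  refine h.subset ?_
  rintro t ⟨ht, m, hm⟩
  exact ⟨ht, m, by rw [← hm]; simp [curve]⟩

/-- The underlying perfect network of `N̄_{k,n}` on the torus, together with its rim and cut. -/
def _root_.torusNetworkNbar (k n : ℕ) :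
    PerfectTorusNetwork (Fin n × CornerKind) (Fin n × EdgeKind) where
  src := src
  tgt := tgt k
  pos := pos
  curve := curve k
  speed e _ := ‖vec k e‖
  angle e _ := Complex.arg (vec k e)
  speed_pos e _ _ := norm_pos_iff.mpr (vec_ne k e)
  speed_cont _ := continuousOn_const
  angle_cont _ := continuousOn_const
  hasDeriv := has_deriv k
  curve_zero e := ⟨0, 0, by simp [curve]⟩
  curve_one := curve_one k
  pos_inj := pos_inj
  curve_avoid := curve_avoid k
  curve_inj := curve_inj k
  perfect := perfect k
  no_cusp := no_cusp k
  pos_rim := pos_rim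
  pos_cut := pos_cut
  avoid_corner := avoid_corner k
  rim_transversal := rim_transversal k
  cut_transversal := cut_transversal k
  rim_finite := rim_finite k
  cut_finite := cut_finite k

end Nbar

variable {K : Type*}

/-- The edge weights of `N̄_{k,n}`: the left edge of the `i`-th quadrilateral has weight `x i`, its lower
edge has weight `y i`, and all other edges have weight `1`. -/
def nbarWeight [One K] {n : ℕ} (x y : Fin n → K) : Fin n × EdgeKind → K
  | (i, .left) => x i
  | (i, .lower) => y i
  | _ => 1

/-! ### The matrices `M_{k,n}(λ)` and `A_{k,n}(z)` -/

/-- The boundary measurement matrix `L_i(λ)` of an elementary network, where `x = x_i` and `y = y_i`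
(rows and columns are numbered from `0`). -/
def elementaryMatrix [CommRing K] (k : ℕ) (lam x y : K) : Matrix (Fin k) (Fin k) K :=
  Matrix.of fun a b =>
    if k = 2 then
      if a.val = 0 then (if b.val = 0 then -lam * x else x + y)
      else (if b.val = 0 then -lam else 1)
    else if a.val = 0 then
      if b.val + 2 = k then x else if b.val + 1 = k then x + y else 0
    else if a.val = 1 then
      if b.val = 0 then -lam else 0
    else if b.val + 1 = a.val then 1
    else if a.val + 1 = k ∧ b.val + 1 = k then 1
    else 0

/-- `M_{k,n}(λ) = L_1(λ) ⋯ L_n(λ)`, the boundary measurement matrix of `N_{k,n}`. -/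
def monodromyMatrix [CommRing K] (k : ℕ) {n : ℕ} (x y : Fin n → K) (lam : K) :
    Matrix (Fin k) (Fin k) K :=
  (List.ofFn fun i => elementaryMatrix k lam (x i) (y i)).prod

/-- `Z = -z e_{n1} + ∑_{i < n} e_{i,i+1}` (rows and columns are numbered from `0`). -/
def shiftMatrix [CommRing K] (n : ℕ) (z : K) : Matrix (Fin n) (Fin n) K :=
  Matrix.of fun a b =>
    if a.val + 1 = b.val then 1 else if a.val + 1 = n ∧ b.val = 0 then -z else 0

/-- `A_{k,n}(z) = Z (D_x + D_y Z) Z^(k-2) (1 - Z)⁻¹`, the boundary measurement matrix of the conjugate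
network `N'_{k,n}`. -/
def conjugateMatrix [Field K] (k : ℕ) {n : ℕ} (x y : Fin n → K) (z : K) :
    Matrix (Fin n) (Fin n) K :=
  shiftMatrix n z * (Matrix.diagonal x + Matrix.diagonal y * shiftMatrix n z) *
    shiftMatrix n z ^ (k - 2) * (1 - shiftMatrix n z)⁻¹

end

/-! The identity compares determinants of the form `det (1 - T)`, where `T` is a weighted adjacency
matrix. Expanded along rows, such a determinant is a sum over collections of disjoint simple cycles
in which every cycle contributes minus the product of its edge factors (`det_one_sub_transfer`). The
indices `d_λ` and `d_z` are additive over edges, and for an ideal rim `d_z` counts crossings. So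
`𝔓(λ, z)` is such a determinant, with edge factors `(-1)^d λ^d (-z)^c w`, where `d` is the cut index
and `c` the number of rim crossings of the edge (`IsIdealRim.partitionFunction_eq_det`).

On the cylinder, suppose that path weights are multiplicative over pieces. Let `D` be the diagonal
matrix of piece weights, let `Q₀`, `Q` record which vertex or sink a piece ends at, and `S₀`, `S`
which vertex or source it starts at. The matrix of path sums is then `S W` with `(1 - D Q₀ S₀) W = D
Q`, and `det (1 + AB) = det (1 + BA)` yields `det (1 + z S W) det (1 - D Q₀ S₀) = det (1 - D (Q₀ S₀
- z Q S))`. Gluing sinks to sources at the price `-z` restores the torus: elimination of the rim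
points leaves a determinant over the vertices of the torus network (`det_one_sub_piece`,
`det_one_add_smul_paths`).

It remains to make the sign `(-1)^(r - 1)` multiplicative. An exterior angle is the difference of
two directions plus a whole number of turns, `angleBranch`. Every vertex has only one incoming or
only one outgoing edge, so this number splits into a contribution `ke` of the incoming and a
contribution `ks` of the outgoing edge (`exists_corner_split`). At an ideal rim all directions are
within a right angle of the horizontal, so they can be rounded to whole turns. Everything
telescopes: `r - 1` is a sum of integers attached to the pieces plus `d_λ`
(`IsIdealRim.rotationNumber_eq`). The resulting edge factors are those of `𝔓` up to `(-1)^(ks +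
ke)`, and around a cycle the exponents `ks + ke` add up to its total turning, counted in full turns.
For a non-contractible cycle this is `0`, by Hopf's secant argument on the universal cover
(`turning_eq_zero`). The extra signs therefore do not change the determinant (`det_transfer_twist`).

The identity is proved over any commutative `K`-algebra. It is applied over power series, and over
`K` with solutions obtained from Cramer's rule.

In the Corollary all three expressions equal `det (1 - Z + λ Z^(k-1) (D_x + D_y Z))`, by block
elimination. This does not pass through boundary measurements, so `λ = 0` is allowed. -/

/-! ### Turning of translation invariant curves -/

theorem re_exp_mul (r a b : ℝ) :
    ((r : ℂ) * Complex.exp ((a : ℂ) * Complex.I) * Complex.exp (-(b : ℂ) * Complex.I)).re =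
      r * Real.cos (a - b) := by
  rw [mul_assoc, ← Complex.exp_add, ← add_mul]
  have : ((a : ℂ) + -(b : ℂ)) = ((a - b : ℝ) : ℂ) := by push_cast; ring
  rw [this, Complex.re_ofReal_mul, Complex.exp_ofReal_mul_I_re]

/-- A curve whose direction stays within a right angle of `b` moves forward in the direction `b`. -/
theorem re_sub_mul_exp_pos {f : ℝ → ℂ} {v α : ℝ → ℝ} {s t b : ℝ} (hst : s < t)
    (hf : ∀ τ ∈ Set.Icc s t, HasDerivWithinAt f
      ((v τ : ℂ) * Complex.exp ((α τ : ℂ) * Complex.I)) (Set.Icc s t) τ)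
    (hv : ∀ τ ∈ Set.Icc s t, 0 < v τ) (hα : ∀ τ ∈ Set.Icc s t, 0 < Real.cos (α τ - b)) :
    0 < ((f t - f s) * Complex.exp (-(b : ℂ) * Complex.I)).re := by
  set g : ℝ → ℝ := fun τ => (f τ * Complex.exp (-(b : ℂ) * Complex.I)).re with hg
  have hd : ∀ τ ∈ Set.Icc s t, HasDerivWithinAt g (v τ * Real.cos (α τ - b)) (Set.Icc s t) τ := by
    intro τ hτ
    have h := Complex.reCLM.hasFDerivAt.comp_hasDerivWithinAt τ
      ((hf τ hτ).mul_const (Complex.exp (-(b : ℂ) * Complex.I)))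
    rw [← re_exp_mul]
    exact h
  have hmono : StrictMonoOn g (Set.Icc s t) := by
    apply strictMonoOn_of_deriv_pos (convex_Icc s t)
    · exact fun τ hτ => (hd τ hτ).continuousWithinAt
    · intro τ hτ
      rw [interior_Icc] at hτ
      have hτ' := Set.Ioo_subset_Icc_self hτ
      rw [((hd τ hτ').hasDerivAt (Icc_mem_nhds hτ.1 hτ.2)).deriv]
      exact mul_pos (hv τ hτ') (hα τ hτ')
  have h := hmono (Set.left_mem_Icc.2 hst.le) (Set.right_mem_Icc.2 hst.le) hst
  simp only [hg] at h
  rw [sub_mul, Complex.sub_re]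
  linarith

theorem re_sub_mul_exp_nonneg {f : ℝ → ℂ} {v α : ℝ → ℝ} {s t b : ℝ} (hst : s ≤ t)
    (hf : ∀ τ ∈ Set.Icc s t, HasDerivWithinAt f
      ((v τ : ℂ) * Complex.exp ((α τ : ℂ) * Complex.I)) (Set.Icc s t) τ)
    (hv : ∀ τ ∈ Set.Icc s t, 0 < v τ) (hα : ∀ τ ∈ Set.Icc s t, 0 < Real.cos (α τ - b)) :
    0 ≤ ((f t - f s) * Complex.exp (-(b : ℂ) * Complex.I)).re := by
  rcases hst.eq_or_lt with rfl | h
  · simp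
  · exact (re_sub_mul_exp_pos h hf hv hα).le

theorem cos_pos_of_abs_lt {x : ℝ} (h : |x| < Real.pi / 2) : 0 < Real.cos x :=
  Real.cos_pos_of_mem_Ioo (abs_lt.1 h)

theorem abs_lt_pi_div_two_of_cos_pos {x : ℝ} (hx : |x| < Real.pi) (h : 0 < Real.cos x) :
    |x| < Real.pi / 2 := by
  by_contra! hc
  have := Real.cos_nonpos_of_pi_div_two_le_of_le hc (by linarith [Real.pi_pos])
  rw [Real.cos_abs] at this
  linarith

theorem exists_abs_sub_lt_of_cos_pos {x : ℝ} (h : 0 < Real.cos x) :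
    ∃ k : ℤ, |x - k * (2 * Real.pi)| < Real.pi / 2 := by
  have hp := Real.pi_pos
  set k := round (x / (2 * Real.pi))
  have hk := abs_sub_round (x / (2 * Real.pi))
  have h1 : |x - k * (2 * Real.pi)| ≤ Real.pi := by
    have : x - k * (2 * Real.pi) = (x / (2 * Real.pi) - k) * (2 * Real.pi) := by field_simp
    rw [this, abs_mul, abs_of_pos (by positivity : (0 : ℝ) < 2 * Real.pi)]
    nlinarith
  refine ⟨k, ?_⟩
  by_contra! hc
  have := Real.cos_nonpos_of_pi_div_two_le_of_le hc (by linarith)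
  rw [Real.cos_abs, Real.cos_sub_int_mul_two_pi] at this
  linarith

/-- An angle with positive cosine along an interval stays in the same branch. -/
theorem abs_sub_lt_of_cos_pos {φ : ℝ → ℝ} {s t : ℝ} (hst : s ≤ t)
    (hφ : ContinuousOn φ (Set.Icc s t)) (hc : ∀ τ ∈ Set.Icc s t, 0 < Real.cos (φ τ)) (k : ℤ)
    (h : |φ s - k * (2 * Real.pi)| < Real.pi) : |φ t - k * (2 * Real.pi)| < Real.pi / 2 := by
  have hc' : ∀ τ ∈ Set.Icc s t, 0 < Real.cos (φ τ - k * (2 * Real.pi)) := by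
    intro τ hτ
    rw [Real.cos_sub_int_mul_two_pi]
    exact hc τ hτ
  have hs := abs_lt_pi_div_two_of_cos_pos h (hc' s (Set.left_mem_Icc.2 hst))
  by_contra! hcon
  have hcont : ContinuousOn (fun τ => |φ τ - k * (2 * Real.pi)|) (Set.Icc s t) :=
    (hφ.sub continuousOn_const).abs
  obtain ⟨τ, hτ, hτ'⟩ := intermediate_value_Icc hst hcont ⟨hs.le, hcon⟩
  have := hc' τ hτ
  rw [← Real.cos_abs] at this
  simp only at hτ'
  rw [hτ', Real.cos_pi_div_two] at this
  exact lt_irrefl _ this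

theorem eventually_uniform {α : ℝ → ℝ} {a b μ : ℝ} (hα : ContinuousOn α (Set.Icc a b))
    (hμ : 0 < μ) : ∀ᶠ ε in nhdsWithin (0 : ℝ) (Set.Ioi 0),
      ∀ s ∈ Set.Icc a b, ∀ t ∈ Set.Icc a b, |s - t| ≤ ε → |α s - α t| < μ := by
  have h := isCompact_Icc.uniformContinuousOn_of_continuous hα
  rw [Metric.uniformContinuousOn_iff] at h
  obtain ⟨δ, hδ, h⟩ := h μ hμ
  filter_upwards [Ioo_mem_nhdsGT hδ] with ε hε s hs t ht hst
  exact h s hs t ht (lt_of_le_of_lt hst hε.2)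

/-- The argument of a short secant stays within a right angle of the tangent direction, in a fixed
branch, while the secant slides along one arc and past the corner at its end. Since the corner turns
by less than `π`, both arcs advance in the direction of the bisector there. -/
theorem turning_step {Γ : ℝ → ℂ} {v w α β : ℝ → ℝ} {a : ℝ}
    (hv : ∀ τ ∈ Set.Icc a (a + 1), 0 < v τ) (hw : ∀ τ ∈ Set.Icc (a + 1) (a + 2), 0 < w τ)
    (hα : ContinuousOn α (Set.Icc a (a + 1))) (hβ : ContinuousOn β (Set.Icc (a + 1) (a + 2)))
    (hΓα : ∀ τ ∈ Set.Icc a (a + 1), HasDerivWithinAt Γ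
      ((v τ : ℂ) * Complex.exp ((α τ : ℂ) * Complex.I)) (Set.Icc a (a + 1)) τ)
    (hΓβ : ∀ τ ∈ Set.Icc (a + 1) (a + 2), HasDerivWithinAt Γ
      ((w τ : ℂ) * Complex.exp ((β τ : ℂ) * Complex.I)) (Set.Icc (a + 1) (a + 2)) τ)
    (hext : |β (a + 1) - α (a + 1)| < Real.pi) :
    ∀ᶠ ε in nhdsWithin (0 : ℝ) (Set.Ioi 0), ∀ r θ : ℝ → ℝ, ContinuousOn θ (Set.Icc a (a + 1)) →
      (∀ s ∈ Set.Icc a (a + 1), 0 < r s ∧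
        Γ (s + ε) - Γ s = (r s : ℂ) * Complex.exp ((θ s : ℂ) * Complex.I)) →
      0 < Real.cos (θ a - α a) ∧
      ∀ k : ℤ, |θ a - α a - k * (2 * Real.pi)| < Real.pi / 2 →
        |θ (a + 1) - β (a + 1) - k * (2 * Real.pi)| < Real.pi / 2 := by
  -- With this margin, directions near the corner differ from the bisector `mid` by less than `|β -
  -- α| / 2 + μ = π / 2`.
  set μ := (Real.pi - |β (a + 1) - α (a + 1)|) / 2 with hμ
  have hμ0 : 0 < μ := by rw [hμ]; linarith
  have hpi := Real.pi_pos
  have hμ1 : μ ≤ Real.pi / 2 := by rw [hμ]; linarith [abs_nonneg (β (a + 1) - α (a + 1))]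
  filter_upwards [eventually_uniform hα hμ0, eventually_uniform hβ hμ0,
    Ioo_mem_nhdsGT (show (0 : ℝ) < 1 by norm_num)] with ε h1 h2 hε r θ hθ hr
  obtain ⟨hε0, hε1⟩ := hε
  have hcos : ∀ s ∈ Set.Icc a (a + 1), ∀ b : ℝ,
      0 < ((Γ (s + ε) - Γ s) * Complex.exp (-(b : ℂ) * Complex.I)).re → 0 < Real.cos (θ s - b) := by
    intro s hs b hb
    rw [(hr s hs).2, re_exp_mul] at hb
    exact (pos_iff_pos_of_mul_pos hb).1 (hr s hs).1
  -- The secant still lies on the first arc.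
  have hA : ∀ s ∈ Set.Icc a (a + 1 - ε), 0 < Real.cos (θ s - α s) := by
    intro s hs
    have hsub : Set.Icc s (s + ε) ⊆ Set.Icc a (a + 1) :=
      Set.Icc_subset_Icc hs.1 (by linarith [hs.2])
    apply hcos s ⟨hs.1, by linarith [hs.2]⟩
    apply re_sub_mul_exp_pos (by linarith : s < s + ε)
      (fun τ hτ => (hΓα τ (hsub hτ)).mono hsub) (fun τ hτ => hv τ (hsub hτ))
    intro τ hτ
    apply cos_pos_of_abs_lt
    refine lt_of_lt_of_le (h1 τ (hsub hτ) s ⟨hs.1, by linarith [hs.2]⟩ ?_) hμ1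
    rw [abs_le]; constructor <;> linarith [hτ.1, hτ.2]
  set mid := (α (a + 1) + β (a + 1)) / 2 with hmid
  have hm1 : |α (a + 1) - mid| = |β (a + 1) - α (a + 1)| / 2 := by
    rw [hmid, abs_sub_comm (β (a + 1)), ← abs_two, ← abs_div, abs_two]; congr 1; ring
  have hm2 : |β (a + 1) - mid| = |β (a + 1) - α (a + 1)| / 2 := by
    rw [hmid, ← abs_two, ← abs_div, abs_two]; congr 1; ring
  -- The secant spans the corner; it is the sum of two chords, each of which advances along `mid`.
  have hB : ∀ s ∈ Set.Icc (a + 1 - ε) (a + 1), 0 < Real.cos (θ s - mid) := by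
    intro s hs
    have hsa : s ∈ Set.Icc a (a + 1) := ⟨by linarith [hs.1], hs.2⟩
    apply hcos s hsa
    have hs1 : Set.Icc s (a + 1) ⊆ Set.Icc a (a + 1) := Set.Icc_subset_Icc hsa.1 le_rfl
    have hs2 : Set.Icc (a + 1) (s + ε) ⊆ Set.Icc (a + 1) (a + 2) :=
      Set.Icc_subset_Icc le_rfl (by linarith [hs.2])
    have c1 : ∀ τ ∈ Set.Icc s (a + 1), 0 < Real.cos (α τ - mid) := by
      intro τ hτ
      apply cos_pos_of_abs_lt
      have h3 := h1 τ (hs1 hτ) (a + 1) ⟨by linarith, le_rfl⟩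
        (by rw [abs_le]; constructor <;> linarith [hτ.1, hτ.2, hs.1, hs.2])
      have h4 := abs_add_le (α τ - α (a + 1)) (α (a + 1) - mid)
      rw [sub_add_sub_cancel] at h4
      linarith
    have c2 : ∀ τ ∈ Set.Icc (a + 1) (s + ε), 0 < Real.cos (β τ - mid) := by
      intro τ hτ
      apply cos_pos_of_abs_lt
      have h3 := h2 τ (hs2 hτ) (a + 1) ⟨le_rfl, by linarith⟩
        (by rw [abs_le]; constructor <;> linarith [hτ.1, hτ.2, hs.1, hs.2])
      have h4 := abs_add_le (β τ - β (a + 1)) (β (a + 1) - mid)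
      rw [sub_add_sub_cancel] at h4
      linarith
    have e : (Γ (s + ε) - Γ s) * Complex.exp (-(mid : ℂ) * Complex.I) =
        (Γ (a + 1) - Γ s) * Complex.exp (-(mid : ℂ) * Complex.I) +
        (Γ (s + ε) - Γ (a + 1)) * Complex.exp (-(mid : ℂ) * Complex.I) := by ring
    rw [e, Complex.add_re]
    have p1 := re_sub_mul_exp_nonneg hs.2 (fun τ hτ => (hΓα τ (hs1 hτ)).mono hs1)
      (fun τ hτ => hv τ (hs1 hτ)) c1
    have p2 := re_sub_mul_exp_nonneg (by linarith [hs.1] : a + 1 ≤ s + ε)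
      (fun τ hτ => (hΓβ τ (hs2 hτ)).mono hs2) (fun τ hτ => hw τ (hs2 hτ)) c2
    rcases hs.2.lt_or_eq with h | h
    · have := re_sub_mul_exp_pos h (fun τ hτ => (hΓα τ (hs1 hτ)).mono hs1)
        (fun τ hτ => hv τ (hs1 hτ)) c1
      linarith
    · have := re_sub_mul_exp_pos (by linarith : a + 1 < s + ε)
        (fun τ hτ => (hΓβ τ (hs2 hτ)).mono hs2) (fun τ hτ => hw τ (hs2 hτ)) c2
      linarith
  -- At the corner itself the secant lies entirely on the second arc.
  have hC : 0 < Real.cos (θ (a + 1) - β (a + 1)) := by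
    have hs2 : Set.Icc (a + 1) (a + 1 + ε) ⊆ Set.Icc (a + 1) (a + 2) :=
      Set.Icc_subset_Icc le_rfl (by linarith)
    apply hcos (a + 1) ⟨by linarith, le_rfl⟩
    apply re_sub_mul_exp_pos (by linarith : a + 1 < a + 1 + ε)
      (fun τ hτ => (hΓβ τ (hs2 hτ)).mono hs2) (fun τ hτ => hw τ (hs2 hτ))
    intro τ hτ
    apply cos_pos_of_abs_lt
    refine lt_of_lt_of_le (h2 τ (hs2 hτ) (a + 1) ⟨le_rfl, by linarith⟩ ?_) hμ1
    rw [abs_le]; constructor <;> linarith [hτ.1, hτ.2]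
  refine ⟨hA a ⟨le_rfl, by linarith⟩, fun k hk => ?_⟩
  have sA : Set.Icc a (a + 1 - ε) ⊆ Set.Icc a (a + 1) := Set.Icc_subset_Icc le_rfl (by linarith)
  have sB : Set.Icc (a + 1 - ε) (a + 1) ⊆ Set.Icc a (a + 1) :=
    Set.Icc_subset_Icc (by linarith) le_rfl
  have k1 := abs_sub_lt_of_cos_pos (φ := fun s => θ s - α s) (by linarith : a ≤ a + 1 - ε)
    ((hθ.mono sA).sub (hα.mono sA)) hA k (by linarith)
  have k2 := abs_sub_lt_of_cos_pos (φ := fun s => θ s - mid) (by linarith : a + 1 - ε ≤ a + 1)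
    ((hθ.mono sB).sub continuousOn_const) hB k (by
      have h3 := h1 (a + 1 - ε) ⟨by linarith, by linarith⟩ (a + 1) ⟨by linarith, le_rfl⟩
        (by rw [abs_le]; constructor <;> linarith)
      have h4 := abs_add_le (α (a + 1 - ε) - α (a + 1)) (α (a + 1) - mid)
      have h5 := abs_add_le (θ (a + 1 - ε) - α (a + 1 - ε) - k * (2 * Real.pi))
        (α (a + 1 - ε) - α (a + 1) + (α (a + 1) - mid))
      have h6 : θ (a + 1 - ε) - α (a + 1 - ε) - k * (2 * Real.pi) +
        (α (a + 1 - ε) - α (a + 1) + (α (a + 1) - mid)) =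
          θ (a + 1 - ε) - mid - k * (2 * Real.pi) := by ring
      rw [h6] at h5
      linarith)
  apply abs_lt_pi_div_two_of_cos_pos
  · have h5 := abs_add_le (θ (a + 1) - mid - k * (2 * Real.pi)) (mid - β (a + 1))
    have h6 : θ (a + 1) - mid - k * (2 * Real.pi) + (mid - β (a + 1)) =
      θ (a + 1) - β (a + 1) - k * (2 * Real.pi) := by ring
    rw [h6, abs_sub_comm mid, hm2] at h5
    linarith
  · rw [Real.cos_sub_int_mul_two_pi]
    exact hC

/-- Hopf's theorem for curves on the torus: a curve `Γ` that is invariant under a translation by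
`Γ L - Γ 0` and injective has total turning `0`. -/
theorem turning_eq_zero {Γ : ℝ → ℂ} {L : ℕ} (hL : 0 < L) {v α : ℕ → ℝ → ℝ} {w : ℂ}
    (hΓ : ContinuousOn Γ (Set.Icc 0 (2 * L)))
    (hper : ∀ s ∈ Set.Icc (0 : ℝ) L, Γ (s + L) = Γ s + w)
    (hinj : ∀ s ∈ Set.Icc (0 : ℝ) L, ∀ x ∈ Set.Ioc (0 : ℝ) L, Γ (s + x) ≠ Γ s)
    (hv : ∀ i : ℕ, ∀ τ ∈ Set.Icc (i : ℝ) (i + 1), 0 < v i τ)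
    (hα : ∀ i, ContinuousOn (α i) (Set.Icc (i : ℝ) (i + 1)))
    (hd : ∀ i : ℕ, ∀ τ ∈ Set.Icc (i : ℝ) (i + 1), HasDerivWithinAt Γ
      ((v i τ : ℂ) * Complex.exp ((α i τ : ℂ) * Complex.I)) (Set.Icc (i : ℝ) (i + 1)) τ)
    (hext : ∀ i : ℕ, |α (i + 1) (i + 1) - α i (i + 1)| < Real.pi)
    {κ : ℤ} (hκ : α L L = α 0 0 + κ * (2 * Real.pi)) : κ = 0 := by
  have hL' : (1 : ℝ) ≤ L := by exact_mod_cast hL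
  have key : ∀ᶠ ε in nhdsWithin (0 : ℝ) (Set.Ioi 0), ∀ i ∈ Finset.range L,
      ∀ r θ : ℝ → ℝ, ContinuousOn θ (Set.Icc (i : ℝ) (i + 1)) →
      (∀ s ∈ Set.Icc (i : ℝ) (i + 1), 0 < r s ∧
        Γ (s + ε) - Γ s = (r s : ℂ) * Complex.exp ((θ s : ℂ) * Complex.I)) →
      0 < Real.cos (θ i - α i i) ∧
      ∀ k : ℤ, |θ i - α i i - k * (2 * Real.pi)| < Real.pi / 2 →
        |θ (i + 1) - α (i + 1) (i + 1) - k * (2 * Real.pi)| < Real.pi / 2 := by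
    rw [Filter.eventually_all_finset]
    intro i _
    have e1 : ((i + 1 : ℕ) : ℝ) = i + 1 := by push_cast; ring
    have e2 : (i : ℝ) + 1 + 1 = i + 2 := by ring
    have a1 := hv (i + 1)
    have a2 := hα (i + 1)
    have a3 := hd (i + 1)
    rw [e1, e2] at a1 a2 a3
    exact turning_step (hv i) a1 (hα i) a2 (hd i) a3 (hext i)
  obtain ⟨ε, hε, hε0, hε1⟩ :=
    (key.and (Ioo_mem_nhdsGT (show (0 : ℝ) < 1 by norm_num))).exists
  have hεL : ε ≤ L := by linarith
  have h0L : (0 : ℝ) ≤ L := by linarith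
  -- Hopf's secant map on the rectangle `[0, L] × [ε, L]`. Clamping with `projIcc` extends it to the
  -- plane, which is open and simply connected, so the nonvanishing map has a continuous logarithm.
  let g : ℝ × ℝ → ℂ := fun p =>
    Γ ((Set.projIcc 0 (L : ℝ) h0L p.1 : ℝ) + (Set.projIcc ε (L : ℝ) hεL p.2 : ℝ)) -
      Γ (Set.projIcc 0 (L : ℝ) h0L p.1 : ℝ)
  have hg : Continuous g := by
    apply Continuous.sub
    · apply hΓ.comp_continuous (by fun_prop)
      intro p
      have h1 := (Set.projIcc 0 (L : ℝ) h0L p.1).2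
      have h2 := (Set.projIcc ε (L : ℝ) hεL p.2).2
      exact ⟨by linarith [h1.1, h2.1], by linarith [h1.2, h2.2]⟩
    · apply hΓ.comp_continuous (by fun_prop)
      intro p
      have h1 := (Set.projIcc 0 (L : ℝ) h0L p.1).2
      exact ⟨by linarith [h1.1], by linarith [h1.2]⟩
  have hg0 : (0 : ℂ) ∉ g '' Set.univ := by
    rintro ⟨p, -, hp⟩
    have h2 := (Set.projIcc ε (L : ℝ) hεL p.2).2
    exact hinj _ (Set.projIcc 0 (L : ℝ) h0L p.1).2 _ ⟨by linarith [h2.1], h2.2⟩ (sub_eq_zero.1 hp)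
  obtain ⟨f, hf, hfg⟩ := Complex.exists_continuousOn_eqOn_exp_comp (U := (Set.univ : Set (ℝ × ℝ)))
    (by
      have := (convex_univ (𝕜 := ℝ) (E := ℝ × ℝ)).contractibleSpace ⟨0, Set.mem_univ _⟩
      exact (inferInstance : SimplyConnectedSpace (Set.univ : Set (ℝ × ℝ)))) isOpen_univ hg.continuousOn hg0
  rw [continuousOn_univ] at hf
  have hexp : ∀ s ∈ Set.Icc (0 : ℝ) L, ∀ x ∈ Set.Icc ε (L : ℝ),
      Complex.exp (f (s, x)) = Γ (s + x) - Γ s := by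
    intro s hs x hx
    have := hfg (Set.mem_univ (s, x))
    simp only [Function.comp, g, Set.projIcc_of_mem _ hs, Set.projIcc_of_mem _ hx] at this
    exact this
  have hint : ∀ a b : ℂ, Complex.exp a = Complex.exp b →
      ∃ n : ℤ, a.im - b.im = n * (2 * Real.pi) := by
    intro a b hab
    obtain ⟨n, hn⟩ := Complex.exp_eq_exp_iff_exists_int.1 hab
    refine ⟨n, ?_⟩
    rw [hn]
    simp
  have hdisc : ∀ (ψ : ℝ → ℝ) (a b : ℝ), a ≤ b → ContinuousOn ψ (Set.Icc a b) →
      (∀ t ∈ Set.Icc a b, ∃ n : ℤ, ψ t = n * (2 * Real.pi)) → ψ b = ψ a := by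
    intro ψ a b hab hψ hn
    obtain ⟨k, hk⟩ := hn a ⟨le_rfl, hab⟩
    obtain ⟨l, hl⟩ := hn b ⟨hab, le_rfl⟩
    have := abs_sub_lt_of_cos_pos hab hψ (fun t ht => by
      obtain ⟨n, hn⟩ := hn t ht
      rw [hn, Real.cos_int_mul_two_pi]; norm_num) k (by rw [hk]; simp [Real.pi_pos])
    rw [hl, ← sub_mul, abs_mul, abs_of_pos Real.two_pi_pos] at this
    have h3 : |((l - k : ℤ) : ℝ)| < 1 := by
      push_cast
      nlinarith [Real.pi_pos]
    rw [← Int.cast_abs] at h3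
    have h4 : |l - k| < 1 := by exact_mod_cast h3
    rw [Int.abs_lt_one_iff] at h4
    rw [hk, hl, sub_eq_zero.1 h4]
  -- The change of argument along the side `x = ε` is transported to the side `x = L`: the sides `s
  -- = 0` and `s = L` carry the same secants by periodicity, and along `x = L` the secant is
  -- constantly `w`.
  have hclosed : (f (L, ε)).im = (f (0, ε)).im := by
    have h1 : (f (L, L)).im - (f (0, L)).im = (f (L, ε)).im - (f (0, ε)).im := by
      apply hdisc (fun x => (f (L, x)).im - (f (0, x)).im) ε L hεL
      · exact Continuous.continuousOn (by fun_prop)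
      · intro x hx
        apply hint
        rw [hexp L ⟨h0L, le_rfl⟩ x hx, hexp 0 ⟨le_rfl, h0L⟩ x hx, add_comm (L : ℝ) x,
          hper x ⟨by linarith [hx.1], hx.2⟩, zero_add]
        have := hper 0 ⟨le_rfl, h0L⟩
        rw [zero_add] at this
        rw [this]
        ring
    have h2 : (f (L, L)).im - (f (0, L)).im = (f (0, L)).im - (f (0, L)).im := by
      apply hdisc (fun s => (f (s, L)).im - (f (0, L)).im) 0 L h0L
      · exact Continuous.continuousOn (by fun_prop)
      · intro s hs
        apply hint
        rw [hexp s hs L ⟨hεL, le_rfl⟩, hexp 0 ⟨le_rfl, h0L⟩ L ⟨hεL, le_rfl⟩, hper s hs,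
          hper 0 ⟨le_rfl, h0L⟩]
        ring
    linarith
  set θ : ℝ → ℝ := fun s => (f (s, ε)).im with hθ
  set r : ℝ → ℝ := fun s => Real.exp (f (s, ε)).re with hr
  have hθc : Continuous θ := by simp only [hθ]; fun_prop
  have hrθ : ∀ s ∈ Set.Icc (0 : ℝ) L, 0 < r s ∧
      Γ (s + ε) - Γ s = (r s : ℂ) * Complex.exp ((θ s : ℂ) * Complex.I) := by
    intro s hs
    refine ⟨Real.exp_pos _, ?_⟩
    rw [← hexp s hs ε ⟨le_rfl, hεL⟩, hr, hθ]
    simp only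
    rw [Complex.ofReal_exp, ← Complex.exp_add, Complex.re_add_im]
  have hstep : ∀ i ∈ Finset.range L, _ := fun i hi => hε i hi r θ hθc.continuousOn (fun s hs => by
    apply hrθ s
    have : (i : ℝ) + 1 ≤ L := by exact_mod_cast Finset.mem_range.1 hi
    have h0 : (0 : ℝ) ≤ i := Nat.cast_nonneg i
    exact ⟨by linarith [hs.1], by linarith [hs.2]⟩)
  have h0 := (hstep 0 (Finset.mem_range.2 hL)).1
  rw [Nat.cast_zero] at h0
  obtain ⟨k, hk⟩ := exists_abs_sub_lt_of_cos_pos h0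
  -- The branch `k` persists through all corners. After one period `θ` is unchanged while the
  -- tangent angle has grown by `κ · 2π`, and both angles are within `π / 2` of `θ` in the same
  -- branch, whence `|κ · 2π| < π`.
  have hall : ∀ i ≤ L, |θ i - α i i - k * (2 * Real.pi)| < Real.pi / 2 := by
    intro i
    induction i with
    | zero => intro _; rw [Nat.cast_zero]; exact hk
    | succ i ih =>
      intro hi
      have := (hstep i (Finset.mem_range.2 hi)).2 k (ih (by omega))
      push_cast
      exact this
  have hend := hall L le_rfl
  have hLθ : θ L = θ 0 := hclosed
  rw [hLθ, hκ] at hend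
  have h5 : |(κ : ℝ) * (2 * Real.pi)| < Real.pi := by
    rw [abs_lt] at hk hend ⊢
    constructor <;> linarith
  rw [abs_mul, abs_of_pos Real.two_pi_pos, ← Int.cast_abs] at h5
  have h6 : ((|κ| : ℤ) : ℝ) < 1 := by nlinarith [Real.pi_pos]
  have h7 : |κ| < 1 := by exact_mod_cast h6
  exact Int.abs_lt_one_iff.1 h7

/-! ### Total turning of non-contractible simple cycles of a network -/

namespace LatticeEq

theorem symm {a b : ℂ} (h : LatticeEq a b) : LatticeEq b a := by
  obtain ⟨m, n, h⟩ := h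
  exact ⟨-m, -n, by push_cast; linear_combination -h⟩

theorem trans {a b c : ℂ} (h : LatticeEq a b) (h' : LatticeEq b c) : LatticeEq a c := by
  obtain ⟨m, n, h⟩ := h
  obtain ⟨m', n', h'⟩ := h'
  exact ⟨m + m', n + n', by push_cast; linear_combination h + h'⟩

theorem add_right {a b w : ℂ} (h : LatticeEq a b) (hw : LatticeEq w 0) : LatticeEq (a + w) b := by
  obtain ⟨m, n, h⟩ := h
  obtain ⟨m', n', h'⟩ := hw
  exact ⟨m + m', n + n', by push_cast; linear_combination h + h'⟩

theorem sub_zero {a b : ℂ} (h : LatticeEq a b) : LatticeEq (a - b) 0 := by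
  obtain ⟨m, n, h⟩ := h
  exact ⟨m, n, by rw [_root_.sub_zero, h]⟩

theorem sum_zero {ι : Type*} (s : Finset ι) (f : ι → ℂ) (h : ∀ i ∈ s, LatticeEq (f i) 0) :
    LatticeEq (∑ i ∈ s, f i) 0 := by
  classical
  induction s using Finset.induction_on with
  | empty => exact ⟨0, 0, by simp⟩
  | insert i s hi ih =>
    rw [Finset.sum_insert hi]
    exact (h i (Finset.mem_insert_self i s)).add_right
      (ih fun j hj => h j (Finset.mem_insert_of_mem hj))

end LatticeEq

/-- The number of full turns by which the exterior angle differs from the difference. -/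
noncomputable def angleBranch (a b : ℝ) : ℤ := -toIocDiv Real.two_pi_pos (-Real.pi) (b - a)

theorem exteriorAngle_eq (a b : ℝ) :
    exteriorAngle a b = b - a + angleBranch a b * (2 * Real.pi) := by
  rw [exteriorAngle, Real.Angle.toReal_coe, toIocMod, angleBranch, zsmul_eq_mul]
  push_cast
  ring

theorem abs_exteriorAngle_lt {a b : ℝ} (h : Real.cos (b - a) ≠ -1) :
    |exteriorAngle a b| < Real.pi := by
  refine lt_of_le_of_ne (Real.Angle.abs_toReal_le_pi _) fun hc => h ?_
  have h1 : Real.cos (exteriorAngle a b) = -1 := by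
    rw [← Real.cos_abs, hc, Real.cos_pi]
  rwa [exteriorAngle_eq, Real.cos_add_int_mul_two_pi] at h1

theorem continuousOn_Icc_of_unit_intervals {Γ : ℝ → ℂ}
    (h : ∀ i : ℕ, ContinuousOn Γ (Set.Icc (i : ℝ) (i + 1))) (n : ℕ) :
    ContinuousOn Γ (Set.Icc 0 n) := by
  induction n with
  | zero => simp
  | succ n ih =>
    have : Set.Icc (0 : ℝ) (n + 1 : ℕ) = Set.Icc 0 (n : ℝ) ∪ Set.Icc (n : ℝ) (n + 1) := by
      rw [Set.Icc_union_Icc_eq_Icc (Nat.cast_nonneg n) (by linarith)]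
      push_cast
      rfl
    rw [this]
    exact ih.union_of_isClosed (h n) isClosed_Icc isClosed_Icc

namespace PerfectTorusNetwork

variable {V E : Type*} [Fintype V] [Fintype E] (N : PerfectTorusNetwork V E)

theorem latticeEq_corner {e f : E} (h : N.tgt e = N.src f) :
    LatticeEq (N.curve e 1) (N.curve f 0) := by
  have := N.curve_one e
  rw [h] at this
  exact this.trans (N.curve_zero f).symm

/-- A point of the half-open arc determines the edge (up to the choice of an outgoing edge at a vertex)
and the parameter. -/
theorem src_eq_of_latticeEq {e f : E} {s t : ℝ} (hs : s ∈ Set.Ico (0 : ℝ) 1)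
    (ht : t ∈ Set.Ico (0 : ℝ) 1) (h : LatticeEq (N.curve e s) (N.curve f t)) :
    N.src e = N.src f ∧ s = t := by
  rcases hs.1.eq_or_lt with rfl | hs0 <;> rcases ht.1.eq_or_lt with rfl | ht0
  · exact ⟨N.pos_inj _ _ (((N.curve_zero e).symm.trans h).trans (N.curve_zero f)), rfl⟩
  · exact (N.curve_avoid f t ⟨ht0, ht.2⟩ _ (h.symm.trans (N.curve_zero e))).elim
  · exact (N.curve_avoid e s ⟨hs0, hs.2⟩ _ (h.trans (N.curve_zero f))).elim
  · obtain ⟨rfl, rfl⟩ := N.curve_inj e f s ⟨hs0, hs.2⟩ t ⟨ht0, ht.2⟩ h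
    exact ⟨rfl, rfl⟩

/-- The total turning of a non-contractible simple cycle is `0`. -/
theorem sum_angleBranch_eq_zero {L : ℕ} (hL : 0 < L) (c : ℕ → E)
    (hper : ∀ i, c (i + L) = c i) (hc : ∀ i, N.tgt (c i) = N.src (c (i + 1)))
    (hinj : ∀ i j, N.src (c i) = N.src (c j) → i ≡ j [MOD L])
    (hne : ∑ i ∈ Finset.range L, (N.curve (c i) 1 - N.curve (c i) 0) ≠ 0) :
    ∑ i ∈ Finset.range L, angleBranch (N.angle (c i) 1) (N.angle (c (i + 1)) 0) = 0 := by
  -- Lattice translations that join the given lifts of the edges end to end; `Γ` is the resulting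
  -- lift of the cycle, traversed repeatedly, with one unit of time per edge.
  set o : ℕ → ℂ := fun j => ∑ i ∈ Finset.range j, (N.curve (c i) 1 - N.curve (c (i + 1)) 0) with ho
  set κ : ℕ → ℤ := fun j =>
    ∑ i ∈ Finset.range j, angleBranch (N.angle (c i) 1) (N.angle (c (i + 1)) 0) with hκ
  set Γ : ℝ → ℂ := fun s => N.curve (c ⌊s⌋₊) (s - ⌊s⌋₊) + o ⌊s⌋₊ with hΓ
  have hos : ∀ j, o (j + 1) = o j + (N.curve (c j) 1 - N.curve (c (j + 1)) 0) :=
    fun j => Finset.sum_range_succ _ _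
  have hol : ∀ j, LatticeEq (o j) 0 := fun j =>
    LatticeEq.sum_zero _ _ fun i _ => (N.latticeEq_corner (hc i)).sub_zero
  have hoper : ∀ j, o (j + L) = o j + o L := by
    intro j
    induction j with
    | zero => simp [ho]
    | succ j ih =>
      rw [show j + 1 + L = j + L + 1 by ring, hos, hos, ih, hper, show j + L + 1 = j + 1 + L by ring,
        hper]
      ring
  have hoL : o L ≠ 0 := by
    have : o L = ∑ i ∈ Finset.range L, (N.curve (c i) 1 - N.curve (c i) 0) := by
      simp only [ho, Finset.sum_sub_distrib]
      congr 1
      have h1 := Finset.sum_range_succ (fun i => N.curve (c i) 0) L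
      have h2 := Finset.sum_range_succ' (fun i => N.curve (c i) 0) L
      have h3 := hper 0
      rw [zero_add] at h3
      rw [h3] at h1
      rw [h1] at h2
      exact (add_right_cancel h2).symm
    rwa [this]
  have hEq : ∀ i : ℕ, ∀ s ∈ Set.Icc (i : ℝ) (i + 1), Γ s = N.curve (c i) (s - i) + o i := by
    intro i s hs
    rcases hs.2.eq_or_lt with h | h
    · have hf : ⌊s⌋₊ = i + 1 := by
        rw [h, show ((i : ℝ) + 1) = ((i + 1 : ℕ) : ℝ) by push_cast; ring, Nat.floor_natCast]
      simp only [hΓ, hf, hos]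
      rw [h]
      push_cast
      rw [sub_self, add_sub_cancel_left]
      ring
    · have hf : ⌊s⌋₊ = i := (Nat.floor_eq_iff (by linarith [hs.1, (Nat.cast_nonneg i : (0 : ℝ) ≤ i)])).2
        ⟨hs.1, h⟩
      simp only [hΓ, hf]
  have hmem : ∀ (i : ℕ) (s : ℝ), s ∈ Set.Icc (i : ℝ) (i + 1) → s - i ∈ Set.Icc (0 : ℝ) 1 :=
    fun i s hs => ⟨by linarith [hs.1], by linarith [hs.2]⟩
  have hd : ∀ i : ℕ, ∀ τ ∈ Set.Icc (i : ℝ) (i + 1), HasDerivWithinAt Γ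
      ((N.speed (c i) (τ - i) : ℂ) *
        Complex.exp (((N.angle (c i) (τ - i) + κ i * (2 * Real.pi) : ℝ) : ℂ) * Complex.I))
      (Set.Icc (i : ℝ) (i + 1)) τ := by
    intro i τ hτ
    have h1 := (N.hasDeriv (c i) (τ - i) (hmem i τ hτ)).scomp τ
      ((hasDerivWithinAt_id τ (Set.Icc (i : ℝ) (i + 1))).sub_const (i : ℝ)) (hmem i)
    rw [one_smul] at h1
    have h2 := (h1.add_const (o i)).congr (fun s hs => hEq i s hs) (hEq i τ hτ)
    rw [Complex.ofReal_add, add_mul, Complex.exp_add]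
    have : Complex.exp (((κ i * (2 * Real.pi) : ℝ) : ℂ) * Complex.I) = 1 := by
      rw [Complex.exp_eq_one_iff]
      exact ⟨κ i, by push_cast; ring⟩
    rw [this, mul_one]
    exact h2
  have hfl : ∀ s : ℝ, 0 ≤ s → s - ⌊s⌋₊ ∈ Set.Ico (0 : ℝ) 1 := fun s hs =>
    ⟨by linarith [Nat.floor_le hs], by linarith [Nat.lt_floor_add_one s]⟩
  have hκs : ∀ j, κ (j + 1) = κ j + angleBranch (N.angle (c j) 1) (N.angle (c (j + 1)) 0) :=
    fun j => Finset.sum_range_succ _ _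
  have hperΓ : ∀ s ∈ Set.Icc (0 : ℝ) L, Γ (s + L) = Γ s + o L := by
    intro s hs
    simp only [hΓ, Nat.floor_add_natCast hs.1, hper, hoper]
    push_cast
    rw [add_sub_add_right_eq_sub]
    ring
  -- Adding `κ i` full turns to the angle on the `i`-th edge makes each jump at a corner equal to
  -- the exterior angle. The turns accumulated over a period are the sum in question.
  refine turning_eq_zero hL (Γ := Γ) (w := o L)
    (v := fun i s => N.speed (c i) (s - i))
    (α := fun i s => N.angle (c i) (s - i) + κ i * (2 * Real.pi)) ?_ hperΓ ?_ ?_ ?_ hd ?_ ?_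
  · have := continuousOn_Icc_of_unit_intervals (Γ := Γ)
      (fun i τ hτ => (hd i τ hτ).continuousWithinAt) (2 * L)
    push_cast at this
    exact this
  · intro s hs x hx heq
    -- Points that coincide have the same parameter on edges whose indices agree modulo `L`. So `x`
    -- is a multiple of `L`, that is `x = L`, which is excluded because the translation `o L` of a
    -- non-contractible cycle is nonzero.
    have h1 : LatticeEq (N.curve (c ⌊s + x⌋₊) (s + x - ⌊s + x⌋₊)) (N.curve (c ⌊s⌋₊) (s - ⌊s⌋₊)) := by
      obtain ⟨m, n, h⟩ := hol ⌊s⌋₊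
      obtain ⟨m', n', h'⟩ := hol ⌊s + x⌋₊
      simp only [hΓ] at heq
      exact ⟨m - m', n - n', by push_cast; linear_combination heq + h - h'⟩
    obtain ⟨h2, h3⟩ := N.src_eq_of_latticeEq (hfl _ (by linarith [hs.1, hx.1])) (hfl s hs.1) h1
    have h4 := hinj _ _ h2
    have hle : ⌊s⌋₊ ≤ ⌊s + x⌋₊ := Nat.floor_mono (by linarith [hx.1])
    obtain ⟨q, hq⟩ := (Nat.modEq_iff_dvd' hle).1 h4.symm
    have h5 : x = L * q := by
      have : ((⌊s + x⌋₊ - ⌊s⌋₊ : ℕ) : ℝ) = x := by rw [Nat.cast_sub hle]; linarith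
      rw [← this, hq]
      push_cast
      ring
    have hL0 : (0 : ℝ) < L := by exact_mod_cast hL
    have hq1 : q = 1 := by
      have a1 : (0 : ℝ) < q := by
        by_contra! hc
        have := hx.1
        nlinarith
      have a2 : (q : ℝ) ≤ 1 := by
        by_contra! hc
        have := hx.2
        nlinarith
      have a3 : 0 < q := by exact_mod_cast a1
      have a4 : q ≤ 1 := by exact_mod_cast a2
      omega
    rw [hq1, Nat.cast_one, mul_one] at h5
    rw [h5, hperΓ s hs] at heq
    exact hoL (by simpa using heq)
  · exact fun i τ hτ => N.speed_pos _ _ (hmem i τ hτ)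
  · intro i
    exact ((N.angle_cont (c i)).comp (Continuous.continuousOn (by fun_prop)) (hmem i)).add
      continuousOn_const
  · intro i
    have h1 := abs_exteriorAngle_lt (N.no_cusp (c i) (c (i + 1)) (hc i))
    rw [exteriorAngle_eq] at h1
    simp only [hκs]
    push_cast
    rw [add_sub_cancel_left, sub_self]
    convert h1 using 2
    ring
  · have h3 := hper 0
    rw [zero_add] at h3
    simp only [h3, sub_self, Nat.cast_zero]
    simp [hκ]

theorem sum_cycle {M : Type*} [AddCommMonoid M] {m : ℕ} {c : Fin (m + 1) → E} {S : Finset E}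
    (hinj : Function.Injective fun i => N.src (c i)) (hS : ∀ e, e ∈ S ↔ ∃ i, c i = e) (f : E → M) :
    ∑ e ∈ S, f e = ∑ i, f (c i) := by
  classical
  have hci : Function.Injective c := fun i j h => hinj (by simp only [h])
  have : S = Finset.univ.image c := by
    ext e
    simp [hS]
  rw [this, Finset.sum_image fun i _ j _ h => hci h]

theorem sum_angleBranch_cycle {m : ℕ} {c : Fin (m + 1) → E} {S : Finset E}
    (hinj : Function.Injective fun i => N.src (c i)) (hc : ∀ i, N.tgt (c i) = N.src (c (i + 1)))
    (hS : ∀ e, e ∈ S ↔ ∃ i, c i = e) (hne : ∑ e ∈ S, (N.curve e 1 - N.curve e 0) ≠ 0) :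
    ∑ i, angleBranch (N.angle (c i) 1) (N.angle (c (i + 1)) 0) = 0 := by
  have hsucc : ∀ i : ℕ, Fin.ofNat (m + 1) (i + 1) = Fin.ofNat (m + 1) i + 1 := by
    intro i
    apply Fin.ext
    simp [Fin.val_add, Fin.ofNat]
  have hval : ∀ i : Fin (m + 1), Fin.ofNat (m + 1) i = i := by
    intro i
    apply Fin.ext
    simp [Fin.ofNat, Nat.mod_eq_of_lt i.isLt]
  have := N.sum_angleBranch_eq_zero (Nat.succ_pos m) (fun i => c (Fin.ofNat (m + 1) i)) ?_ ?_ ?_ ?_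
  · rw [Finset.sum_range] at this
    simpa only [hsucc, hval] using this
  · intro i
    congr 1
    apply Fin.ext
    simp [Fin.ofNat]
  · intro i
    simp only [hsucc]
    exact hc _
  · intro i j h
    have := hinj h
    exact congrArg Fin.val this
  · rw [Finset.sum_range]
    simp only [hval]
    rwa [← N.sum_cycle hinj hS (fun e => N.curve e 1 - N.curve e 0)]

end PerfectTorusNetwork

namespace PerfectTorusNetwork

variable {V E : Type*} [Fintype V] [Fintype E] (N : PerfectTorusNetwork V E)

/-! ### Expansion of a determinant over collections of disjoint cycles -/

section Expansion

variable {A : Type*} [CommRing A]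

open Classical in
/-- The transfer matrix of the graph for the edge weights `X`. -/
noncomputable def transfer (X : E → A) : Matrix V V A :=
  Matrix.of fun v w => ∑ e, if N.src e = v ∧ N.tgt e = w then X e else 0

open Classical in
/-- The matrix of a map. -/
noncomputable def mapMatrix (A : Type*) [CommRing A] (f : V → V) : Matrix V V A :=
  Matrix.of fun v w => if f v = w then 1 else 0

open Classical in
theorem mapMatrix_mul (f g : V → V) : mapMatrix A f * mapMatrix A g = mapMatrix A (g ∘ f) := by
  ext v w
  simp only [mapMatrix, Matrix.mul_apply, Matrix.of_apply, ite_mul, one_mul, zero_mul,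
    Finset.sum_ite_eq, Finset.mem_univ, if_true, Function.comp]

open Classical in
theorem det_mapMatrix_id : (mapMatrix A (id : V → V)).det = 1 := by
  have : mapMatrix A (id : V → V) = 1 := by
    ext v w
    simp [mapMatrix, Matrix.one_apply]
  rw [this, Matrix.det_one]

open Classical in
theorem det_mapMatrix_perm (σ : Equiv.Perm V) :
    (mapMatrix A σ).det = ((Equiv.Perm.sign σ : ℤ) : A) := by
  rw [← Matrix.det_permutation]
  congr 1
  ext v w
  simp [mapMatrix, PEquiv.toMatrix_apply, Equiv.toPEquiv_apply, eq_comm]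

open Classical in
theorem injective_of_det_mapMatrix_ne {f : V → V} (h : (mapMatrix A f).det ≠ 0) :
    Function.Injective f := by
  intro v w hvw
  by_contra hne
  apply h
  apply Matrix.det_zero_of_row_eq hne
  ext u
  simp [mapMatrix, hvw]

/-- The vertex reached from `v` along a chosen edge, or `v` itself if no edge is chosen. -/
def dest (v : V) : Option E → V
  | none => v
  | some e => N.tgt e

open Classical in
/-- The coefficient of a choice of an edge at `v`. -/
noncomputable def coef (X : E → A) (v : V) : Option E → A
  | none => 1
  | some e => if N.src e = v then -X e else 0

open Classical in
-- Row `v` is a sum over the options at `v`: stay (`none`) or leave along an edge. Multilinearity in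
-- the rows turns the determinant into a sum over simultaneous choices, each with the determinant of
-- the matrix of a map.
theorem det_one_sub_transfer_eq_sum (X : E → A) :
    (1 - N.transfer X).det = ∑ φ : V → Option E, (∏ v, N.coef X v (φ v)) *
      (mapMatrix A fun v => N.dest v (φ v)).det := by
  have h : (1 - N.transfer X : Matrix V V A) = fun v => ∑ o : Option E, N.coef X v o •
      (fun w => if N.dest v o = w then (1 : A) else 0) := by
    ext v w
    rw [Finset.sum_apply, Fintype.sum_option]
    simp only [transfer, coef, dest, Matrix.sub_apply, Matrix.one_apply, Matrix.of_apply,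
      Pi.smul_apply, smul_eq_mul, one_mul]
    rw [sub_eq_add_neg, ← Finset.sum_neg_distrib]
    congr 1
    apply Finset.sum_congr rfl
    intro e _
    by_cases h1 : N.src e = v <;> by_cases h2 : N.tgt e = w <;> simp [h1, h2]
  rw [h]
  have h1 := (Matrix.detRowAlternating (n := V) (R := A)).toMultilinearMap.map_sum
    (fun (v : V) (o : Option E) => N.coef X v o • (fun w => if N.dest v o = w then (1 : A) else 0))
  refine h1.trans (Finset.sum_congr rfl fun φ _ => ?_)
  have h2 := (Matrix.detRowAlternating (n := V) (R := A)).toMultilinearMap.map_smul_univ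
    (fun v => N.coef X v (φ v)) (fun v => fun w => if N.dest v (φ v) = w then (1 : A) else 0)
  exact h2

open Classical in
/-- The edge of `F` that starts at `v`. -/
noncomputable def selection (F : Finset E) (v : V) : Option E :=
  if h : ∃ e ∈ F, N.src e = v then some h.choose else none

theorem selection_eq_some {F : Finset E} (hF : Set.InjOn N.src F) {v : V} {e : E} :
    N.selection F v = some e ↔ e ∈ F ∧ N.src e = v := by
  unfold selection
  split_ifs with h
  · constructor
    · intro he
      rw [← Option.some.inj he]
      exact h.choose_spec
    · rintro ⟨he, rfl⟩
      rw [Option.some.injEq]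
      exact hF h.choose_spec.1 he h.choose_spec.2
  · simp only [false_iff]
    exact fun he => h ⟨e, he⟩

theorem selection_eq_none {F : Finset E} {v : V} :
    N.selection F v = none ↔ ∀ e ∈ F, N.src e ≠ v := by
  unfold selection
  split_ifs with h
  · simpa using h
  · simpa using h

/-- The map that moves each vertex along the edge of `F` that starts there. -/
noncomputable def stepMap (F : Finset E) (v : V) : V := N.dest v (N.selection F v)

theorem stepMap_src {F : Finset E} (hF : Set.InjOn N.src F) {e : E} (he : e ∈ F) :
    N.stepMap F (N.src e) = N.tgt e := by
  rw [stepMap, (N.selection_eq_some hF).2 ⟨he, rfl⟩, dest]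

theorem stepMap_of_notMem {F : Finset E} {v : V} (hv : ∀ e ∈ F, N.src e ≠ v) :
    N.stepMap F v = v := by
  rw [stepMap, N.selection_eq_none.2 hv, dest]

variable {N} in
theorem IsSimpleCycle.injOn {S : Finset E} (hS : N.IsSimpleCycle S) : Set.InjOn N.src S := by
  obtain ⟨m, c, hinj, -, hS⟩ := hS
  intro e he f hf h
  obtain ⟨i, rfl⟩ := (hS e).1 he
  obtain ⟨j, rfl⟩ := (hS f).1 hf
  exact congrArg c (hinj h)

variable {N} in
theorem IsSimpleCycle.exists_next {S : Finset E} (hS : N.IsSimpleCycle S) {e : E} (he : e ∈ S) :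
    ∃ f ∈ S, N.tgt e = N.src f := by
  obtain ⟨m, c, -, hc, hS⟩ := hS
  obtain ⟨i, rfl⟩ := (hS e).1 he
  exact ⟨c (i + 1), (hS _).2 ⟨_, rfl⟩, hc i⟩

variable {N} in
theorem IsSimpleCycle.nonempty {S : Finset E} (hS : N.IsSimpleCycle S) : S.Nonempty := by
  obtain ⟨m, c, -, -, hS⟩ := hS
  exact ⟨c 0, (hS _).2 ⟨0, rfl⟩⟩

variable {N} in
/-- A set of edges that is closed under passing to the next edge of a simple cycle `S` contains `S`
as soon as it meets `S`. -/
theorem IsSimpleCycle.subset {S S' : Finset E} (hS : N.IsSimpleCycle S) {e : E} (he : e ∈ S)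
    (he' : e ∈ S') (h : ∀ a ∈ S, a ∈ S' → ∀ b ∈ S, N.tgt a = N.src b → b ∈ S') : S ⊆ S' := by
  obtain ⟨m, c, -, hc, hS⟩ := hS
  obtain ⟨i, rfl⟩ := (hS e).1 he
  have key : ∀ k : ℕ, c (i + (Fin.ofNat (m + 1) k)) ∈ S' := by
    intro k
    induction k with
    | zero =>
      have : Fin.ofNat (m + 1) 0 = 0 := rfl
      rwa [this, add_zero]
    | succ k ih =>
      have : i + Fin.ofNat (m + 1) (k + 1) = i + Fin.ofNat (m + 1) k + 1 := by
        rw [add_assoc]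
        congr 1
        apply Fin.ext
        simp [Fin.val_add, Fin.ofNat]
      rw [this]
      exact h _ ((hS _).2 ⟨_, rfl⟩) ih _ ((hS _).2 ⟨_, rfl⟩) (hc _)
  intro f hf
  obtain ⟨j, rfl⟩ := (hS f).1 hf
  have := key (j - i).val
  have hval : Fin.ofNat (m + 1) (j - i).val = j - i := by
    apply Fin.ext
    simp [Fin.ofNat, Nat.mod_eq_of_lt (j - i).isLt]
  rwa [hval, add_sub_cancel] at this

open Classical in
-- The step map is a rotation of the vertices of the cycle, extended by the identity, and the sign
-- of a rotation of `l` points is `(-1)^(l - 1)`. A loop counts as a cycle of length one.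
theorem det_mapMatrix_cycle {S : Finset E} (hS : N.IsSimpleCycle S) :
    (mapMatrix A (N.stepMap S)).det = (-1) ^ (S.card + 1) := by
  have hSi := hS.injOn
  obtain ⟨m, c, hinj, hc, hS⟩ := hS
  let emb : Fin (m + 1) ↪ V := ⟨fun i => N.src (c i), hinj⟩
  have h : N.stepMap S = (finRotate (m + 1)).viaFintypeEmbedding emb := by
    ext v
    by_cases hv : v ∈ Set.range emb
    · obtain ⟨i, rfl⟩ := hv
      rw [Equiv.Perm.viaFintypeEmbedding_apply_image, finRotate_apply]
      exact (N.stepMap_src hSi ((hS _).2 ⟨i, rfl⟩)).trans (hc i)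
    · rw [Equiv.Perm.viaFintypeEmbedding_apply_notMem_range _ _ hv]
      apply N.stepMap_of_notMem
      intro e he hev
      obtain ⟨i, rfl⟩ := (hS e).1 he
      exact hv ⟨i, hev⟩
  have hcard : S.card = m + 1 := by
    have := N.sum_cycle hinj hS (fun _ => 1)
    simpa using this
  rw [h, det_mapMatrix_perm, Equiv.Perm.viaFintypeEmbedding_sign, sign_finRotate, hcard]
  push_cast
  rw [pow_add, pow_add]
  norm_num

/-- The union of a collection of edge sets. -/
def support [DecidableEq E] (𝒞 : Finset (Finset E)) : Finset E := 𝒞.biUnion id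

variable {N} in
theorem IsDisjointCollection.mono {𝒞 𝒞' : Finset (Finset E)} (h : N.IsDisjointCollection 𝒞)
    (h' : 𝒞' ⊆ 𝒞) : N.IsDisjointCollection 𝒞' :=
  ⟨fun S hS => h.1 S (h' hS), fun S hS S' hS' => h.2 S (h' hS) S' (h' hS')⟩

variable {N} in
theorem IsDisjointCollection.injOn [DecidableEq E] {𝒞 : Finset (Finset E)}
    (h : N.IsDisjointCollection 𝒞) : Set.InjOn N.src (support 𝒞) := by
  intro e he f hf hef
  simp only [support, Finset.coe_biUnion, id, Set.mem_iUnion, Finset.mem_coe] at he hf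
  obtain ⟨S, hS, he⟩ := he
  obtain ⟨S', hS', hf⟩ := hf
  by_cases hSS : S = S'
  · subst hSS
    exact (h.1 S hS).injOn he hf hef
  · exact (h.2 S hS S' hS' hSS e he f hf hef).elim

variable {N} in
theorem IsDisjointCollection.pairwiseDisjoint [DecidableEq E] {𝒞 : Finset (Finset E)}
    (h : N.IsDisjointCollection 𝒞) : (𝒞 : Set (Finset E)).PairwiseDisjoint id := by
  intro S hS S' hS' hne
  rw [Function.onFun, Finset.disjoint_left]
  exact fun e he he' => h.2 S hS S' hS' hne e he e he' rfl

variable {N} in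
-- In the union of a disjoint collection every edge has only one possible successor, so cycles from
-- two collections with the same union agree as soon as they share an edge. A collection can thus be
-- recovered from its set of edges.
theorem IsDisjointCollection.subset_of_support_eq [DecidableEq E] {𝒞 𝒞' : Finset (Finset E)}
    (h : N.IsDisjointCollection 𝒞) (h' : N.IsDisjointCollection 𝒞')
    (hs : support 𝒞 = support 𝒞') : 𝒞 ⊆ 𝒞' := by
  intro S hS
  obtain ⟨e, he⟩ := (h.1 S hS).nonempty
  have hSs : S ⊆ support 𝒞 := Finset.subset_biUnion_of_mem id hS
  have : e ∈ support 𝒞' := hs ▸ hSs he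
  obtain ⟨S', hS', he'⟩ := Finset.mem_biUnion.1 this
  have hSs' : S' ⊆ support 𝒞 := hs ▸ Finset.subset_biUnion_of_mem id hS'
  have h1 : S ⊆ S' := by
    refine (h.1 S hS).subset he he' fun a _ ha b hb hab => ?_
    obtain ⟨f, hf, haf⟩ := (h'.1 S' hS').exists_next ha
    rwa [h.injOn (hSs hb) (hSs' hf) (hab.symm.trans haf)]
  have h2 : S' ⊆ S := by
    refine (h'.1 S' hS').subset he' he fun a _ ha b hb hab => ?_
    obtain ⟨f, hf, haf⟩ := (h.1 S hS).exists_next ha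
    rwa [h.injOn (hSs' hb) (hSs hf) (hab.symm.trans haf)]
  rwa [h1.antisymm h2]

open Classical in
-- Disjoint cycles move disjoint sets of vertices, so the step map of the union is the composition
-- of the individual ones.
theorem det_mapMatrix_collection (𝒞 : Finset (Finset E)) (h : N.IsDisjointCollection 𝒞) :
    (mapMatrix A (N.stepMap (support 𝒞))).det = ∏ S ∈ 𝒞, (-1) ^ (S.card + 1) := by
  induction 𝒞 using Finset.induction_on with
  | empty =>
    have : N.stepMap (support ∅) = id := by
      ext v
      exact N.stepMap_of_notMem (by simp [support])
    rw [this, det_mapMatrix_id, Finset.prod_empty]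
  | insert S 𝒞 hS ih =>
    have h' : N.IsDisjointCollection 𝒞 := h.mono (Finset.subset_insert S 𝒞)
    have hSc := h.1 S (Finset.mem_insert_self S 𝒞)
    have hdis : ∀ e ∈ S, ∀ f ∈ support 𝒞, N.src f ≠ N.src e := by
      intro e he f hf
      obtain ⟨S', hS', hf⟩ := Finset.mem_biUnion.1 hf
      exact h.2 S' (Finset.mem_insert_of_mem hS') S (Finset.mem_insert_self S 𝒞)
        (fun hc => hS (hc ▸ hS')) f hf e he
    have hsup : support (insert S 𝒞) = S ∪ support 𝒞 := by simp [support]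
    have hcomp : N.stepMap (support (insert S 𝒞)) = N.stepMap (support 𝒞) ∘ N.stepMap S := by
      ext v
      by_cases hv : ∃ e ∈ S, N.src e = v
      · obtain ⟨e, he, rfl⟩ := hv
        obtain ⟨f, hf, hef⟩ := hSc.exists_next he
        rw [N.stepMap_src h.injOn (hsup ▸ Finset.mem_union_left _ he), Function.comp,
          N.stepMap_src hSc.injOn he, hef, N.stepMap_of_notMem (hdis f hf)]
      · push Not at hv
        rw [Function.comp, N.stepMap_of_notMem hv]
        by_cases hv' : ∃ e ∈ support 𝒞, N.src e = v
        · obtain ⟨e, he, rfl⟩ := hv'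
          rw [N.stepMap_src h.injOn (hsup ▸ Finset.mem_union_right _ he), N.stepMap_src h'.injOn he]
        · push Not at hv'
          rw [N.stepMap_of_notMem hv', N.stepMap_of_notMem]
          intro e he
          rw [hsup] at he
          rcases Finset.mem_union.1 he with he | he
          exacts [hv e he, hv' e he]
    rw [hcomp, ← mapMatrix_mul, Matrix.det_mul, ih h', N.det_mapMatrix_cycle hSc,
      Finset.prod_insert hS]

open Classical in
theorem prod_coef_selection (X : E → A) {F : Finset E} (hF : Set.InjOn N.src F) :
    ∏ v, N.coef X v (N.selection F v) = ∏ e ∈ F, -X e := by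
  rw [← Finset.prod_subset (Finset.subset_univ (F.image N.src)), Finset.prod_image hF]
  · apply Finset.prod_congr rfl
    intro e he
    rw [(N.selection_eq_some hF).2 ⟨he, rfl⟩, coef, if_pos rfl]
  · intro v _ hv
    rw [N.selection_eq_none.2, coef]
    intro e he hev
    exact hv (Finset.mem_image.2 ⟨e, he, hev⟩)

/-- A finite set of edges with a successor bijection decomposes into disjoint simple cycles. -/
theorem exists_collection_of_next [DecidableEq E] {F : Finset E} (hF : Set.InjOn N.src F)
    (hF' : Set.InjOn N.tgt F) (nx : E → E) (hnx : ∀ e ∈ F, nx e ∈ F ∧ N.tgt e = N.src (nx e)) :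
    ∃ 𝒞 : Finset (Finset E), N.IsDisjointCollection 𝒞 ∧ support 𝒞 = F := by
  classical
  have hmaps : Set.MapsTo nx F F := fun e he => (hnx e he).1
  have hit : ∀ k, ∀ e ∈ F, nx^[k] e ∈ F := fun k e he => hmaps.iterate k he
  have hinj : Set.InjOn nx F := by
    intro e he f hf h
    apply hF' he hf
    rw [(hnx e he).2, (hnx f hf).2, h]
  have hper : ∀ e ∈ F, 0 < Function.minimalPeriod nx e := by
    intro e he
    rw [Function.minimalPeriod_pos_iff_mem_periodicPts]
    obtain ⟨a, b, hab, h⟩ := Finite.exists_ne_map_eq_of_infinite (fun k : ℕ => nx^[k] e)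
    wlog hlt : a < b generalizing a b
    · exact this b a hab.symm h.symm (lt_of_le_of_ne (not_lt.1 hlt) hab.symm)
    refine ⟨b - a, by omega, ?_⟩
    have h1 : nx^[a] (nx^[b - a] e) = nx^[a] e := by
      rw [← Function.iterate_add_apply, Nat.add_sub_cancel' hlt.le]
      exact h.symm
    exact hinj.iterate hmaps a (hit _ e he) he h1
  set orb : E → Finset E := fun e => Finset.univ.filter fun f => ∃ k, nx^[k] e = f with horb
  have hmem : ∀ e f, f ∈ orb e ↔ ∃ k, nx^[k] e = f := by simp [horb]
  have horbF : ∀ e ∈ F, orb e ⊆ F := by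
    intro e he f hf
    obtain ⟨k, rfl⟩ := (hmem e f).1 hf
    exact hit k e he
  have hself : ∀ e, e ∈ orb e := fun e => (hmem e e).2 ⟨0, rfl⟩
  have horbeq : ∀ e ∈ F, ∀ f ∈ orb e, orb f = orb e := by
    intro e he f hf
    obtain ⟨k, rfl⟩ := (hmem e f).1 hf
    ext g
    rw [hmem, hmem]
    constructor
    · rintro ⟨j, rfl⟩
      exact ⟨j + k, Function.iterate_add_apply _ _ _ _⟩
    · rintro ⟨j, rfl⟩
      have hp : nx^[Function.minimalPeriod nx e * k] e = e :=
        ((Function.isPeriodicPt_minimalPeriod nx e).mul_const k)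
      -- From `nx^[k] e` the orbit is back at `e` after `minimalPeriod * k - k` further steps.
      refine ⟨j + (Function.minimalPeriod nx e * k - k), ?_⟩
      have hle : k ≤ Function.minimalPeriod nx e * k := Nat.le_mul_of_pos_left k (hper e he)
      rw [← Function.iterate_add_apply, add_assoc, Nat.sub_add_cancel hle,
        Function.iterate_add_apply, hp]
  have hcyc : ∀ e ∈ F, N.IsSimpleCycle (orb e) := by
    intro e he
    obtain ⟨m, hm⟩ := Nat.exists_eq_succ_of_ne_zero (hper e he).ne'
    refine ⟨m, fun i => nx^[i] e, ?_, ?_, ?_⟩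
    · intro i j hij
      have h1 := hF (hit _ e he) (hit _ e he) hij
      have hlt : ∀ i : Fin (m + 1), i.val ∈ Set.Iio (Function.minimalPeriod nx e) := by
        intro i
        rw [hm]
        exact i.isLt
      exact Fin.ext (Function.iterate_injOn_Iio_minimalPeriod (hlt i) (hlt j) h1)
    · intro i
      rw [(hnx _ (hit _ e he)).2]
      congr 1
      simp only
      rw [← Function.iterate_succ_apply' nx]
      rw [← Function.iterate_mod_minimalPeriod_eq (n := i.val.succ), hm]
      congr 1
      simp [Fin.val_add]
    · intro f
      rw [hmem]
      constructor
      · rintro ⟨k, rfl⟩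
        refine ⟨⟨k % (m + 1), Nat.mod_lt _ (Nat.succ_pos m)⟩, ?_⟩
        have := Function.iterate_mod_minimalPeriod_eq (f := nx) (x := e) (n := k)
        rw [hm] at this
        exact this
      · rintro ⟨i, rfl⟩
        exact ⟨i, rfl⟩
  refine ⟨F.image orb, ⟨?_, ?_⟩, ?_⟩
  · intro S hS
    obtain ⟨e, he, rfl⟩ := Finset.mem_image.1 hS
    exact hcyc e he
  · intro S hS S' hS' hne a ha b hb hab
    obtain ⟨e, he, rfl⟩ := Finset.mem_image.1 hS
    obtain ⟨f, hf, rfl⟩ := Finset.mem_image.1 hS'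
    have := hF (horbF e he ha) (horbF f hf hb) hab
    subst this
    exact hne ((horbeq e he a ha).symm.trans (horbeq f hf a hb))
  · ext e
    rw [support, Finset.mem_biUnion]
    constructor
    · rintro ⟨S, hS, heS⟩
      obtain ⟨f, hf, rfl⟩ := Finset.mem_image.1 hS
      exact horbF f hf heS
    · intro he
      exact ⟨orb e, Finset.mem_image_of_mem _ he, hself e⟩

open Classical in
/-- Expansion of `det (1 - T)` over collections of disjoint simple cycles. -/
theorem det_one_sub_transfer (X : E → A) :
    (1 - N.transfer X).det =
      ∑ 𝒞 ∈ (Finset.univ : Finset (Finset (Finset E))).filter N.IsDisjointCollection,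
        (-1) ^ 𝒞.card * ∏ S ∈ 𝒞, ∏ e ∈ S, X e := by
  rw [det_one_sub_transfer_eq_sum]
  symm
  refine Finset.sum_of_injOn (fun 𝒞 => N.selection (support 𝒞)) ?_ (fun _ _ => Finset.mem_coe.2 (Finset.mem_univ _)) ?_ ?_
  · intro 𝒞 h𝒞 𝒞' h𝒞' heq
    simp only [Finset.coe_filter, Finset.mem_univ, true_and, Set.mem_ofPred_eq] at h𝒞 h𝒞' heq
    have hs : support 𝒞 = support 𝒞' := by
      ext e
      have h1 := N.selection_eq_some h𝒞.injOn (v := N.src e) (e := e)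
      have h2 := N.selection_eq_some h𝒞'.injOn (v := N.src e) (e := e)
      rw [heq, h2] at h1
      simpa using h1.symm
    exact (h𝒞.subset_of_support_eq h𝒞' hs).antisymm (h𝒞'.subset_of_support_eq h𝒞 hs.symm)
  -- A choice with a nonzero term selects edges at their own tails and moves the vertices
  -- injectively; the selected edges then form disjoint cycles, so the choice comes from a
  -- collection.
  · intro φ _ hφ
    by_contra hne
    apply hφ
    have hcoef : ∀ v, N.coef X v (φ v) ≠ 0 := by
      intro v hv
      exact hne (by rw [Finset.prod_eq_zero (Finset.mem_univ v) hv, zero_mul])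
    have hinj := injective_of_det_mapMatrix_ne (right_ne_zero_of_mul hne)
    have hsrc : ∀ v e, φ v = some e → N.src e = v := by
      intro v e he
      have := hcoef v
      rw [he, coef] at this
      by_contra hc
      exact this (if_neg hc)
    set F : Finset E := Finset.univ.filter fun e => φ (N.src e) = some e with hFdef
    have hFm : ∀ e, e ∈ F ↔ φ (N.src e) = some e := by simp [hFdef]
    have hF : Set.InjOn N.src F := by
      intro e he f hf hef
      have h1 := (hFm e).1 he
      rw [hef, (hFm f).1 hf] at h1
      exact (Option.some.inj h1).symm
    have hdest : ∀ e ∈ F, N.dest (N.src e) (φ (N.src e)) = N.tgt e := by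
      intro e he
      rw [(hFm e).1 he, dest]
    have hF' : Set.InjOn N.tgt F := by
      intro e he f hf hef
      apply hF he hf
      apply hinj
      simp only
      rw [hdest e he, hdest f hf, hef]
    have hnext : ∀ e : E, ∃ f, e ∈ F → f ∈ F ∧ N.tgt e = N.src f := by
      intro e
      by_cases he : e ∈ F
      · rcases h : φ (N.tgt e) with _ | f
        -- If nothing were chosen at the head of `e`, the head would be fixed while the tail moves
        -- onto it. Injectivity makes `e` a loop, but an edge is chosen at its vertex.
        · exfalso
          have h1 : N.tgt e = N.src e := by
            apply hinj
            simp only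
            rw [hdest e he, h, dest]
          rw [h1, (hFm e).1 he] at h
          exact Option.some_ne_none _ h
        · have h1 := hsrc _ _ h
          exact ⟨f, fun _ => ⟨(hFm f).2 (by rw [h1, h]), h1.symm⟩⟩
      · exact ⟨e, fun h => (he h).elim⟩
    choose nx hnx using hnext
    obtain ⟨𝒞, h𝒞, hsup⟩ := N.exists_collection_of_next hF hF' nx hnx
    refine ⟨𝒞, by simpa using h𝒞, ?_⟩
    ext1 v
    simp only [hsup]
    rcases h : φ v with _ | e
    · rw [N.selection_eq_none]
      rintro e he rfl
      rw [(hFm e).1 he] at h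
      exact Option.some_ne_none _ h
    · rw [N.selection_eq_some hF]
      have h1 := hsrc v e h
      exact ⟨(hFm e).2 (by rw [h1, h]), h1⟩
  · intro 𝒞 h𝒞
    have h𝒞' : N.IsDisjointCollection 𝒞 := by simpa using h𝒞
    rw [N.prod_coef_selection X h𝒞'.injOn]
    change _ = _ * (mapMatrix A (N.stepMap (support 𝒞))).det
    rw [N.det_mapMatrix_collection 𝒞 h𝒞', support, Finset.prod_biUnion h𝒞'.pairwiseDisjoint,
      ← Finset.prod_mul_distrib, Finset.card_eq_sum_ones, ← Finset.prod_pow_eq_pow_sum,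
      ← Finset.prod_mul_distrib]
    apply Finset.prod_congr rfl
    intro S _
    simp only [id]
    -- The coefficients give `(-1)^|S|` and the cyclic permutation gives `(-1)^(|S| + 1)`; one minus
    -- sign per cycle survives.
    rw [Finset.prod_neg, pow_succ (-1 : A) S.card, pow_one]
    have : ((-1 : A) ^ S.card) * (-1) ^ S.card = 1 := by
      rw [← mul_pow]; simp
    linear_combination (∏ e ∈ S, X e) * this

end Expansion

end PerfectTorusNetwork

/-! ### The partition function as a determinant, and the removal of corner signs -/

theorem negOnePow_natCast (n : ℕ) : (n : ℤ).negOnePow = (-1 : ℤˣ) ^ n := by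
  rw [Int.negOnePow_def, zpow_natCast]

theorem neg_one_pow_natAbs (A : Type*) [Ring A] (n : ℤ) :
    (-1 : A) ^ n.natAbs = ((n.negOnePow : ℤ) : A) := by
  rw [← Int.negOnePow_abs, Int.abs_eq_natAbs, negOnePow_natCast]
  push_cast
  rfl

/-- The second alternative covers `a = 0`, where integer powers with exponents of mixed sign do not
add. It is what admits `λ = 0` for the networks `N̄_{k,n}`, whose edges never cross the cut
downwards. -/
theorem prod_zpow_eq_zpow_sum {K ι : Type*} [Field K] (a : K) (s : Finset ι) (f : ι → ℤ)
    (h : a ≠ 0 ∨ ∀ i, 0 ≤ f i) : ∏ i ∈ s, a ^ f i = a ^ ∑ i ∈ s, f i := by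
  classical
  induction s using Finset.induction_on with
  | empty => simp
  | insert i s hi ih =>
    rw [Finset.prod_insert hi, Finset.sum_insert hi, ih, zpow_add']
    rcases h with h | h
    · exact Or.inl h
    · have h1 := h i
      have h2 := Finset.sum_nonneg fun j (_ : j ∈ s) => h j
      by_cases h0 : f i + ∑ j ∈ s, f j = 0
      · exact Or.inr (Or.inr ⟨by omega, by omega⟩)
      · exact Or.inr (Or.inl h0)

theorem prod_negOnePow {ι : Type*} (s : Finset ι) (f : ι → ℤ) :
    ∏ i ∈ s, (f i).negOnePow = (∑ i ∈ s, f i).negOnePow := by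
  classical
  induction s using Finset.induction_on with
  | empty => simp
  | insert i s hi ih => rw [Finset.prod_insert hi, Finset.sum_insert hi, ih, Int.negOnePow_add]

namespace PerfectTorusNetwork

variable {V E : Type*} [Fintype V] [Fintype E] (N : PerfectTorusNetwork V E)

section Partition

variable {K : Type*} [Field K] {A : Type*} [CommRing A] [Algebra K A]

variable {N} in
theorem IsIdealRim.rimIndex_eq (h : N.IsIdealRim) (e : E) :
    N.rimIndex e = (N.rimTimes e).card := by
  rw [rimIndex, Finset.sum_congr rfl (g := fun _ => 1)]
  · simp
  · intro t ht
    rw [sign_pos (h e t ht)]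
    rfl

/-- The factor `(-1)^(d_λ + d_z) λ^d_λ z^d_z w_e` of an edge in the weight of a cycle. -/
noncomputable def edgeFactor (lam : K) (z : A) (w : E → A) (e : E) : A :=
  algebraMap K A (((N.cutIndex e).negOnePow : ℤ) * lam ^ N.cutIndex e) *
    (-z) ^ (N.rimTimes e).card * w e

variable {N} in
theorem IsIdealRim.cycleWeight_eq (h : N.IsIdealRim) (lam : K)
    (hlam : lam ≠ 0 ∨ ∀ e, 0 ≤ N.cutIndex e) (z : A) (w : E → A) (S : Finset E) :
    N.cycleWeight lam z w S = ∏ e ∈ S, N.edgeFactor lam z w e := by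
  simp only [edgeFactor, Finset.prod_mul_distrib, ← map_prod]
  rw [prod_zpow_eq_zpow_sum lam S _ hlam, Finset.prod_pow_eq_pow_sum, cycleWeight,
    neg_one_pow_natAbs, Finset.sum_add_distrib, Int.negOnePow_add, ← Int.cast_prod,
    ← Units.coe_prod, prod_negOnePow]
  have h1 : ∑ e ∈ S, N.rimIndex e = ((∑ e ∈ S, (N.rimTimes e).card : ℕ) : ℤ) := by
    push_cast
    exact Finset.sum_congr rfl fun e _ => h.rimIndex_eq e
  rw [h1, Int.toNat_natCast, negOnePow_natCast, neg_pow z, map_mul, map_intCast]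
  simp only [Units.val_mul, Units.val_pow_eq_pow_val, Units.val_neg, Units.val_one, Int.cast_mul,
    Int.cast_pow, Int.cast_neg, Int.cast_one]
  ring

variable {N} in
-- For an ideal rim, cycle weights are products of edge factors, so the expansion of the determinant
-- over disjoint collections reproduces the partition function term by term.
theorem IsIdealRim.partitionFunction_eq_det (h : N.IsIdealRim) (lam : K)
    (hlam : lam ≠ 0 ∨ ∀ e, 0 ≤ N.cutIndex e) (z : A) (w : E → A) :
    letI := Classical.decEq V
    N.partitionFunction lam z w = (1 - N.transfer (N.edgeFactor lam z w)).det := by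
  classical
  convert (N.det_one_sub_transfer (N.edgeFactor lam z w)).symm using 1
  · rw [partitionFunction]
    refine Finset.sum_congr ?_ fun 𝒞 _ => ?_
    · congr
    · rw [Finset.prod_congr rfl fun S _ => h.cycleWeight_eq lam hlam z w S]

/-- The corner contributions to the turning split into contributions of the edges. -/
theorem exists_corner_split (k : E → E → ℤ) :
    ∃ ks ke : E → ℤ, ∀ e f, N.tgt e = N.src f → k e f = ks f + ke e := by
  classical
  have hw : ∀ v : V, ∃ e, ({e | N.tgt e = v}.ncard = 1 → ∀ e', N.tgt e' = v → e' = e) ∧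
      ({e | N.src e = v}.ncard = 1 → ∀ e', N.src e' = v → e' = e) := by
    intro v
    rcases N.perfect v with ⟨h1, h2⟩ | ⟨h1, h2⟩
    · obtain ⟨e, he⟩ := Set.ncard_eq_one.1 h1
      refine ⟨e, fun _ e' he' => ?_, fun h => by omega⟩
      have : e' ∈ ({e} : Set E) := he ▸ he'
      exact this
    · obtain ⟨e, he⟩ := Set.ncard_eq_one.1 h2
      refine ⟨e, fun h => by omega, fun _ e' he' => ?_⟩
      have : e' ∈ ({e} : Set E) := he ▸ he'
      exact this
  choose r hr using hw
  -- At a white vertex the incoming edge is determined, so the contribution can be charged to the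
  -- outgoing edge alone; at a black vertex the roles are exchanged.
  refine ⟨fun f => if {e | N.tgt e = N.src f}.ncard = 1 then k (r (N.src f)) f else 0,
    fun e => if {e' | N.tgt e' = N.tgt e}.ncard = 1 then 0 else k e (r (N.tgt e)), ?_⟩
  intro e f hef
  simp only [hef]
  split_ifs with h
  · rw [add_zero, ← (hr (N.src f)).1 h e hef]
  · rw [zero_add, ← (hr (N.src f)).2 ?_ f rfl]
    rcases N.perfect (N.src f) with ⟨h1, h2⟩ | ⟨h1, h2⟩
    · exact absurd h1 h
    · exact h2

variable {N} in
-- After a cyclic reindexing of `ks`, the sum runs over the corners of the cycle, and Hopf's theorem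
-- applies.
theorem NoContractibleCycles.sum_eq_zero (h : N.NoContractibleCycles) {ks ke : E → ℤ}
    (hk : ∀ e f, N.tgt e = N.src f → angleBranch (N.angle e 1) (N.angle f 0) = ks f + ke e)
    {S : Finset E} (hS : N.IsSimpleCycle S) : ∑ e ∈ S, (ks e + ke e) = 0 := by
  have hne := h S hS
  obtain ⟨m, c, hinj, hc, hS⟩ := hS
  rw [N.sum_cycle hinj hS, ← N.sum_angleBranch_cycle hinj hc hS hne,
    Finset.sum_congr rfl fun i _ => hk _ _ (hc i), Finset.sum_add_distrib, Finset.sum_add_distrib]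
  congr 1
  exact (Equiv.sum_comp (Equiv.addRight 1) fun i => ks (c i)).symm

variable {N} in
-- The determinant depends on the edge factors only through their products over simple cycles.
theorem det_transfer_twist {κ : E → ℤ} (hκ : ∀ S, N.IsSimpleCycle S → ∑ e ∈ S, κ e = 0)
    (X : E → A) [DecidableEq V] :
    (1 - N.transfer fun e => (((κ e).negOnePow : ℤ) : A) * X e).det = (1 - N.transfer X).det := by
  classical
  have h1 := N.det_one_sub_transfer X
  have h2 := N.det_one_sub_transfer fun e => (((κ e).negOnePow : ℤ) : A) * X e
  convert h2.trans (Eq.trans _ h1.symm) using 1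
  · congr!
  · congr!
  · refine Finset.sum_congr rfl fun 𝒞 h𝒞 => ?_
    congr 1
    refine Finset.prod_congr rfl fun S hS => ?_
    rw [Finset.prod_mul_distrib, ← Int.cast_prod, ← Units.coe_prod, prod_negOnePow,
      hκ S ((Finset.mem_filter.1 h𝒞).2.1 S hS)]
    simp

end Partition

end PerfectTorusNetwork

/-! ### Block elimination, and gluing the pieces of edges along the rim -/

theorem Matrix.det_one_sub_eq_one_of_rank {R n α : Type*} [CommRing R] [Fintype n] [DecidableEq n]
    [LinearOrder α] (b : n → α) (T : Matrix n n R) (h : ∀ i j, b j ≤ b i → T i j = 0) :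
    (1 - T).det = 1 := by
  have hT : Matrix.BlockTriangular (1 - T) b := by
    intro i j hij
    rw [Matrix.sub_apply, Matrix.one_apply_ne (by rintro rfl; exact lt_irrefl _ hij),
      h i j hij.le, sub_zero]
  rw [hT.det]
  apply Finset.prod_eq_one
  intro a _
  have : (1 - T).toSquareBlock b a = 1 := by
    ext i j
    rw [Matrix.toSquareBlock_def, Matrix.of_apply, Matrix.sub_apply,
      h i j (by rw [i.2, j.2]), sub_zero, Matrix.one_apply, Matrix.one_apply]
    simp only [Subtype.ext_iff]
  rw [this, Matrix.det_one]

theorem fromBlocks_sub {l m n o α : Type*} [Sub α] (A A' : Matrix n l α) (B B' : Matrix n m α)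
    (C C' : Matrix o l α) (D D' : Matrix o m α) :
    Matrix.fromBlocks A B C D - Matrix.fromBlocks A' B' C' D' =
      Matrix.fromBlocks (A - A') (B - B') (C - C') (D - D') := by
  ext (i | i) (j | j) <;> rfl

/-- Elimination of a block of variables. -/
theorem Matrix.det_one_sub_fromBlocks {K l m : Type*} [CommRing K] [Fintype l] [Fintype m] [DecidableEq l]
    [DecidableEq m] (A : Matrix l l K) (B : Matrix l m K) (C : Matrix m l K) (D : Matrix m m K)
    (U : Matrix m l K) (hU : C + D * U = U) :
    (1 - Matrix.fromBlocks A B C D).det = (1 - (A + B * U)).det * (1 - D).det := by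
  have hdet : (Matrix.fromBlocks (1 : Matrix l l K) 0 U 1).det = 1 := by
    rw [Matrix.det_fromBlocks_zero₁₂, Matrix.det_one, Matrix.det_one, one_mul]
  -- Right multiplication by a unitriangular block matrix clears the lower left block, since `hU`
  -- says `(1 - D) U = C`. No invertibility of `1 - D` is needed.
  rw [← mul_one (Matrix.det _), ← hdet, ← Matrix.det_mul, ← Matrix.fromBlocks_one,
    fromBlocks_sub, Matrix.fromBlocks_multiply]
  have c1 : (1 - A) * (1 : Matrix l l K) + (0 - B) * U = 1 - (A + B * U) := by
    rw [Matrix.mul_one, zero_sub, Matrix.neg_mul]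
    abel
  have c2 : (0 - C) * (1 : Matrix l l K) + (1 - D) * U = 0 := by
    rw [Matrix.mul_one, Matrix.sub_mul, Matrix.one_mul]
    nth_rewrite 1 [← hU]
    abel
  rw [c1, c2, Matrix.mul_zero, Matrix.mul_one, zero_add, Matrix.mul_zero, Matrix.mul_one, zero_add,
    Matrix.det_fromBlocks_zero₂₁]

theorem Finset.filter_lt_eq_insert_min' {T : Finset ℝ} {s : ℝ} (h : (T.filter (s < ·)).Nonempty) :
    T.filter (s < ·) = insert ((T.filter (s < ·)).min' h)
      (T.filter ((T.filter (s < ·)).min' h < ·)) := by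
  have hm := Finset.mem_filter.1 ((T.filter (s < ·)).min'_mem h)
  ext t
  rw [Finset.mem_insert]
  constructor
  · intro ht
    rcases ((T.filter (s < ·)).min'_le t ht).eq_or_lt with h1 | h1
    · exact Or.inl h1.symm
    · exact Or.inr (Finset.mem_filter.2 ⟨(Finset.mem_filter.1 ht).1, h1⟩)
  · rintro (rfl | ht)
    · exact (T.filter (s < ·)).min'_mem h
    · have ht := Finset.mem_filter.1 ht
      exact Finset.mem_filter.2 ⟨ht.1, hm.2.trans ht.2⟩

namespace PerfectTorusNetwork

variable {V E : Type*} [Fintype V] [Fintype E] (N : PerfectTorusNetwork V E)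

theorem mem_Ioo_of_mem_rimTimes {e : E} {t : ℝ} (h : t ∈ N.rimTimes e) : t ∈ Set.Ioo (0 : ℝ) 1 :=
  (Set.Finite.mem_toFinset _).1 h |>.1

theorem pieceStart_eq_inr {a : N.Piece} {p : N.RimPoint} :
    N.pieceStart a = Sum.inr p ↔ a = Sum.inr p := by
  rcases a with e | q <;> simp [pieceStart]

theorem pieceEnd_eq_inr {a : N.Piece} {q : N.RimPoint} (h : N.pieceEnd a = Sum.inr q) :
    N.endTime a = q.2.1 ∧ N.pieceEdge a = q.1 ∧ N.startTime a < q.2.1 := by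
  unfold pieceEnd at h
  split_ifs at h with h1
  obtain rfl := Sum.inr.inj h
  refine ⟨dif_pos h1, rfl, ?_⟩
  exact (Finset.mem_filter.1 ((N.laterRimTimes a).min'_mem h1)).2

theorem pieceEnd_eq_inl {a : N.Piece} {v : V} (h : N.pieceEnd a = Sum.inl v) :
    N.endTime a = 1 ∧ N.tgt (N.pieceEdge a) = v := by
  unfold pieceEnd at h
  split_ifs at h with h1
  exact ⟨dif_neg h1, Sum.inl.inj h⟩

section Algebra

variable {A : Type*} [CommRing A]

open Classical in
/-- Incidence of initial vertices with pieces. -/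
noncomputable def startVertex (A : Type*) [CommRing A] : Matrix V N.Piece A :=
  Matrix.of fun v a => if N.pieceStart a = Sum.inl v then 1 else 0

open Classical in
/-- Incidence of sources with pieces. -/
noncomputable def startRim (A : Type*) [CommRing A] : Matrix N.RimPoint N.Piece A :=
  Matrix.of fun p a => if N.pieceStart a = Sum.inr p then 1 else 0

open Classical in
/-- Incidence of pieces with final vertices. -/
noncomputable def endVertex (A : Type*) [CommRing A] : Matrix N.Piece V A :=
  Matrix.of fun a v => if N.pieceEnd a = Sum.inl v then 1 else 0

open Classical in
/-- Incidence of pieces with sinks. -/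
noncomputable def endRim (A : Type*) [CommRing A] : Matrix N.Piece N.RimPoint A :=
  Matrix.of fun a q => if N.pieceEnd a = Sum.inr q then 1 else 0

theorem startRim_mul {n : Type*} (f : Matrix N.Piece n A) :
    N.startRim A * f = Matrix.of fun p w => f (Sum.inr p) w := by
  classical
  ext p w
  simp [Matrix.mul_apply, startRim, pieceStart_eq_inr]

open Classical in
theorem startVertex_mul_apply {n : Type*} (f : Matrix N.Piece n A) (v : V) (w : n) :
    (N.startVertex A * f) v w = ∑ e, if N.src e = v then f (Sum.inl e) w else 0 := by
  simp [Matrix.mul_apply, startVertex, pieceStart]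

open Classical in
/-- The factor of a rim point in the weight of an edge. -/
noncomputable def rimFactor (ζ : A) (x : N.Piece → A) (e : E) (t : ℝ) : A :=
  if h : t ∈ N.rimTimes e then ζ * x (Sum.inr ⟨e, t, h⟩) else 1

/-- The product of the rim factors beyond a given parameter. -/
noncomputable def tailProd (ζ : A) (x : N.Piece → A) (e : E) (s : ℝ) : A :=
  ∏ t ∈ (N.rimTimes e).filter (s < ·), N.rimFactor ζ x e t

theorem mul_tailProd_zero (ζ : A) (x : N.Piece → A) (e : E) :
    x (Sum.inl e) * N.tailProd ζ x e 0 = ζ ^ (N.rimTimes e).card * N.edgeWeight x e := by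
  rw [tailProd, Finset.filter_true_of_mem fun _ ht => (N.mem_Ioo_of_mem_rimTimes ht).1, edgeWeight]
  have : ∏ t ∈ N.rimTimes e, N.rimFactor ζ x e t =
      ∏ t : {t : ℝ // t ∈ N.rimTimes e}, ζ * x (Sum.inr ⟨e, t⟩) := by
    rw [← Finset.prod_coe_sort]
    refine Finset.prod_congr rfl fun t _ => ?_
    rw [rimFactor, dif_pos t.2]
  rw [this, Finset.prod_mul_distrib, Finset.prod_const, Finset.card_univ, Fintype.card_coe]
  ring

open Classical in
/-- The sum over continuations of a piece to the end of its edge. -/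
noncomputable def tailMatrix (ζ : A) (x : N.Piece → A) : Matrix N.Piece V A :=
  Matrix.of fun a w => if N.tgt (N.pieceEdge a) = w then
    N.tailProd ζ x (N.pieceEdge a) (N.startTime a) else 0

/-- The sum over continuations of a source to the end of its edge. -/
noncomputable def rimTailMatrix (ζ : A) (x : N.Piece → A) : Matrix N.RimPoint V A :=
  Matrix.of fun p w => ζ * (x (Sum.inr p) * N.tailMatrix ζ x (Sum.inr p) w)

open Classical in
-- A piece either ends at a vertex, or at a rim point from which the edge continues with the factor
-- `ζ` and the next piece; the second term collects these continuations.
theorem endVertex_add_endRim_mul (ζ : A) (x : N.Piece → A) :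
    N.endVertex A + N.endRim A * N.rimTailMatrix ζ x = N.tailMatrix ζ x := by
  ext a w
  rw [Matrix.add_apply, Matrix.mul_apply]
  rcases h : N.pieceEnd a with v | q
  · obtain ⟨-, h2⟩ := N.pieceEnd_eq_inl h
    have h1 : ¬ (N.laterRimTimes a).Nonempty := by
      intro hc
      rw [pieceEnd, dif_pos hc] at h
      exact Sum.inr_ne_inl h
    rw [Finset.not_nonempty_iff_eq_empty, laterRimTimes] at h1
    simp [endVertex, endRim, h, tailMatrix, h2, tailProd, h1]
  · obtain ⟨h1, h2, h3⟩ := N.pieceEnd_eq_inr h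
    have hne : (N.laterRimTimes a).Nonempty := by
      by_contra hc
      rw [pieceEnd, dif_neg hc] at h
      exact Sum.inl_ne_inr h
    have hmin : (N.laterRimTimes a).min' hne = q.2.1 := by
      rw [← h1, endTime, dif_pos hne]
    have hins := Finset.filter_lt_eq_insert_min' hne
    change _ = insert ((N.laterRimTimes a).min' hne)
      ((N.rimTimes (N.pieceEdge a)).filter ((N.laterRimTimes a).min' hne < ·)) at hins
    rw [hmin, h2] at hins
    have hp : N.tailProd ζ x q.1 (N.startTime a) =
        N.rimFactor ζ x q.1 q.2.1 * N.tailProd ζ x q.1 q.2.1 := by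
      rw [tailProd, tailProd, hins, Finset.prod_insert (by simp)]
    have hq : N.rimFactor ζ x q.1 q.2.1 = ζ * x (Sum.inr q) := by
      rw [rimFactor, dif_pos q.2.2]
      rfl
    have hq1 : N.pieceEdge (Sum.inr q) = q.1 := rfl
    have hq2 : N.startTime (Sum.inr q) = q.2.1 := rfl
    simp only [endVertex, endRim, Matrix.of_apply, h, reduceCtorEq, if_false, Sum.inr.injEq,
      ite_mul, one_mul, zero_mul, Finset.sum_ite_eq, Finset.mem_univ, if_true, zero_add,
      rimTailMatrix, tailMatrix, h2, hq1, hq2]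
    split_ifs with hw
    · rw [hp, hq]
      ring
    · simp

open Classical in
-- Pieces are exchanged for vertices and rim points by `det (1 - XY) = det (1 - YX)`, and the rim
-- points are then eliminated. Transitions between rim points only move forward along an edge, so
-- their block has determinant `1`. What remains is the transfer matrix in which each edge is
-- traversed as a whole. The value `ζ = 0` describes the cylinder and `ζ = -z` the torus.
theorem det_one_sub_piece (ζ : A) (x : N.Piece → A) :
    (1 - Matrix.diagonal x * (N.endVertex A * N.startVertex A +
      ζ • (N.endRim A * N.startRim A))).det =
      (1 - N.transfer fun e => ζ ^ (N.rimTimes e).card * N.edgeWeight x e).det := by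
  set D := Matrix.diagonal x
  set Q0 := N.endVertex A
  set Q := N.endRim A
  set S0 := N.startVertex A
  set S := N.startRim A
  set U := N.rimTailMatrix ζ x with hU
  have hchain : Q0 + Q * U = N.tailMatrix ζ x := N.endVertex_add_endRim_mul ζ x
  have hUR : ζ • (S * (D * N.tailMatrix ζ x)) = U := by
    rw [N.startRim_mul]
    ext p w
    simp [D, hU, rimTailMatrix, Matrix.diagonal_mul]
  have hUV : S0 * (D * N.tailMatrix ζ x) =
      N.transfer fun e => ζ ^ (N.rimTimes e).card * N.edgeWeight x e := by
    ext v w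
    rw [N.startVertex_mul_apply, transfer, Matrix.of_apply]
    refine Finset.sum_congr rfl fun e _ => ?_
    rw [Matrix.diagonal_mul, ← mul_tailProd_zero]
    by_cases h1 : N.src e = v <;> by_cases h2 : N.tgt e = w <;>
      simp [h1, h2, tailMatrix, pieceEdge, startTime]
  have e1 : D * (Q0 * S0 + ζ • (Q * S)) = (D * Matrix.fromCols Q0 Q) * Matrix.fromRows S0 (ζ • S) := by
    rw [Matrix.mul_assoc, Matrix.fromCols_mul_fromRows, Matrix.mul_smul]
  have e2 : Matrix.fromRows S0 (ζ • S) * (D * Matrix.fromCols Q0 Q) =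
      Matrix.fromBlocks (S0 * D * Q0) (S0 * D * Q) (ζ • (S * D * Q0)) (ζ • (S * D * Q)) := by
    rw [← Matrix.mul_assoc, Matrix.fromRows_mul, Matrix.fromRows_mul_fromCols]
    simp only [Matrix.smul_mul]
  rw [e1, Matrix.det_one_sub_mul_comm, e2]
  have hU' : ζ • (S * D * Q0) + ζ • (S * D * Q) * U = U := by
    conv_rhs => rw [← hUR, ← hchain]
    simp only [Matrix.mul_add, smul_add, Matrix.mul_assoc, Matrix.smul_mul]
  rw [Matrix.det_one_sub_fromBlocks _ _ _ _ U hU',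
    Matrix.det_one_sub_eq_one_of_rank (fun p : N.RimPoint => p.2.1), mul_one, ← hUV, ← hchain]
  · simp only [Matrix.mul_add, Matrix.mul_assoc]
  intro p q hqp
  rw [Matrix.smul_apply, Matrix.mul_assoc, N.startRim_mul]
  simp only [Matrix.of_apply, D, Matrix.diagonal_mul, Q, endRim]
  rw [if_neg, mul_zero, smul_zero]
  intro hc
  exact absurd (N.pieceEnd_eq_inr hc).2.2 (not_lt.2 hqp)

open Classical in
/-- The determinant identity for a matrix of sums over paths. -/
theorem det_one_add_smul_paths (z : A) (x : N.Piece → A) (W : Matrix N.Piece N.RimPoint A)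
    (hW : (1 - Matrix.diagonal x * (N.endVertex A * N.startVertex A)) * W =
      Matrix.diagonal x * N.endRim A) :
    (1 + z • (N.startRim A * W)).det *
      (1 - N.transfer fun e => (0 : A) ^ (N.rimTimes e).card * N.edgeWeight x e).det =
      (1 - N.transfer fun e => (-z) ^ (N.rimTimes e).card * N.edgeWeight x e).det := by
  -- After `det (1 + z S W) = det (1 + z W S)` the two determinants multiply, and `hW` replaces `(1
  -- - D Q₀ S₀) W` by `D Q`.
  rw [← det_one_sub_piece, ← det_one_sub_piece, ← Matrix.mul_smul, Matrix.det_one_add_mul_comm,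
    mul_comm, ← Matrix.det_mul, zero_smul, add_zero, Matrix.mul_add, Matrix.mul_one,
    Matrix.smul_mul, Matrix.mul_smul, ← Matrix.mul_assoc _ W, hW]
  congr 1
  rw [Matrix.mul_add, Matrix.mul_smul, neg_smul, Matrix.mul_assoc]
  abel

end Algebra

end PerfectTorusNetwork

/-! ### Signed cut crossings as differences of floors, and telescoping over pieces -/

theorem eventually_floor_eq {f : ℝ → ℝ} {s : Set ℝ} {x : ℝ} (hf : ContinuousWithinAt f s x)
    (hx : ∀ m : ℤ, f x ≠ m) : ∀ᶠ y in nhdsWithin x s, ⌊f y⌋ = ⌊f x⌋ := by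
  have h1 : (⌊f x⌋ : ℝ) < f x := lt_of_le_of_ne (Int.floor_le _) (hx _).symm
  have h2 : f x < ⌊f x⌋ + 1 := Int.lt_floor_add_one _
  filter_upwards [hf (Ioo_mem_nhds h1 h2)] with y hy
  exact Int.floor_eq_iff.2 ⟨hy.1.le, hy.2⟩

/-- Counting transversal crossings of integer levels with signs. -/
theorem sum_sign_eq_floor_sub {f : ℝ → ℝ} {a b : ℝ} (hab : a < b)
    (hf : ContinuousOn f (Set.Icc a b)) (T : Finset ℝ)
    (hT : ∀ t, t ∈ T ↔ t ∈ Set.Ioo a b ∧ ∃ m : ℤ, f t = m) (ha : ∀ m : ℤ, f a ≠ m)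
    (hb : ∀ m : ℤ, f b ≠ m) (σ : ℝ → ℤ)
    (hσ : ∀ t ∈ T, (σ t = 1 ∧ 0 < deriv f t) ∨ (σ t = -1 ∧ deriv f t < 0)) :
    ∑ t ∈ T, σ t = ⌊f b⌋ - ⌊f a⌋ := by
  classical
  -- This function is locally constant. At an upward crossing the floor jumps at the point itself,
  -- at a downward one only behind it; the last term compensates for the difference.
  set g : ℝ → ℤ := fun x => ⌊f x⌋ - ∑ t ∈ T.filter (· < x), σ t -
    if x ∈ T ∧ σ x = 1 then 1 else 0 with hg
  have hsep : ∀ x : ℝ, ∀ᶠ y in nhds x, ∀ t ∈ T, t ≠ x → y ≠ t ∧ (t < y ↔ t < x) := by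
    intro x
    rw [Filter.eventually_all_finset]
    intro t _
    rcases lt_trichotomy t x with h | rfl | h
    · filter_upwards [Ioi_mem_nhds h] with y hy _
      exact ⟨(Set.mem_Ioi.1 hy).ne', iff_of_true hy h⟩
    · exact Filter.Eventually.of_forall fun y h => (h rfl).elim
    · filter_upwards [Iio_mem_nhds h] with y hy _
      exact ⟨(Set.mem_Iio.1 hy).ne, iff_of_false (not_lt.2 (Set.mem_Iio.1 hy).le) (not_lt.2 h.le)⟩
  have hloc : ∀ x ∈ Set.Icc a b, ∀ᶠ y in nhdsWithin x (Set.Icc a b), g y = g x := by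
    intro x hx
    by_cases hxT : x ∈ T
    · obtain ⟨hxab, m, hm⟩ := (hT x).1 hxT
      have hcont : ContinuousAt f x := hf.continuousAt (Icc_mem_nhds hxab.1 hxab.2)
      have hnear : ∀ᶠ y in nhds x, f y ∈ Set.Ioo ((m : ℝ) - 1) (m + 1) :=
        hcont (Ioo_mem_nhds (by rw [hm]; linarith) (by rw [hm]; linarith))
      have hsplit : ∀ y, x < y → (∀ t ∈ T, t ≠ x → y ≠ t ∧ (t < y ↔ t < x)) →
          ∑ t ∈ T.filter (· < y), σ t = σ x + ∑ t ∈ T.filter (· < x), σ t := by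
        intro y hxy hy
        rw [← Finset.sum_insert (by simp)]
        refine Finset.sum_congr ?_ fun _ _ => rfl
        ext t
        simp only [Finset.mem_filter, Finset.mem_insert]
        by_cases htx : t = x
        · subst htx
          simp [hxT, hxy]
        · simp only [htx, false_or]
          exact and_congr_right fun ht => (hy t ht htx).2
      have hsame : ∀ y, y < x → (∀ t ∈ T, t ≠ x → y ≠ t ∧ (t < y ↔ t < x)) →
          ∑ t ∈ T.filter (· < y), σ t = ∑ t ∈ T.filter (· < x), σ t := by
        intro y hxy hy
        refine Finset.sum_congr ?_ fun _ _ => rfl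
        ext t
        simp only [Finset.mem_filter]
        by_cases htx : t = x
        · subst htx
          simp [hxy.le]
        · exact and_congr_right fun ht => (hy t ht htx).2
      have hyT : ∀ y, y ≠ x → (∀ t ∈ T, t ≠ x → y ≠ t ∧ (t < y ↔ t < x)) → y ∉ T :=
        fun y hyx hy hyT => (hy y hyT hyx).1 rfl
      have hfx : ⌊f x⌋ = m := by rw [hm, Int.floor_intCast]
      apply Filter.Eventually.filter_mono nhdsWithin_le_nhds
      have hd0 : (fun y => f y - m) x = 0 := by simp [hm]
      have hder : deriv (fun y => f y - m) x = deriv f x := deriv_sub_const _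
      rcases hσ x hxT with ⟨h1, h2⟩ | ⟨h1, h2⟩
      · have hs := eventually_nhdsWithin_sign_eq_of_deriv_pos (f := fun y => f y - m) (x₀ := x)
          (by rw [hder]; exact h2) hd0
        filter_upwards [hsep x, hnear, hs] with y hy hn hsy
        rcases lt_trichotomy y x with h | rfl | h
        · rw [sign_neg (sub_neg.2 h), sign_eq_neg_one_iff] at hsy
          have : ⌊f y⌋ = m - 1 := Int.floor_eq_iff.2 ⟨by push_cast; linarith [hn.1],
            by push_cast; linarith⟩
          simp [hg, this, hfx, hsame y h hy, hyT y h.ne hy, hxT, h1]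
          ring
        · rfl
        · rw [sign_pos (sub_pos.2 h), sign_eq_one_iff] at hsy
          have : ⌊f y⌋ = m := Int.floor_eq_iff.2 ⟨by linarith, hn.2⟩
          simp [hg, this, hfx, hsplit y h hy, hyT y h.ne' hy, hxT, h1]
          ring
      · have hs := eventually_nhdsWithin_sign_eq_of_deriv_neg (f := fun y => f y - m) (x₀ := x)
          (by rw [hder]; exact h2) hd0
        filter_upwards [hsep x, hnear, hs] with y hy hn hsy
        rcases lt_trichotomy y x with h | rfl | h
        · rw [sign_pos (sub_pos.2 h), sign_eq_one_iff] at hsy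
          have : ⌊f y⌋ = m := Int.floor_eq_iff.2 ⟨by linarith, hn.2⟩
          simp [hg, this, hfx, hsame y h hy, hyT y h.ne hy, h1]
        · rfl
        · rw [sign_neg (sub_neg.2 h), sign_eq_neg_one_iff] at hsy
          have : ⌊f y⌋ = m - 1 := Int.floor_eq_iff.2 ⟨by push_cast; linarith [hn.1],
            by push_cast; linarith⟩
          simp [hg, this, hfx, hsplit y h hy, hyT y h.ne' hy, h1]
          ring
    · have hne : ∀ m : ℤ, f x ≠ m := by
        intro m hm
        rcases hx.1.eq_or_lt with rfl | h1
        · exact ha m hm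
        rcases hx.2.eq_or_lt with rfl | h2
        · exact hb m hm
        exact hxT ((hT x).2 ⟨⟨h1, h2⟩, m, hm⟩)
      filter_upwards [eventually_floor_eq (hf x hx) hne, nhdsWithin_le_nhds (hsep x)] with y h1 hy
      have hyT : y ∉ T := fun hyT => by
        by_cases hyx : y = x
        · exact hxT (hyx ▸ hyT)
        · exact (hy y hyT hyx).1 rfl
      have hs : T.filter (· < y) = T.filter (· < x) := by
        ext t
        simp only [Finset.mem_filter]
        exact and_congr_right fun ht => (hy t ht (fun hc => hxT (hc ▸ ht))).2
      simp only [hg, h1, hs, hyT, hxT, false_and, if_false]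
  have hgc : ContinuousOn g (Set.Icc a b) := fun x hx =>
    tendsto_const_nhds.congr' ((hloc x hx).mono fun y hy => hy.symm)
  have hconst := isPreconnected_Icc.constant hgc (Set.left_mem_Icc.2 hab.le)
    (Set.right_mem_Icc.2 hab.le)
  have haT : a ∉ T := fun h => ha _ ((hT a).1 h).2.choose_spec
  have hbT : b ∉ T := fun h => hb _ ((hT b).1 h).2.choose_spec
  have hfa : T.filter (· < a) = ∅ := Finset.filter_eq_empty_iff.2 fun t ht =>
    not_lt.2 ((hT t).1 ht).1.1.le
  have hfb : T.filter (· < b) = T := Finset.filter_true_of_mem fun t ht => ((hT t).1 ht).1.2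
  simp only [hg, haT, hbT, hfa, hfb, false_and, if_false, Finset.sum_empty] at hconst
  linarith

/-- The next point of a finite set, or `1`. -/
noncomputable def nextPoint (T : Finset ℝ) (s : ℝ) : ℝ :=
  if h : (T.filter (s < ·)).Nonempty then (T.filter (s < ·)).min' h else 1

/-- Each point of the set is the end of one interval and the start of the next, so the sum
telescopes up to the parameter `1`. -/
theorem sum_nextPoint {M : Type*} [AddCommGroup M] (T : Finset ℝ) (g : ℝ → M) (s : ℝ) :
    ∑ t ∈ T.filter (s < ·), (g (nextPoint T t) - g t) + g (nextPoint T s) = g 1 := by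
  induction hn : (T.filter (s < ·)).card using Nat.strong_induction_on generalizing s with
  | _ n ih =>
    by_cases h : (T.filter (s < ·)).Nonempty
    · have hins := Finset.filter_lt_eq_insert_min' h
      have hnx : nextPoint T s = (T.filter (s < ·)).min' h := dif_pos h
      rw [← hnx] at hins
      have hnot : nextPoint T s ∉ T.filter (nextPoint T s < ·) := by simp
      have hcard : (T.filter (nextPoint T s < ·)).card < n := by
        rw [← hn, hins, Finset.card_insert_of_notMem hnot]
        exact Nat.lt_succ_self _
      have := ih _ hcard (nextPoint T s) rfl
      rw [hins, Finset.sum_insert hnot, ← this]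
      abel
    · rw [nextPoint, dif_neg h, Finset.not_nonempty_iff_eq_empty.1 h]
      simp

namespace PerfectTorusNetwork

variable {V E : Type*} [Fintype V] [Fintype E] (N : PerfectTorusNetwork V E)

theorem endTime_eq (a : N.Piece) :
    N.endTime a = nextPoint (N.rimTimes (N.pieceEdge a)) (N.startTime a) := rfl

/-- Telescoping over the pieces of an edge. -/
theorem sum_pieces {M : Type*} [AddCommGroup M] (e : E) (g : ℝ → M) :
    (g (N.endTime (Sum.inl e)) - g 0) + ∑ t : {t : ℝ // t ∈ N.rimTimes e},
      (g (N.endTime (Sum.inr ⟨e, t⟩)) - g t) = g 1 - g 0 := by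
  rw [← sum_nextPoint (N.rimTimes e) g 0,
    Finset.filter_true_of_mem fun _ ht => (N.mem_Ioo_of_mem_rimTimes ht).1,
    ← Finset.sum_coe_sort (N.rimTimes e)]
  simp only [endTime_eq, startTime, pieceEdge]
  abel

/-- The height of a point of an edge. -/
def height (e : E) (t : ℝ) : ℝ := (N.curve e t).im

theorem height_hasDeriv (e : E) (t : ℝ) (ht : t ∈ Set.Icc (0 : ℝ) 1) :
    HasDerivWithinAt (N.height e) (N.speed e t * Real.sin (N.angle e t)) (Set.Icc 0 1) t := by
  have h := Complex.imCLM.hasFDerivAt.comp_hasDerivWithinAt t (N.hasDeriv e t ht)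
  have h2 : Complex.imCLM ((N.speed e t : ℂ) * Complex.exp ((N.angle e t : ℂ) * Complex.I)) =
      N.speed e t * Real.sin (N.angle e t) := by
    rw [Complex.imCLM_apply, Complex.im_ofReal_mul, Complex.exp_ofReal_mul_I_im]
  rw [h2] at h
  exact h

theorem height_zero_ne (e : E) (m : ℤ) : N.height e 0 ≠ m := by
  obtain ⟨k, l, h⟩ := N.curve_zero e
  intro hm
  apply N.pos_cut (N.src e) (m - l)
  have := congrArg Complex.im h
  simp at this
  push_cast
  rw [← hm, height]
  linarith

theorem height_one_ne (e : E) (m : ℤ) : N.height e 1 ≠ m := by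
  obtain ⟨k, l, h⟩ := N.curve_one e
  intro hm
  apply N.pos_cut (N.tgt e) (m - l)
  have := congrArg Complex.im h
  simp at this
  push_cast
  rw [← hm, height]
  linarith

theorem height_rim_ne {e : E} {t : ℝ} (ht : t ∈ N.rimTimes e) (m : ℤ) : N.height e t ≠ m := by
  obtain ⟨h1, n, h2⟩ := (Set.Finite.mem_toFinset _).1 ht
  exact N.avoid_corner e t h1 n m h2

theorem mem_cutTimes {e : E} {t : ℝ} :
    t ∈ N.cutTimes e ↔ t ∈ Set.Ioo (0 : ℝ) 1 ∧ ∃ m : ℤ, N.height e t = m :=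
  Set.Finite.mem_toFinset _

theorem sum_cutTimes (e : E) {a b : ℝ} (h0 : 0 ≤ a) (hab : a < b) (h1 : b ≤ 1)
    (ha : ∀ m : ℤ, N.height e a ≠ m) (hb : ∀ m : ℤ, N.height e b ≠ m) :
    ∑ t ∈ (N.cutTimes e).filter (fun t => a < t ∧ t < b),
      (SignType.sign (Real.sin (N.angle e t)) : ℤ) = ⌊N.height e b⌋ - ⌊N.height e a⌋ := by
  have hsub : Set.Icc a b ⊆ Set.Icc 0 1 := Set.Icc_subset_Icc h0 h1
  apply sum_sign_eq_floor_sub hab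
  · exact fun t ht => ((N.height_hasDeriv e t (hsub ht)).continuousWithinAt).mono hsub
  · intro t
    rw [Finset.mem_filter, mem_cutTimes]
    constructor
    · rintro ⟨⟨-, h⟩, h'⟩
      exact ⟨h', h⟩
    · rintro ⟨h', h⟩
      exact ⟨⟨⟨h0.trans_lt h'.1, h'.2.trans_le h1⟩, h⟩, h'⟩
  · exact ha
  · exact hb
  · intro t ht
    obtain ⟨h2, m, h3⟩ := N.mem_cutTimes.1 (Finset.mem_filter.1 ht).1
    have hd := ((N.height_hasDeriv e t (Set.Ioo_subset_Icc_self h2)).hasDerivAt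
      (Icc_mem_nhds h2.1 h2.2)).deriv
    have hs := N.speed_pos e t (Set.Ioo_subset_Icc_self h2)
    rw [hd]
    rcases (N.cut_transversal e t h2 m h3).lt_or_gt with h | h
    · right
      rw [sign_neg h]
      exact ⟨rfl, mul_neg_of_pos_of_neg hs h⟩
    · left
      rw [sign_pos h]
      exact ⟨rfl, mul_pos hs h⟩

theorem cutIndex_eq (e : E) : N.cutIndex e = ⌊N.height e 1⌋ - ⌊N.height e 0⌋ := by
  rw [← N.sum_cutTimes e le_rfl one_pos le_rfl (N.height_zero_ne e) (N.height_one_ne e)]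
  exact Finset.sum_congr (Finset.filter_true_of_mem fun t ht => (N.mem_cutTimes.1 ht).1).symm
    fun _ _ => rfl

theorem startTime_nonneg (a : N.Piece) : 0 ≤ N.startTime a := by
  rcases a with e | p
  · exact le_rfl
  · exact (N.mem_Ioo_of_mem_rimTimes p.2.2).1.le

theorem height_start_ne (a : N.Piece) (m : ℤ) : N.height (N.pieceEdge a) (N.startTime a) ≠ m := by
  rcases a with e | p
  · exact N.height_zero_ne e m
  · exact N.height_rim_ne p.2.2 m

theorem startTime_lt_endTime_and (a : N.Piece) : N.startTime a < N.endTime a ∧ N.endTime a ≤ 1 ∧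
    ∀ m : ℤ, N.height (N.pieceEdge a) (N.endTime a) ≠ m := by
  rcases h : N.pieceEnd a with v | q
  · obtain ⟨h1, -⟩ := N.pieceEnd_eq_inl h
    rw [h1]
    refine ⟨?_, le_rfl, N.height_one_ne _⟩
    rcases a with e | p
    · exact one_pos
    · exact (N.mem_Ioo_of_mem_rimTimes p.2.2).2
  · obtain ⟨h1, h2, h3⟩ := N.pieceEnd_eq_inr h
    rw [h1, h2]
    exact ⟨h3, (N.mem_Ioo_of_mem_rimTimes q.2.2).2.le, N.height_rim_ne q.2.2⟩

theorem pieceCutIndex_eq (a : N.Piece) : N.pieceCutIndex a =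
    ⌊N.height (N.pieceEdge a) (N.endTime a)⌋ - ⌊N.height (N.pieceEdge a) (N.startTime a)⌋ := by
  obtain ⟨h1, h2, h3⟩ := N.startTime_lt_endTime_and a
  exact N.sum_cutTimes _ (N.startTime_nonneg a) h1 h2 (N.height_start_ne a) h3

end PerfectTorusNetwork

/-! ### Rotation numbers of paths as sums over pieces -/

theorem exteriorAngle_eq_of_mem {a b x : ℝ} {n : ℤ} (hx : x ∈ Set.Ioc (-Real.pi) Real.pi)
    (h : b - a = x + n * (2 * Real.pi)) : exteriorAngle a b = x := by
  rw [← Real.Angle.toReal_coe_eq_self_iff_mem_Ioc] at hx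
  rw [exteriorAngle, h, ← zsmul_eq_mul, Real.Angle.coe_add, Real.Angle.coe_zsmul,
    Real.Angle.coe_two_pi, smul_zero, add_zero, hx]

theorem abs_sub_round_mul_two_pi {x : ℝ} (h : 0 < Real.cos x) :
    |x - round (x / (2 * Real.pi)) * (2 * Real.pi)| < Real.pi / 2 := by
  have hp := Real.pi_pos
  have hk := abs_sub_round (x / (2 * Real.pi))
  have h1 : |x - round (x / (2 * Real.pi)) * (2 * Real.pi)| ≤ Real.pi := by
    have : x - round (x / (2 * Real.pi)) * (2 * Real.pi) =
      (x / (2 * Real.pi) - round (x / (2 * Real.pi))) * (2 * Real.pi) := by field_simp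
    rw [this, abs_mul, abs_of_pos (by positivity : (0 : ℝ) < 2 * Real.pi)]
    nlinarith
  by_contra! hc
  have := Real.cos_nonpos_of_pi_div_two_le_of_le hc (by linarith)
  rw [Real.cos_abs, Real.cos_sub_int_mul_two_pi] at this
  linarith

namespace PerfectTorusNetwork

variable {V E : Type*} [Fintype V] [Fintype E] (N : PerfectTorusNetwork V E)

/-- The number of full turns attributed to a position on an edge; the corner contributions `ks`, `ke`
are attributed to the ends of the edge. -/
noncomputable def turns (ks ke : E → ℤ) (e : E) (t : ℝ) : ℤ :=
  if t = 0 then -ks e else if t = 1 then ke e else round (N.angle e t / (2 * Real.pi))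

/-- The contribution of a piece to the rotation number. -/
noncomputable def pieceTurns (ks ke : E → ℤ) (a : N.Piece) : ℤ :=
  N.turns ks ke (N.pieceEdge a) (N.endTime a) - N.turns ks ke (N.pieceEdge a) (N.startTime a)

theorem turns_rim (ks ke : E → ℤ) (p : N.RimPoint) :
    N.turns ks ke p.1 p.2.1 = round (N.angle p.1 p.2.1 / (2 * Real.pi)) := by
  have h := N.mem_Ioo_of_mem_rimTimes p.2.2
  rw [turns, if_neg h.1.ne', if_neg h.2.ne]

/-- Consecutive pieces of a path on the cylinder. -/
def Follows (a b : N.Piece) : Prop := ∃ v : V, N.pieceEnd a = Sum.inl v ∧ N.pieceStart b = Sum.inl v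

variable {N} in
theorem Follows.exists_edge {a b : N.Piece} (h : N.Follows a b) :
    ∃ f, b = Sum.inl f ∧ N.endTime a = 1 ∧ N.tgt (N.pieceEdge a) = N.src f := by
  obtain ⟨v, h1, h2⟩ := h
  obtain ⟨h3, h4⟩ := N.pieceEnd_eq_inl h1
  rcases b with f | p
  · exact ⟨f, rfl, h3, h4.trans (Sum.inl.inj h2).symm⟩
  · exact absurd h2 Sum.inr_ne_inl

/-- Differences of directions telescope to those at the two ends. What is left are the full turns at
the corners, and `turns` is normalized at the ends of edges so that the `pieceTurns` add up to them,
apart from the two end terms. -/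
theorem turning_eq {ks ke : E → ℤ}
    (hk : ∀ e f, N.tgt e = N.src f → angleBranch (N.angle e 1) (N.angle f 0) = ks f + ke e)
    (P : List N.Piece) (a : N.Piece) (h : (a :: P).IsChain N.Follows) {b : N.Piece}
    (hb : (a :: P).getLast? = some b) :
    N.turning (a :: P) = N.angle (N.pieceEdge b) (N.endTime b) -
      N.angle (N.pieceEdge a) (N.startTime a) +
      (((((a :: P).map (N.pieceTurns ks ke)).sum - N.turns ks ke (N.pieceEdge b) (N.endTime b) +
        N.turns ks ke (N.pieceEdge a) (N.startTime a) : ℤ)) : ℝ) * (2 * Real.pi) := by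
  induction P generalizing a with
  | nil =>
    obtain rfl : a = b := by simpa using hb
    simp [turning, pieceTurns]
  | cons c P ih =>
    rw [List.isChain_cons_cons] at h
    have hb' : (c :: P).getLast? = some b := by rwa [List.getLast?_cons_cons] at hb
    have ih := ih c h.2 hb'
    obtain ⟨f, rfl, h1, h2⟩ := h.1.exists_edge
    have hc0 : N.turns ks ke (N.pieceEdge (Sum.inl f)) (N.startTime (Sum.inl f)) = -ks f := if_pos rfl
    have ha1 : N.turns ks ke (N.pieceEdge a) 1 = ke (N.pieceEdge a) := by
      rw [turns, if_neg one_ne_zero, if_pos rfl]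
    have hbr := hk _ _ h2
    rw [turning, ih, exteriorAngle_eq, hc0, h1]
    have e1 : angleBranch (N.angle (N.pieceEdge a) 1)
        (N.angle (N.pieceEdge (Sum.inl f : N.Piece)) (N.startTime (Sum.inl f))) =
        ks f + ke (N.pieceEdge a) := hbr
    rw [e1]
    have e2 : N.pieceTurns ks ke a =
        ke (N.pieceEdge a) - N.turns ks ke (N.pieceEdge a) (N.startTime a) := by
      rw [pieceTurns, h1, ha1]
    rw [List.map_cons (a := a), List.sum_cons, e2]
    push_cast
    ring

/-- Lifts of consecutive pieces match up to integers. The accumulated integer `m` enters both the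
rise of the path and, since floors commute with integer shifts, its cut index. -/
theorem height_path (P : List N.Piece) (a : N.Piece) (h : (a :: P).IsChain N.Follows) {b : N.Piece}
    (hb : (a :: P).getLast? = some b) :
    ∃ m : ℤ, N.height (N.pieceEdge a) (N.startTime a) + N.pathRise (a :: P) =
      N.height (N.pieceEdge b) (N.endTime b) + m ∧
      N.pathCutIndex (a :: P) = ⌊N.height (N.pieceEdge b) (N.endTime b)⌋ + m -
        ⌊N.height (N.pieceEdge a) (N.startTime a)⌋ := by
  induction P generalizing a with
  | nil =>
    obtain rfl : a = b := by simpa using hb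
    refine ⟨0, ?_, ?_⟩
    · simp [pathRise, height]
    · simp [pathCutIndex, pieceCutIndex_eq]
  | cons c P ih =>
    rw [List.isChain_cons_cons] at h
    have hb' : (c :: P).getLast? = some b := by rwa [List.getLast?_cons_cons] at hb
    obtain ⟨m, h3, h4⟩ := ih c h.2 hb'
    obtain ⟨f, rfl, h1, h2⟩ := h.1.exists_edge
    obtain ⟨k, l, hkl⟩ := N.latticeEq_corner h2
    have him := congrArg Complex.im hkl
    simp only [Complex.sub_im, Complex.add_im, Complex.intCast_im, Complex.mul_im, Complex.I_im,
      Complex.intCast_re, Complex.I_re, mul_one, mul_zero, add_zero, zero_add] at him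
    have hh : N.height (N.pieceEdge a) 1 =
        N.height (N.pieceEdge (Sum.inl f : N.Piece)) (N.startTime (Sum.inl f)) + l := by
      change (N.curve (N.pieceEdge a) 1).im = (N.curve f 0).im + l
      linarith
    refine ⟨m + l, ?_, ?_⟩
    · have : N.pathRise (a :: Sum.inl f :: P) = (N.height (N.pieceEdge a) (N.endTime a) -
        N.height (N.pieceEdge a) (N.startTime a)) + N.pathRise (Sum.inl f :: P) := by
        simp [pathRise, height]
      rw [this, h1, hh]
      push_cast
      linarith
    · have : N.pathCutIndex (a :: Sum.inl f :: P) = N.pieceCutIndex a +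
          N.pathCutIndex (Sum.inl f :: P) := by
        simp [pathCutIndex]
      rw [this, h4, pieceCutIndex_eq, h1, hh, Int.floor_add_intCast]
      ring

theorem isPath_iff {p q : N.RimPoint} {P : List N.Piece} : N.IsPath p q P ↔
    ∃ P' b, P = Sum.inr p :: P' ∧ P.getLast? = some b ∧ N.pieceEnd b = Sum.inr q ∧
      P.IsChain N.Follows := by
  unfold IsPath
  constructor
  · rintro ⟨h1, h2, h3⟩
    rcases P with _ | ⟨a, P'⟩
    · simp at h1
    · have ha : a = Sum.inr p := N.pieceStart_eq_inr.1 (by simpa using h1)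
      obtain ⟨b, hb, hb'⟩ := Option.map_eq_some_iff.1 h2
      exact ⟨P', b, by rw [ha], hb, hb', h3⟩
  · rintro ⟨P', b, rfl, hb, hb', h3⟩
    exact ⟨rfl, by rw [hb, Option.map_some, hb'], h3⟩

variable {N} in
-- Directions at `p` and `q` lie within a right angle of a multiple of `2π`, so the exterior angles
-- of the loop at these corners are explicit. They cancel the end terms of `turning_eq`, and the two
-- right angles at the ends of the cut cancel each other.
theorem IsIdealRim.rotationNumber_eq (hrim : N.IsIdealRim) {ks ke : E → ℤ}
    (hk : ∀ e f, N.tgt e = N.src f → angleBranch (N.angle e 1) (N.angle f 0) = ks f + ke e)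
    {p q : N.RimPoint} {P : List N.Piece} (hP : N.IsPath p q P) :
    N.rotationNumber p q P - 1 = (P.map (N.pieceTurns ks ke)).sum + N.pathCutIndex P := by
  obtain ⟨P', b, rfl, hb, hbq, hch⟩ := N.isPath_iff.1 hP
  obtain ⟨b1, b2, -⟩ := N.pieceEnd_eq_inr hbq
  have hpi := Real.pi_pos
  have hs1 : N.pieceEdge (Sum.inr p) = p.1 := rfl
  have hs2 : N.startTime (Sum.inr p) = p.2.1 := rfl
  have ht := N.turning_eq hk P' (Sum.inr p) hch hb
  rw [b1, b2, hs1, hs2, turns_rim, turns_rim] at ht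
  have hp := abs_lt.1 (abs_sub_round_mul_two_pi (hrim p.1 p.2.1 p.2.2))
  have hq := abs_lt.1 (abs_sub_round_mul_two_pi (hrim q.1 q.2.1 q.2.2))
  set rp := round (N.angle p.1 p.2.1 / (2 * Real.pi))
  set rq := round (N.angle q.1 q.2.1 / (2 * Real.pi))
  have e1 : exteriorAngle (N.angle q.1 q.2.1) (Real.pi / 2) =
      Real.pi / 2 - (N.angle q.1 q.2.1 - rq * (2 * Real.pi)) :=
    exteriorAngle_eq_of_mem (n := -rq) ⟨by linarith, by linarith⟩ (by push_cast; ring)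
  have e2 : exteriorAngle (Real.pi / 2) (N.angle p.1 p.2.1) =
      (N.angle p.1 p.2.1 - rp * (2 * Real.pi)) - Real.pi / 2 :=
    exteriorAngle_eq_of_mem (n := rp) ⟨by linarith, by linarith⟩ (by ring)
  have e3 : exteriorAngle (Real.pi / 2) Real.pi = Real.pi / 2 :=
    exteriorAngle_eq_of_mem (n := 0) ⟨by linarith, by linarith⟩ (by push_cast; ring)
  have e4 : exteriorAngle Real.pi (Real.pi / 2) = -(Real.pi / 2) :=
    exteriorAngle_eq_of_mem (n := 0) ⟨by linarith, by linarith⟩ (by push_cast; ring)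
  have hloop : N.loopTurning p q (Sum.inr p :: P') / (2 * Real.pi) =
      ((((Sum.inr p :: P').map (N.pieceTurns ks ke)).sum : ℤ) : ℝ) := by
    rw [div_eq_iff (by positivity), loopTurning, ht, e1, e2, e3, e4]
    push_cast
    ring
  obtain ⟨m, h3, h4⟩ := N.height_path P' (Sum.inr p) hch hb
  rw [b1, b2, hs1, hs2] at h3 h4
  -- The sink is not at integer height, so the ceiling exceeds the floor by one; this is the one
  -- subtracted in `r - 1`.
  have hceil : ⌈N.height p.1 p.2.1 + N.pathRise (Sum.inr p :: P')⌉ =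
      ⌊N.height q.1 q.2.1⌋ + m + 1 := by
    rw [h3, Int.ceil_add_intCast]
    have : ⌈N.height q.1 q.2.1⌉ = ⌊N.height q.1 q.2.1⌋ + 1 := by
      rw [Int.ceil_eq_iff]
      push_cast
      rw [add_sub_cancel_right]
      exact ⟨lt_of_le_of_ne (Int.floor_le _) (N.height_rim_ne q.2.2 _).symm,
        (Int.lt_floor_add_one _).le⟩
    rw [this]
    ring
  have hwind : N.loopWinding p (Sum.inr p :: P') = N.pathCutIndex (Sum.inr p :: P') + 1 := by
    rw [h4]
    have : N.loopWinding p (Sum.inr p :: P') =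
      ⌈N.height p.1 p.2.1 + N.pathRise (Sum.inr p :: P')⌉ - ⌊N.height p.1 p.2.1⌋ := rfl
    rw [this, hceil]
    ring
  rw [rotationNumber, hloop, round_intCast, hwind]
  ring

section Weights

variable {K : Type*} [Field K]

/-- The sign and power of `λ` contributed by a piece. -/
noncomputable def pieceFactor (lam : K) (ks ke : E → ℤ) (a : N.Piece) : K :=
  (((N.pieceTurns ks ke a + N.pieceCutIndex a).negOnePow : ℤ) : K) * lam ^ N.pieceCutIndex a

variable {N} in
theorem IsIdealRim.pathSign_mul (hrim : N.IsIdealRim) {ks ke : E → ℤ}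
    (hk : ∀ e f, N.tgt e = N.src f → angleBranch (N.angle e 1) (N.angle f 0) = ks f + ke e)
    {lam : K} (hlam : lam ≠ 0) {p q : N.RimPoint} {P : List N.Piece} (hP : N.IsPath p q P) :
    (N.pathSign p q P : K) * lam ^ N.pathCutIndex P = (P.map (N.pieceFactor lam ks ke)).prod := by
  rw [pathSign, hrim.rotationNumber_eq hk hP, neg_one_pow_natAbs, pathCutIndex]
  clear hP
  push_cast
  induction P with
  | nil => simp
  | cons a P ih =>
    simp only [List.map_cons, List.sum_cons, List.prod_cons]
    rw [← ih, pieceFactor, add_add_add_comm, Int.negOnePow_add, zpow_add₀ hlam]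
    push_cast
    ring

/-- Turns and floors telescope over the pieces of an edge. The rounded angles at the rim cancel;
only the corner contributions and the cut index of the whole edge remain. -/
theorem edgeWeight_pieceFactor {lam : K} (hlam : lam ≠ 0) (ks ke : E → ℤ) (e : E) :
    N.edgeWeight (N.pieceFactor lam ks ke) e =
      (((ks e + ke e).negOnePow : ℤ) : K) * (((N.cutIndex e).negOnePow : ℤ) * lam ^ N.cutIndex e) := by
  have h1 := N.sum_pieces e (N.turns ks ke e)
  have h2 := N.sum_pieces e (fun t => ⌊N.height e t⌋)
  have e0 : N.turns ks ke e 1 - N.turns ks ke e 0 = ks e + ke e := by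
    rw [turns, if_neg one_ne_zero, if_pos rfl, turns, if_pos rfl]
    ring
  rw [e0] at h1
  rw [← N.cutIndex_eq] at h2
  have h1' : N.pieceTurns ks ke (Sum.inl e) + ∑ t : {t : ℝ // t ∈ N.rimTimes e},
    N.pieceTurns ks ke (Sum.inr ⟨e, t⟩) = ks e + ke e := h1
  have h2' : N.pieceCutIndex (Sum.inl e) + ∑ t : {t : ℝ // t ∈ N.rimTimes e},
      N.pieceCutIndex (Sum.inr ⟨e, t⟩) = N.cutIndex e := by
    simp only [pieceCutIndex_eq]
    exact h2
  simp only [edgeWeight, pieceFactor, Finset.prod_mul_distrib]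
  rw [prod_zpow_eq_zpow_sum lam _ _ (Or.inl hlam), ← Int.cast_prod, ← Units.coe_prod,
    prod_negOnePow, Finset.sum_add_distrib, mul_mul_mul_comm, ← zpow_add₀ hlam, h2', ← Int.cast_mul,
    ← Units.val_mul, ← Int.negOnePow_add, add_add_add_comm, h1', h2', Int.negOnePow_add]
  push_cast
  ring

end Weights

end PerfectTorusNetwork

/-! ### Base change and the determinant identity over a commutative algebra -/

namespace PerfectTorusNetwork

variable {V E : Type*} [Fintype V] [Fintype E] (N : PerfectTorusNetwork V E)

section BaseChange

variable {A B : Type*} [CommRing A] [CommRing B]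

theorem map_edgeWeight (f : A →+* B) (u : N.Piece → A) (e : E) :
    f (N.edgeWeight u e) = N.edgeWeight (fun a => f (u a)) e := by
  simp [edgeWeight, map_prod]

theorem edgeWeight_mul (u v : N.Piece → A) (e : E) :
    N.edgeWeight (fun a => u a * v a) e = N.edgeWeight u e * N.edgeWeight v e := by
  simp only [edgeWeight, Finset.prod_mul_distrib]
  ring

theorem map_partitionFunction {K : Type*} [Field K] [Algebra K A] [Algebra K B] (f : A →+* B)
    (hf : ∀ k : K, f (algebraMap K A k) = algebraMap K B k) (lam : K) (z : A) (w : E → A) :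
    f (N.partitionFunction lam z w) = N.partitionFunction lam (f z) (fun e => f (w e)) := by
  simp only [partitionFunction, cycleWeight, map_sum, map_mul, map_prod, map_pow, map_neg, map_one,
    hf]

theorem map_startVertex (f : A →+* B) : (N.startVertex A).map f = N.startVertex B := by
  ext a v
  simp only [startVertex, Matrix.map_apply, Matrix.of_apply, apply_ite f, map_one, map_zero]

theorem map_endVertex (f : A →+* B) : (N.endVertex A).map f = N.endVertex B := by
  ext a v
  simp only [endVertex, Matrix.map_apply, Matrix.of_apply, apply_ite f, map_one, map_zero]

theorem map_endRim (f : A →+* B) : (N.endRim A).map f = N.endRim B := by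
  ext a v
  simp only [endRim, Matrix.map_apply, Matrix.of_apply, apply_ite f, map_one, map_zero]

open Classical in
/-- The matrix whose inverse sums over the walks on the cylinder. -/
noncomputable def walkMatrix (x : N.Piece → A) : Matrix N.Piece N.Piece A :=
  1 - Matrix.diagonal x * (N.endVertex A * N.startVertex A)

open Classical in
/-- The final steps of the paths on the cylinder. -/
noncomputable def exitMatrix (x : N.Piece → A) : Matrix N.Piece N.RimPoint A :=
  Matrix.diagonal x * N.endRim A

theorem map_walkMatrix (f : A →+* B) (x : N.Piece → A) :
    (N.walkMatrix x).map f = N.walkMatrix (fun a => f (x a)) := by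
  classical
  rw [walkMatrix, walkMatrix, Matrix.map_sub f (map_sub f), Matrix.map_mul, Matrix.map_mul,
    map_startVertex, map_endVertex, Matrix.map_one _ (map_zero f) (map_one f),
    Matrix.diagonal_map (map_zero f)]

theorem map_exitMatrix (f : A →+* B) (x : N.Piece → A) :
    (N.exitMatrix x).map f = N.exitMatrix (fun a => f (x a)) := by
  classical
  rw [exitMatrix, exitMatrix, Matrix.map_mul, map_endRim, Matrix.diagonal_map (map_zero f)]

theorem startRim_mul_map (f : A →+* B) (W : Matrix N.Piece N.RimPoint A) :
    N.startRim B * W.map f = (N.startRim A * W).map f := by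
  rw [startRim_mul, startRim_mul]
  rfl

end BaseChange

section Determinant

variable {K : Type*} [Field K] {A : Type*} [CommRing A] [Algebra K A]

variable {N} in
-- The piece factors reproduce the edge factors of the partition function up to `(-1)^(ks + ke)`,
-- and these signs cancel around every non-contractible cycle.
theorem det_transfer_pieceFactor (hrim : N.IsIdealRim) (hnc : N.NoContractibleCycles) {ks ke : E → ℤ}
    (hk : ∀ e f, N.tgt e = N.src f → angleBranch (N.angle e 1) (N.angle f 0) = ks f + ke e)
    {lam : K} (hlam : lam ≠ 0) (z : A) (u : N.Piece → A) [DecidableEq V] :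
    (1 - N.transfer fun e => (-z) ^ (N.rimTimes e).card *
      N.edgeWeight (fun a => algebraMap K A (N.pieceFactor lam ks ke a) * u a) e).det =
      N.partitionFunction lam z (N.edgeWeight u) := by
  have h1 : (fun e => (-z) ^ (N.rimTimes e).card *
      N.edgeWeight (fun a => algebraMap K A (N.pieceFactor lam ks ke a) * u a) e) =
      fun e => (((ks e + ke e).negOnePow : ℤ) : A) * N.edgeFactor lam z (N.edgeWeight u) e := by
    ext e
    rw [edgeWeight_mul, ← map_edgeWeight, edgeWeight_pieceFactor N hlam, edgeFactor, map_mul,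
      map_intCast]
    ring
  rw [h1, det_transfer_twist fun S hS => hnc.sum_eq_zero hk hS,
    hrim.partitionFunction_eq_det lam (Or.inl hlam)]
  congr!

variable {N} in
theorem det_walkMatrix (hrim : N.IsIdealRim) (hnc : N.NoContractibleCycles) {ks ke : E → ℤ}
    (hk : ∀ e f, N.tgt e = N.src f → angleBranch (N.angle e 1) (N.angle f 0) = ks f + ke e)
    {lam : K} (hlam : lam ≠ 0) (u : N.Piece → A) [DecidableEq N.Piece] :
    (N.walkMatrix fun a => algebraMap K A (N.pieceFactor lam ks ke a) * u a).det =
      N.partitionFunction lam (0 : A) (N.edgeWeight u) := by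
  classical
  rw [← det_transfer_pieceFactor hrim hnc hk hlam 0 u, neg_zero, ← det_one_sub_piece, zero_smul,
    add_zero, walkMatrix]
  congr!

variable {N} in
-- Only a solution `W` of the linear system is required, not an inverse of the walk matrix. Power
-- series of paths and Cramer's rule both supply one.
theorem det_one_add_smul_walks (hrim : N.IsIdealRim) (hnc : N.NoContractibleCycles)
    {ks ke : E → ℤ}
    (hk : ∀ e f, N.tgt e = N.src f → angleBranch (N.angle e 1) (N.angle f 0) = ks f + ke e)
    {lam : K} (hlam : lam ≠ 0) (z : A) (u : N.Piece → A) (W : Matrix N.Piece N.RimPoint A)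
    (hW : N.walkMatrix (fun a => algebraMap K A (N.pieceFactor lam ks ke a) * u a) * W =
      N.exitMatrix fun a => algebraMap K A (N.pieceFactor lam ks ke a) * u a) :
    (1 + z • (N.startRim A * W)).det * N.partitionFunction lam (0 : A) (N.edgeWeight u) =
      N.partitionFunction lam z (N.edgeWeight u) := by
  classical
  rw [← det_transfer_pieceFactor hrim hnc hk hlam z u,
    ← det_transfer_pieceFactor hrim hnc hk hlam 0 u, neg_zero, ← N.det_one_add_smul_paths z _ W]
  rw [walkMatrix, exitMatrix] at hW
  convert hW

end Determinant

/-! ### Power series of paths -/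

section Series

variable {K : Type*} [Field K]

open Classical in
/-- The sums over the paths from a piece to a sink. -/
noncomputable def pathSeries (c : N.Piece → K) :
    Matrix N.Piece N.RimPoint (MvPowerSeries N.Piece K) :=
  Matrix.of fun a q => fun α =>
    ∑ P ∈ (Finsupp.toMultiset α).lists.toFinset.filter (fun P => P.head? = some a ∧
      P.getLast?.map N.pieceEnd = some (Sum.inr q) ∧ P.IsChain N.Follows), (P.map c).prod

theorem mem_lists_toMultiset {ι : Type*} [DecidableEq ι] {α : ι →₀ ℕ} {P : List ι} :
    P ∈ (Finsupp.toMultiset α).lists.toFinset ↔ (P : Multiset ι) = Finsupp.toMultiset α := by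
  rw [Multiset.mem_toFinset, Multiset.mem_lists_iff]
  exact eq_comm

open Classical in
-- Decomposition by the first piece: after `a` a path either stops at the sink or goes on with a
-- piece that follows `a`. On coefficients this removes one occurrence of `a` from the multiset of
-- pieces used.
theorem pathSeries_apply (c : N.Piece → K) (a : N.Piece) (q : N.RimPoint) :
    N.pathSeries c a q = MvPowerSeries.monomial (Finsupp.single a 1) (c a) *
      ((if N.pieceEnd a = Sum.inr q then 1 else 0) +
        ∑ b, if N.Follows a b then N.pathSeries c b q else 0) := by
  ext α
  rw [MvPowerSeries.coeff_monomial_mul]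
  change (∑ P ∈ _, _ : K) = _
  rw [Finset.sum_filter]
  by_cases hα : Finsupp.single a 1 ≤ α
  · rw [if_pos hα]
    obtain ⟨β, rfl⟩ := exists_add_of_le hα
    rw [add_tsub_cancel_left, map_add (MvPowerSeries.coeff β), map_sum, mul_add, Finset.mul_sum]
    have hsub : (Finsupp.toMultiset β).lists.toFinset.image (List.cons a) ⊆
        (Finsupp.toMultiset (Finsupp.single a 1 + β)).lists.toFinset := by
      intro P hP
      obtain ⟨P', hP', rfl⟩ := Finset.mem_image.1 hP
      rw [mem_lists_toMultiset] at hP' ⊢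
      rw [← Multiset.cons_coe, hP', map_add, Finsupp.toMultiset_single, one_smul,
        Multiset.singleton_add]
    rw [← Finset.sum_subset hsub, Finset.sum_image fun P _ P' _ h => (List.cons.inj h).2]
    · have h1 : MvPowerSeries.coeff β (if N.pieceEnd a = Sum.inr q then (1 : MvPowerSeries N.Piece K)
          else 0) = ∑ P ∈ (Finsupp.toMultiset β).lists.toFinset,
            if P = [] then (if N.pieceEnd a = Sum.inr q then 1 else 0) else 0 := by
        rw [Finset.sum_ite_eq']
        by_cases h : N.pieceEnd a = Sum.inr q
        · rw [if_pos h, if_pos h, MvPowerSeries.coeff_one]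
          congr 1
          rw [mem_lists_toMultiset, eq_iff_iff]
          constructor
          · rintro rfl
            simp
          · intro hβ
            rw [Finsupp.toMultiset_eq_iff.1 hβ.symm]; exact map_zero _
        · simp [h]
      have h2 : ∀ b, MvPowerSeries.coeff β (if N.Follows a b then N.pathSeries c b q else 0) =
          ∑ P ∈ (Finsupp.toMultiset β).lists.toFinset, if N.Follows a b ∧ (P.head? = some b ∧
            P.getLast?.map N.pieceEnd = some (Sum.inr q) ∧ P.IsChain N.Follows) then
              (P.map c).prod else 0 := by
        intro b
        by_cases h : N.Follows a b
        · simp only [h, true_and, if_true]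
          rw [← Finset.sum_filter]
          rfl
        · simp [h]
      simp only [h1, h2, Finset.mul_sum]
      rw [Finset.sum_comm, ← Finset.sum_add_distrib]
      refine Finset.sum_congr rfl fun P _ => ?_
      rcases P with _ | ⟨b, P⟩
      · simp
      · rw [if_neg (List.cons_ne_nil _ _), mul_zero, zero_add, Finset.sum_eq_single b]
        · simp only [List.head?_cons, true_and, List.getLast?_cons_cons, List.isChain_cons_cons,
            List.map_cons, List.prod_cons, mul_ite, mul_zero]
          congr 1
          rw [eq_iff_iff]
          tauto
        · intro b' _ hb'
          simp [hb'.symm]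
        · simp
    · intro P hP hP'
      rw [if_neg]
      rintro ⟨h1, -⟩
      rcases P with _ | ⟨a', P⟩
      · simp at h1
      · obtain rfl : a' = a := by simpa using h1
        apply hP'
        refine Finset.mem_image_of_mem _ ?_
        rw [mem_lists_toMultiset] at hP ⊢
        rw [← Multiset.cons_coe, map_add, Finsupp.toMultiset_single, one_smul,
          Multiset.singleton_add] at hP
        exact (Multiset.cons_inj_right _).1 hP
  · rw [if_neg hα]
    apply Finset.sum_eq_zero
    intro P hP
    rw [if_neg]
    rintro ⟨h1, -⟩
    apply hα
    rw [Finsupp.single_le_iff]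
    rw [mem_lists_toMultiset] at hP
    have : a ∈ Finsupp.toMultiset α := by
      rw [← hP]
      exact List.mem_of_mem_head? h1
    rw [Finsupp.mem_toMultiset, Finsupp.mem_support_iff] at this
    omega

theorem walkMatrix_mul_pathSeries (c : N.Piece → K) :
    N.walkMatrix (fun a => algebraMap K (MvPowerSeries N.Piece K) (c a) * MvPowerSeries.X a) *
      N.pathSeries c =
    N.exitMatrix fun a => algebraMap K (MvPowerSeries N.Piece K) (c a) * MvPowerSeries.X a := by
  classical
  have hx : ∀ a : N.Piece, algebraMap K (MvPowerSeries N.Piece K) (c a) * MvPowerSeries.X a =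
      MvPowerSeries.monomial (Finsupp.single a 1) (c a) := by
    intro a
    rw [← Algebra.smul_def, MvPowerSeries.X, ← map_smul, smul_eq_mul, mul_one]
  have hadj : ∀ a b, (N.endVertex (MvPowerSeries N.Piece K) * N.startVertex (MvPowerSeries N.Piece K)) a b =
      if N.Follows a b then 1 else 0 := by
    intro a b
    rw [Matrix.mul_apply]
    simp only [endVertex, startVertex, Matrix.of_apply, ite_mul, one_mul, zero_mul]
    rcases h : N.pieceEnd a with v | q
    · simp [Follows, h]
    · simp [Follows, h]
  simp only [hx]
  rw [walkMatrix, exitMatrix, Matrix.sub_mul, Matrix.one_mul, sub_eq_iff_eq_add]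
  ext1 a q
  rw [pathSeries_apply, Matrix.add_apply, Matrix.mul_assoc, Matrix.diagonal_mul,
    Matrix.diagonal_mul, mul_add]
  congr 2
  rw [Matrix.mul_apply]
  refine Finset.sum_congr rfl fun b _ => ?_
  rw [hadj, ite_mul, one_mul, zero_mul]

variable {N} in
theorem IsIdealRim.boundaryMeasurement_eq (hrim : N.IsIdealRim) {ks ke : E → ℤ}
    (hk : ∀ e f, N.tgt e = N.src f → angleBranch (N.angle e 1) (N.angle f 0) = ks f + ke e)
    {lam : K} (hlam : lam ≠ 0) :
    N.boundaryMeasurement lam =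
      N.startRim (MvPowerSeries N.Piece K) * N.pathSeries (N.pieceFactor lam ks ke) := by
  classical
  rw [startRim_mul]
  ext1 p q
  funext α
  simp only [boundaryMeasurement, Matrix.of_apply, pathSeries]
  have hiff : ∀ P, N.IsPath p q P ↔ (P.head? = some (Sum.inr p) ∧
      P.getLast?.map N.pieceEnd = some (Sum.inr q) ∧ P.IsChain N.Follows) := by
    intro P
    rw [IsPath]
    refine and_congr ?_ Iff.rfl
    rcases P with _ | ⟨a, P⟩
    · simp
    · simp [pieceStart_eq_inr]
  exact Finset.sum_congr (Finset.filter_congr fun P _ => hiff P) fun P hP =>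
    hrim.pathSign_mul hk hlam ((hiff P).2 (Finset.mem_filter.1 hP).2)

end Series

end PerfectTorusNetwork

/-! ### The Proposition, over power series and over the field -/

namespace PerfectTorusNetwork

variable {V E : Type*} [Fintype V] [Fintype E] {N : PerfectTorusNetwork V E} {K : Type*} [Field K]

/-- When all weights are set to zero the transfer matrix vanishes, so the constant term of the
series is `1`. -/
theorem IsIdealRim.isUnit_partitionFunction (hrim : N.IsIdealRim) {lam : K} (hlam : lam ≠ 0) :
    IsUnit (N.partitionFunction lam (0 : MvPowerSeries N.Piece K)
      (N.edgeWeight MvPowerSeries.X)) := by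
  classical
  rw [MvPowerSeries.isUnit_iff_constantCoeff,
    N.map_partitionFunction MvPowerSeries.constantCoeff (B := K)
      (fun k => by simp [MvPowerSeries.algebraMap_apply]),
    hrim.partitionFunction_eq_det lam (Or.inl hlam)]
  have : N.transfer (N.edgeFactor lam (MvPowerSeries.constantCoeff (0 : MvPowerSeries N.Piece K))
      fun e => MvPowerSeries.constantCoeff (N.edgeWeight
        (MvPowerSeries.X : N.Piece → MvPowerSeries N.Piece K) e)) = 0 := by
    ext v w
    simp [transfer, edgeFactor, edgeWeight]
  rw [this, sub_zero, Matrix.det_one]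
  exact isUnit_one

/-- The determinant identity after adjoining the variable `z`. -/
theorem det_one_add_X_smul_walks {A : Type*} [CommRing A] [Algebra K A]
    (hrim : N.IsIdealRim) (hnc : N.NoContractibleCycles) {ks ke : E → ℤ}
    (hk : ∀ e f, N.tgt e = N.src f → angleBranch (N.angle e 1) (N.angle f 0) = ks f + ke e)
    {lam : K} (hlam : lam ≠ 0) (u : N.Piece → A) (W : Matrix N.Piece N.RimPoint A)
    (hW : N.walkMatrix (fun a => algebraMap K A (N.pieceFactor lam ks ke a) * u a) * W =
      N.exitMatrix fun a => algebraMap K A (N.pieceFactor lam ks ke a) * u a) :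
    (1 + (Polynomial.X : Polynomial A) • (N.startRim A * W).map Polynomial.C).det *
      Polynomial.C (N.partitionFunction lam (0 : A) (N.edgeWeight u)) =
      N.partitionFunction lam (Polynomial.X : Polynomial A)
        (fun e => Polynomial.C (N.edgeWeight u e)) := by
  have hC : ∀ k : K, Polynomial.C (algebraMap K A k) = algebraMap K (Polynomial A) k := fun k => rfl
  have hW' : N.walkMatrix (fun a => algebraMap K (Polynomial A) (N.pieceFactor lam ks ke a) *
        Polynomial.C (u a)) * W.map Polynomial.C =
      N.exitMatrix fun a => algebraMap K (Polynomial A) (N.pieceFactor lam ks ke a) *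
        Polynomial.C (u a) := by
    have := congrArg (fun m => m.map (Polynomial.C : A →+* Polynomial A)) hW
    simpa only [Matrix.map_mul, map_walkMatrix, map_exitMatrix, map_mul, hC] using this
  have h := det_one_add_smul_walks hrim hnc hk hlam (Polynomial.X : Polynomial A)
    (fun a => Polynomial.C (u a)) (W.map Polynomial.C) hW'
  rw [startRim_mul_map] at h
  have hw : N.edgeWeight (fun a => Polynomial.C (u a)) = fun e => Polynomial.C (N.edgeWeight u e) :=
    funext fun e => (N.map_edgeWeight Polynomial.C u e).symm
  rw [hw] at h
  rw [← h, N.map_partitionFunction (Polynomial.C : A →+* Polynomial A) hC, map_zero]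

theorem exists_corner_turns (N : PerfectTorusNetwork V E) : ∃ ks ke : E → ℤ,
    ∀ e f, N.tgt e = N.src f → angleBranch (N.angle e 1) (N.angle f 0) = ks f + ke e :=
  N.exists_corner_split fun e f => angleBranch (N.angle e 1) (N.angle f 0)

theorem det_one_add_boundaryMeasurement (hrim : N.IsIdealRim) (hnc : N.NoContractibleCycles)
    {lam : K} (hlam : lam ≠ 0) :
    (1 + (Polynomial.X : Polynomial (MvPowerSeries N.Piece K)) •
        (N.boundaryMeasurement lam).map Polynomial.C).det *
      Polynomial.C (N.partitionFunction lam (0 : MvPowerSeries N.Piece K)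
        (N.edgeWeight MvPowerSeries.X)) =
      N.partitionFunction lam (Polynomial.X : Polynomial (MvPowerSeries N.Piece K))
        (fun e => Polynomial.C (N.edgeWeight MvPowerSeries.X e)) := by
  obtain ⟨ks, ke, hk⟩ := N.exists_corner_turns
  rw [hrim.boundaryMeasurement_eq hk hlam]
  exact det_one_add_X_smul_walks hrim hnc hk hlam _ _ (N.walkMatrix_mul_pathSeries _)

/-- Cramer's rule over the polynomial ring writes all entries with one denominator, the determinant
of the walk matrix. Its value at `u` is the partition function at `z = 0`, which is nonzero by
assumption. -/
theorem exists_boundaryMeasurementAt (hrim : N.IsIdealRim) (hnc : N.NoContractibleCycles)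
    {lam : K} (hlam : lam ≠ 0) (u : N.Piece → K)
    (hu : N.partitionFunction lam (0 : K) (N.edgeWeight u) ≠ 0) :
    ∃ M : Matrix N.RimPoint N.RimPoint K,
      (∀ M', N.IsBoundaryMeasurementAt lam u M' ↔ M' = M) ∧
      (1 + (Polynomial.X : Polynomial K) • M.map Polynomial.C).det =
        Polynomial.C (N.partitionFunction lam (0 : K) (N.edgeWeight u))⁻¹ *
          N.partitionFunction lam (Polynomial.X : Polynomial K)
            (fun e => Polynomial.C (N.edgeWeight u e)) := by
  classical
  obtain ⟨ks, ke, hk⟩ := N.exists_corner_turns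
  set R := MvPolynomial N.Piece K
  set c := N.pieceFactor lam ks ke
  set B : Matrix N.Piece N.Piece R :=
    N.walkMatrix fun a => algebraMap K R (c a) * MvPolynomial.X a with hB
  set Q : Matrix N.Piece N.RimPoint R :=
    N.exitMatrix fun a => algebraMap K R (c a) * MvPolynomial.X a with hQ
  set G : R := B.det with hG
  set W : Matrix N.Piece N.RimPoint R := B.adjugate * Q with hW
  set F : Matrix N.RimPoint N.RimPoint R := N.startRim R * W with hF
  -- the expansion of the entries as rational functions
  have hseries : ∀ p q, (G : MvPowerSeries N.Piece K) * N.boundaryMeasurement lam p q =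
      (F p q : MvPowerSeries N.Piece K) := by
    set φ : R →+* MvPowerSeries N.Piece K := MvPolynomial.coeToMvPowerSeries.ringHom
    have hφ : ∀ a, φ (algebraMap K R (c a) * MvPolynomial.X a) =
        algebraMap K (MvPowerSeries N.Piece K) (c a) * MvPowerSeries.X a := by
      intro a
      rw [map_mul]
      congr 1
      · simp [φ, MvPowerSeries.algebraMap_apply, MvPolynomial.algebraMap_eq, R]
      · simp [φ, R]
    have h1 := N.walkMatrix_mul_pathSeries c
    simp only [← hφ] at h1
    rw [← map_walkMatrix, ← map_exitMatrix, ← hB, ← hQ] at h1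
    have h2 : φ G • N.pathSeries c = W.map φ := by
      rw [hW, Matrix.map_mul, ← h1, ← Matrix.mul_assoc, ← Matrix.map_mul, Matrix.adjugate_mul, ← hG]
      have : (G • (1 : Matrix N.Piece N.Piece R)).map φ = φ G • 1 := by
        ext1 i j
        simp [Matrix.one_apply, apply_ite φ]
      rw [this, Matrix.smul_mul, Matrix.one_mul]
    intro p q
    rw [hrim.boundaryMeasurement_eq hk hlam]
    change φ G * _ = φ (F p q)
    have h3 : (N.startRim R * W).map φ = φ G • (N.startRim _ * N.pathSeries c) := by
      rw [← startRim_mul_map, ← h2, Matrix.mul_smul]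
      rfl
    exact (congrFun (congrFun h3 p) q).symm
  -- the values
  set ev : R →+* K := MvPolynomial.eval u
  have hev : ∀ a, ev (algebraMap K R (c a) * MvPolynomial.X a) = algebraMap K K (c a) * u a := by
    intro a
    simp [ev, MvPolynomial.algebraMap_eq, R]
  have hevB : B.map ev = N.walkMatrix fun a => algebraMap K K (c a) * u a := by
    rw [hB, map_walkMatrix]
    simp only [hev]
  have hevG : ev G = N.partitionFunction lam (0 : K) (N.edgeWeight u) := by
    rw [hG, RingHom.map_det, RingHom.mapMatrix_apply, hevB, det_walkMatrix hrim hnc hk hlam]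
  have hG0 : ev G ≠ 0 := by rwa [hevG]
  set M : Matrix N.RimPoint N.RimPoint K := (ev G)⁻¹ • F.map ev with hM
  refine ⟨M, fun M' => ⟨fun hM' => ?_, ?_⟩, ?_⟩
  · ext p q
    obtain ⟨F', G', h1, h2, h3⟩ := hM' p q
    rw [h3, hM, Matrix.smul_apply, Matrix.map_apply, smul_eq_mul, inv_mul_eq_div,
      div_eq_div_iff h2 hG0]
    -- Two fractions with the same expansion are equal after cross multiplication, because
    -- polynomials embed into power series; hence the value does not depend on the fraction.
    have h4 : (F' * G : R) = F p q * G' := by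
      apply MvPolynomial.coe_injective
      rw [MvPolynomial.coe_mul, MvPolynomial.coe_mul, ← h1, ← hseries p q]
      ring
    change ev F' * ev G = ev (F p q) * ev G'
    rw [← map_mul, h4, map_mul]
  · rintro rfl p q
    exact ⟨F p q, G, hseries p q, hG0, inv_mul_eq_div _ _⟩
  · have hWu : N.walkMatrix (fun a => algebraMap K K (c a) * u a) * ((ev G)⁻¹ • W.map ev) =
        N.exitMatrix fun a => algebraMap K K (c a) * u a := by
      have h1 : (B * W).map ev = ev G • Q.map ev := by
        rw [hW, ← Matrix.mul_assoc, Matrix.mul_adjugate, Matrix.smul_mul, Matrix.one_mul]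
        ext1 i j
        simp [hG]
      rw [Matrix.map_mul, hevB] at h1
      rw [Matrix.mul_smul, h1, smul_smul, inv_mul_cancel₀ hG0, one_smul, hQ, map_exitMatrix]
      simp only [hev]
    have h := det_one_add_X_smul_walks hrim hnc hk hlam u _ hWu
    rw [Matrix.mul_smul, startRim_mul_map] at h
    change (1 + (Polynomial.X : Polynomial K) • M.map Polynomial.C).det * _ = _ at h
    rw [← h, mul_left_comm, ← map_mul, inv_mul_cancel₀ hu, map_one, mul_one]

end PerfectTorusNetwork

/-! ### Crossings and cycles of `N̄_{k,n}` -/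

namespace Nbar

variable {k n : ℕ}

theorem mem_rimTimes {e : Fin n × EdgeKind} {t : ℝ} : t ∈ (torusNetworkNbar k n).rimTimes e ↔
    t ∈ Set.Ioo (0 : ℝ) 1 ∧ ∃ m : ℤ, (curve k e t).re = m :=
  Set.Finite.mem_toFinset _

theorem isIdealRim (k n : ℕ) : (torusNetworkNbar k n).IsIdealRim := by
  intro e t ht
  obtain ⟨h, m, hm⟩ := mem_rimTimes.1 ht
  change 0 < Real.cos (Complex.arg (vec k e))
  rw [Complex.cos_arg (vec_ne k e)]
  exact div_pos (re_pos_of_re k e t h m hm) (norm_pos_iff.mpr (vec_ne k e))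

/-- Only left edges run backwards, and each is followed by an upper edge that undoes its horizontal
displacement. Every cycle contains some further edge, so it advances strictly to the right. -/
theorem noContractibleCycles (hk : 2 ≤ k) (n : ℕ) : (torusNetworkNbar k n).NoContractibleCycles := by
  classical
  intro S hS hsum
  have hk' : (1 : ℝ) ≤ ((k - 1 : ℕ) : ℝ) := by exact_mod_cast (by omega : 1 ≤ k - 1)
  obtain ⟨e₀, he₀⟩ := hS.nonempty
  have hn := n_pos e₀.1
  have hnext : ∀ e ∈ S, ∃ f ∈ S, tgt k e = src f := fun e he => hS.exists_next he
  have hre : ∑ e ∈ S, ex k e.2 = 0 := by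
    have h1 : ∀ e, (torusNetworkNbar k n).curve e 1 - (torusNetworkNbar k n).curve e 0 = vec k e := by
      intro e
      change curve k e 1 - curve k e 0 = vec k e
      simp [curve]
    simp only [h1] at hsum
    have h2 := congrArg Complex.re hsum
    rw [Complex.re_sum, Complex.zero_re] at h2
    simp only [vec, ← Finset.sum_div] at h2
    exact (div_eq_zero_iff.1 h2).resolve_right hn.ne'
  -- The horizontal component, corrected to `0` on left and upper edges and positive on all others.
  -- Its sum over a closed lift is `(#left - #upper) / 4 ≤ 0`.
  set g : Fin n × EdgeKind → ℝ := fun e => ex k e.2 + (if e.2 = .left then 1 / 4 else 0) -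
    (if e.2 = .upper then 1 / 4 else 0) with hg
  have hg0 : ∀ e, 0 ≤ g e := by
    rintro ⟨i, _ | _ | _ | _ | _ | _⟩ <;> (simp [hg, ex]; try norm_num)
  have hleft : ∀ i, (i, EdgeKind.left) ∈ S → (i, EdgeKind.upper) ∈ S := by
    intro i hi
    obtain ⟨⟨j, f⟩, hf, hf'⟩ := hnext _ hi
    cases f <;> simp [tgt, src] at hf'
    rwa [hf']
  have hupper : ∀ i, (i, EdgeKind.upper) ∈ S → ∃ e ∈ S, 0 < g e := by
    intro i hi
    obtain ⟨⟨j, f⟩, hf, hf'⟩ := hnext _ hi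
    refine ⟨_, hf, ?_⟩
    cases f <;> simp [tgt, src] at hf' <;> simp [hg, ex]
    omega
  have hpos : ∃ e ∈ S, 0 < g e := by
    obtain ⟨i, a⟩ := e₀
    cases a
    · exact hupper i (hleft i he₀)
    · exact ⟨_, he₀, by simp [hg, ex]⟩
    · exact hupper i he₀
    · exact ⟨_, he₀, by simp [hg, ex]⟩
    · exact ⟨_, he₀, by simp [hg, ex]⟩
    · exact ⟨_, he₀, by simp only [hg, ex]; simp; omega⟩
  have hcard : (S.filter fun e => e.2 = .left).card ≤ (S.filter fun e => e.2 = .upper).card := by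
    refine Finset.card_le_card_of_injOn (fun e => (e.1, .upper)) ?_ ?_
    · rintro ⟨i, a⟩ he
      obtain ⟨h1, h2⟩ := Finset.mem_filter.1 he
      obtain rfl : a = .left := h2
      exact Finset.mem_coe.2 (Finset.mem_filter.2 ⟨hleft i h1, rfl⟩)
    · rintro ⟨i, a⟩ he ⟨j, b⟩ hf h
      obtain rfl : a = .left := (Finset.mem_filter.1 he).2
      obtain rfl : b = .left := (Finset.mem_filter.1 hf).2
      obtain rfl : i = j := congrArg Prod.fst h
      rfl
  have h1 : 0 < ∑ e ∈ S, g e := Finset.sum_pos' (fun e _ => hg0 e) hpos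
  have h2 : ∑ e ∈ S, g e = 0 + ((S.filter fun e => e.2 = .left).card : ℝ) * (1 / 4) -
      ((S.filter fun e => e.2 = .upper).card : ℝ) * (1 / 4) := by
    simp only [hg, Finset.sum_sub_distrib, Finset.sum_add_distrib, hre, ← Finset.sum_filter,
      Finset.sum_const, nsmul_eq_mul]
  have h3 : ((S.filter fun e => e.2 = .left).card : ℝ) ≤ (S.filter fun e => e.2 = .upper).card := by
    exact_mod_cast hcard
  linarith

theorem cutIndex_eq (e : Fin n × EdgeKind) :
    (torusNetworkNbar k n).cutIndex e = if e.2 = .ww then 1 else 0 := by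
  have hmem : ∀ t, t ∈ (torusNetworkNbar k n).cutTimes e ↔
      t ∈ Set.Ioo (0 : ℝ) 1 ∧ ∃ m : ℤ, (curve k e t).im = m := fun t => Set.Finite.mem_toFinset _
  rw [PerfectTorusNetwork.cutIndex]
  split_ifs with h
  -- A white-white edge climbs from height `7/10` by `1/2` and meets height `1` at `t = 3/5`.
  · have : (torusNetworkNbar k n).cutTimes e = {3 / 5} := by
      ext t
      rw [hmem, Finset.mem_singleton]
      constructor
      · rintro ⟨ht, m, hm⟩
        exact (eq_ww_of_im k e t ht m hm).2
      · rintro rfl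
        refine ⟨by norm_num, 1, ?_⟩
        obtain ⟨i, a⟩ := e
        obtain rfl : a = .ww := h
        rw [curve_im]
        norm_num [src, cy, ey]
    rw [this, Finset.sum_singleton]
    have hs : 0 < Real.sin (Complex.arg (vec k e)) := by
      rw [Complex.sin_arg]
      have : (0 : ℝ) < (vec k e).im := by simp only [vec, h, ey]; norm_num
      exact div_pos this (norm_pos_iff.mpr (vec_ne k e))
    change ((SignType.sign (Real.sin (Complex.arg (vec k e))) : SignType) : ℤ) = 1
    rw [sign_pos hs]
    rfl
  · apply Finset.sum_eq_zero
    intro t ht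
    obtain ⟨ht, m, hm⟩ := (hmem t).1 ht
    exact (h (eq_ww_of_im k e t ht m hm).1).elim

/-- The number of crossings of an edge that advances by less than a full turn. -/
theorem card_rimTimes {i : Fin n} {a : EdgeKind} (hx : 0 < ex k a)
    (hlt : (i.val : ℝ) + cx (src (i, a)).2 + ex k a < 2 * n) :
    ((torusNetworkNbar k n).rimTimes (i, a)).card =
      if (i.val : ℝ) + cx (src (i, a)).2 < n ∧ (n : ℝ) < i.val + cx (src (i, a)).2 + ex k a
        then 1 else 0 := by
  classical
  have hn := n_pos i
  have hc : 0 < cx (src (i, a)).2 := by cases a <;> norm_num [src, cx]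
  have hi : (0 : ℝ) ≤ i.val := Nat.cast_nonneg _
  set s := (i.val : ℝ) + cx (src (i, a)).2 with hs
  -- The lift stays strictly between the levels `0` and `2`, so it can only meet level `1`.
  have hone : ∀ t ∈ Set.Ioo (0 : ℝ) 1, ∀ m : ℤ, (curve k (i, a) t).re = m →
      s + t * ex k a = n := by
    intro t ht m hm
    rw [curve_re, div_eq_iff hn.ne'] at hm
    change s + t * ex k a = m * n at hm
    have h1 : 0 < (m : ℝ) * n := by rw [← hm]; have := mul_pos ht.1 hx; linarith
    have h2 : (m : ℝ) * n < 2 * n := by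
      rw [← hm]
      have := mul_lt_mul_of_pos_right ht.2 hx
      linarith
    have h3 : (0 : ℝ) < m := pos_of_mul_pos_left h1 hn.le
    have h4 : (m : ℝ) < 2 := lt_of_mul_lt_mul_right h2 hn.le
    have h5 : 0 < m := by exact_mod_cast h3
    have h6 : m < 2 := by exact_mod_cast h4
    obtain rfl : m = 1 := by omega
    rw [hm]
    push_cast
    ring
  split_ifs with h
  · rw [Finset.card_eq_one]
    refine ⟨(n - s) / ex k a, ?_⟩
    ext t
    rw [mem_rimTimes, Finset.mem_singleton, eq_div_iff hx.ne']
    constructor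
    · rintro ⟨ht, m, hm⟩
      linarith [hone t ht m hm]
    · intro ht
      refine ⟨⟨?_, ?_⟩, 1, ?_⟩
      · by_contra! hc
        nlinarith
      · by_contra! hc
        nlinarith
      · rw [curve_re, div_eq_iff hn.ne']
        change s + t * ex k a = _
        rw [ht]
        push_cast
        ring
  · rw [Finset.card_eq_zero, Finset.eq_empty_iff_forall_notMem]
    intro t ht
    obtain ⟨ht, m, hm⟩ := mem_rimTimes.1 ht
    have h1 := hone t ht m hm
    refine h ⟨?_, ?_⟩
    · nlinarith [mul_pos ht.1 hx]
    · nlinarith [mul_lt_mul_of_pos_right ht.2 hx]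

theorem card_rimTimes_eq (hk : 2 ≤ k) (hkn : k ≤ n) (i : Fin n) (a : EdgeKind) :
    ((torusNetworkNbar k n).rimTimes (i, a)).card = match a with
      | .bb => if i.val + 1 = n then 1 else 0
      | .ww => if n ≤ i.val + (k - 1) then 1 else 0
      | _ => 0 := by
  have hi : (i.val : ℝ) + 1 ≤ n := by exact_mod_cast i.isLt
  have hi0 : (0 : ℝ) ≤ i.val := Nat.cast_nonneg _
  have hk' : (1 : ℝ) ≤ ((k - 1 : ℕ) : ℝ) := by exact_mod_cast (by omega : 1 ≤ k - 1)
  have hkn' : ((k - 1 : ℕ) : ℝ) + 1 ≤ n := by exact_mod_cast (by omega : k - 1 + 1 ≤ n)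
  cases a
  case left =>
    rw [Finset.card_eq_zero, Finset.eq_empty_iff_forall_notMem]
    intro t ht
    obtain ⟨ht, m, hm⟩ := mem_rimTimes.1 ht
    have := re_pos_of_re k _ t ht m hm
    have hn := n_pos i
    simp only [vec, ex] at this
    rw [lt_div_iff₀ hn] at this
    linarith
  case ww =>
    rw [card_rimTimes (by simp only [ex]; linarith) (by simp only [src, cx, ex]; linarith)]
    simp only [src, cx, ex]
    refine if_congr ?_ rfl rfl
    constructor
    · rintro ⟨-, h⟩
      have : (n : ℝ) < ((i.val + (k - 1) + 1 : ℕ) : ℝ) := by push_cast; linarith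
      have : n < i.val + (k - 1) + 1 := by exact_mod_cast this
      omega
    · intro h
      have : (n : ℝ) ≤ ((i.val + (k - 1) : ℕ) : ℝ) := by exact_mod_cast h
      push_cast at this
      exact ⟨by linarith, by linarith⟩
  case bb =>
    rw [card_rimTimes (by norm_num [ex]) (by simp only [src, cx, ex]; linarith)]
    simp only [src, cx, ex]
    refine if_congr ?_ rfl rfl
    constructor
    · rintro ⟨-, h⟩
      have : (n : ℝ) < ((i.val + 2 : ℕ) : ℝ) := by push_cast; linarith
      have : n < i.val + 2 := by exact_mod_cast this
      have := i.isLt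
      omega
    · intro h
      have : ((i.val + 1 : ℕ) : ℝ) = n := by exact_mod_cast h
      push_cast at this
      exact ⟨by linarith, by linarith⟩
  all_goals
    rw [card_rimTimes (by norm_num [ex]) (by simp only [src, cx, ex]; linarith)]
    rw [if_neg]
    simp only [src, cx, ex]
    rintro ⟨-, h⟩
    linarith

end Nbar

/-! ### Determinants of cyclic products -/

section CyclicProducts

variable {K : Type*} [CommRing K] {n : ℕ}

/-- For `m ≤ n` at most one wrap-around occurs, so the factor `-z` appears at most once. -/
theorem shiftMatrix_pow_apply (z : K) {m : ℕ} (hm : m ≤ n) (i j : Fin n) :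
    (shiftMatrix n z ^ m) i j =
      if i.val + m = j.val then 1 else if i.val + m = j.val + n then -z else 0 := by
  induction m generalizing i with
  | zero =>
    rw [pow_zero, Matrix.one_apply]
    simp only [Fin.ext_iff, add_zero]
    rw [if_neg (by omega : ¬ i.val = j.val + n)]
  | succ m ih =>
    rw [pow_succ', Matrix.mul_apply]
    simp only [ih (Nat.le_of_succ_le hm)]
    by_cases hi : i.val + 1 < n
    · rw [Finset.sum_eq_single ⟨i.val + 1, hi⟩]
      · simp [shiftMatrix, add_assoc, add_comm 1 m]
      · intro l _ hl
        rw [Ne, Fin.ext_iff] at hl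
        simp only at hl
        simp only [shiftMatrix, Matrix.of_apply]
        rw [if_neg (by omega), if_neg (by omega), zero_mul]
      · simp
    · rw [Finset.sum_eq_single ⟨0, i.pos⟩]
      · simp only [shiftMatrix, Matrix.of_apply, zero_add, and_true]
        rw [if_neg (by omega), if_pos (by omega), if_neg (by omega : ¬ i.val + (m + 1) = j.val)]
        by_cases h : m = j.val
        · rw [if_pos (by omega), if_pos (by omega), mul_one]
        · rw [if_neg (by omega), if_neg (by omega), if_neg (by omega), mul_zero]
      · intro l _ hl
        rw [Ne, Fin.ext_iff] at hl
        simp only at hl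
        simp only [shiftMatrix, Matrix.of_apply]
        rw [if_neg (by omega), if_neg (by omega), zero_mul]
      · simp

/-- The determinant of a cyclic block matrix. -/
theorem det_one_sub_cyclic {κ : Type*} [Fintype κ] [DecidableEq κ] (hn : 0 < n) (z : K)
    (L : Fin n → Matrix κ κ K) :
    (1 - Matrix.of fun p q : Fin n × κ => shiftMatrix n z p.1 q.1 * L p.1 p.2 q.2).det =
      (1 + z • (List.ofFn L).prod).det := by
  -- The cyclic matrix is `N - z C F`, where `N` collects the steps without wrap-around and `C F`
  -- the step from the last block to the first. The partial products `Y` solve `(1 - N) Y = C`, so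
  -- `1 - N + z C F = (1 - N) (1 + z Y F)`; here `1 - N` is unitriangular and `F Y` is the full
  -- product.
  set N : Matrix (Fin n × κ) (Fin n × κ) K :=
    Matrix.of fun p q => if p.1.val + 1 = q.1.val then L p.1 p.2 q.2 else 0 with hN
  set C : Matrix (Fin n × κ) κ K :=
    Matrix.of fun p b => if p.1.val + 1 = n then L p.1 p.2 b else 0 with hC
  set F : Matrix κ (Fin n × κ) K :=
    Matrix.of fun a q => if q = (⟨0, hn⟩, a) then 1 else 0 with hF
  set Y : Matrix (Fin n × κ) κ K :=
    Matrix.of fun p b => ((List.ofFn L).drop p.1).prod p.2 b with hY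
  have hdrop : ∀ i : Fin n, ((List.ofFn L).drop i).prod =
      L i * ((List.ofFn L).drop (i.val + 1)).prod := by
    intro i
    rw [List.drop_eq_getElem_cons (by simp), List.prod_cons, List.getElem_ofFn]
  have hNY : N * Y + C = Y := by
    ext ⟨i, a⟩ b
    rw [Matrix.add_apply, Matrix.mul_apply, Fintype.sum_prod_type]
    simp only [hY, Matrix.of_apply, hN, hC]
    rw [hdrop i]
    by_cases hi : i.val + 1 < n
    · rw [Finset.sum_eq_single ⟨i.val + 1, hi⟩]
      · simp [hi.ne, Matrix.mul_apply]
      · intro l _ hl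
        rw [Ne, Fin.ext_iff] at hl
        exact Finset.sum_eq_zero fun c _ => by rw [if_neg (by simpa using Ne.symm hl), zero_mul]
      · simp
    · have h1 : i.val + 1 = n := by omega
      rw [List.drop_eq_nil_of_le (by simp [h1]), List.prod_nil, mul_one, if_pos h1,
        Finset.sum_eq_zero, zero_add]
      exact fun l _ => Finset.sum_eq_zero fun c _ => by
        rw [if_neg (by omega), zero_mul]
  have hFY : F * Y = (List.ofFn L).prod := by
    ext a b
    simp [Matrix.mul_apply, hF, hY]
  have hsplit : (1 - Matrix.of fun p q : Fin n × κ => shiftMatrix n z p.1 q.1 * L p.1 p.2 q.2) =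
      (1 - N) * (1 + z • (Y * F)) := by
    have h1 : (1 - N) * Y = C := by
      rw [Matrix.sub_mul, Matrix.one_mul]
      nth_rewrite 1 [← hNY]
      abel
    rw [Matrix.mul_add, Matrix.mul_one, Matrix.mul_smul, ← Matrix.mul_assoc, h1, sub_add]
    congr 1
    ext ⟨i, a⟩ ⟨j, b⟩
    have h2 : (C * F) (i, a) (j, b) = if j.val = 0 then C (i, a) b else 0 := by
      rw [Matrix.mul_apply]
      simp only [hF, Matrix.of_apply, Prod.mk.injEq, Fin.ext_iff]
      by_cases hj : j.val = 0 <;> simp [hj]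
    rw [Matrix.sub_apply, Matrix.smul_apply, h2]
    simp only [hN, hC, Matrix.of_apply, shiftMatrix]
    split_ifs <;> first | (exfalso; omega) | simp
  rw [hsplit, Matrix.det_mul, Matrix.det_one_sub_eq_one_of_rank (fun p : Fin n × κ => p.1),
    one_mul, ← Matrix.smul_mul, Matrix.det_one_add_mul_comm, Matrix.mul_smul, hFY]
  intro p q hpq
  simp only [hN, Matrix.of_apply]
  rw [if_neg]
  have : q.1.val ≤ p.1.val := hpq
  omega

/-- The cyclic determinant with all blocks equal to the `1 × 1` identity. -/
theorem det_one_sub_shiftMatrix (hn : 0 < n) (z : K) : (1 - shiftMatrix n z).det = 1 + z := by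
  have h := det_one_sub_cyclic (κ := Unit) hn z fun _ => 1
  rw [List.ofFn_const, List.prod_replicate, one_pow, Matrix.det_unique (1 + z • (1 : Matrix Unit Unit K))] at h
  rw [← Matrix.det_submatrix_equiv_self (Equiv.prodUnique (Fin n) Unit)]
  convert h using 2
  · ext ⟨i, _⟩ ⟨j, _⟩
    simp [Matrix.one_apply]
  · simp

end CyclicProducts

/-! ### The determinant of the monodromy matrix -/

section Monodromy

variable {K : Type*} [CommRing K] {k n : ℕ}

/-- Subtracting `D_x` times the second block row from the first turns the upper left block into the
identity; a Schur complement finishes. -/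
theorem det_fromBlocks_monodromy (k : ℕ) (x y : Fin n → K) (lam z : K) :
    (Matrix.fromBlocks (1 + lam • (Matrix.diagonal x * shiftMatrix n z ^ (k - 1)))
      (-((Matrix.diagonal x + Matrix.diagonal y) * shiftMatrix n z))
      (lam • shiftMatrix n z ^ (k - 1)) (1 - shiftMatrix n z)).det =
    (1 - shiftMatrix n z + lam • (shiftMatrix n z ^ (k - 1) *
      (Matrix.diagonal x + Matrix.diagonal y * shiftMatrix n z))).det := by
  set Z := shiftMatrix n z
  set P := lam • Z ^ (k - 1) with hP
  have h : (Matrix.fromBlocks 1 (-Matrix.diagonal x) 0 (1 : Matrix (Fin n) (Fin n) K)).det = 1 := by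
    rw [Matrix.det_fromBlocks_zero₂₁, Matrix.det_one, one_mul]
  rw [← one_mul (Matrix.det _), ← h, ← Matrix.det_mul, Matrix.fromBlocks_multiply]
  have c1 : 1 * (1 + lam • (Matrix.diagonal x * Z ^ (k - 1))) + -Matrix.diagonal x * P = 1 := by
    rw [one_mul, hP, Matrix.neg_mul, Matrix.mul_smul]
    abel
  have c2 : 1 * -((Matrix.diagonal x + Matrix.diagonal y) * Z) + -Matrix.diagonal x * (1 - Z) =
      -(Matrix.diagonal x + Matrix.diagonal y * Z) := by
    noncomm_ring
  rw [c1, c2, Matrix.zero_mul, Matrix.zero_mul, Matrix.one_mul, Matrix.one_mul, zero_add, zero_add,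
    Matrix.det_fromBlocks_one₁₁, Matrix.mul_neg, sub_neg_eq_add, hP, Matrix.smul_mul]

/-- The indices of the lines other than the first and the last one come last. -/
def lineEquiv (n m : ℕ) : (Fin n ⊕ Fin n) ⊕ Fin n × Fin (m + 1) ≃ Fin n × Fin (m + 3) where
  toFun := Sum.elim (Sum.elim (fun i => (i, 0)) fun i => (i, Fin.last _))
    fun p => (p.1, p.2.succ.castSucc)
  invFun p := if h : p.2.val = 0 then Sum.inl (Sum.inl p.1) else
    if h' : p.2.val = m + 2 then Sum.inl (Sum.inr p.1) else
      Sum.inr (p.1, ⟨p.2.val - 1, by omega⟩)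
  left_inv := by
    rintro ((i | i) | ⟨i, j⟩)
    · simp
    · simp
    · simp [j.isLt.ne]
  right_inv := by
    rintro ⟨i, j⟩
    by_cases h : j.val = 0
    · simp [h, Fin.ext_iff]
    · by_cases h' : j.val = m + 2
      · simp [h', Fin.ext_iff]
      · simp only [h, h', dif_neg, not_false_eq_true, Sum.elim_inr, Prod.mk.injEq, Fin.ext_iff,
          Fin.val_castSucc, Fin.val_succ, true_and]
        omega

/-- The product `L_1 ⋯ L_n` is unrolled into one cyclic matrix over pairs of a position and a line.
The intermediate lines only pass on what they receive, one position per step, so eliminating them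
produces powers of `Z`. -/
theorem det_one_add_monodromyMatrix (hk : 2 ≤ k) (hn : 0 < n) (x y : Fin n → K) (lam z : K) :
    (1 + z • monodromyMatrix k x y lam).det =
    (1 - shiftMatrix n z + lam • (shiftMatrix n z ^ (k - 1) *
      (Matrix.diagonal x + Matrix.diagonal y * shiftMatrix n z))).det := by
  rw [← det_fromBlocks_monodromy k x y lam z, monodromyMatrix, ← det_one_sub_cyclic hn]
  set Z := shiftMatrix n z
  obtain rfl | ⟨m, rfl⟩ : k = 2 ∨ ∃ m, k = m + 3 := by
    rcases hk.eq_or_lt with h | h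
    · exact Or.inl h.symm
    · exact Or.inr ⟨k - 3, by omega⟩
  -- For `k = 2` there are no intermediate lines, and the blocks agree directly.
  · have h0 : finTwoEquiv.symm false = 0 := rfl
    have h1 : finTwoEquiv.symm true = 1 := rfl
    rw [← Matrix.det_submatrix_equiv_self
      ((Equiv.boolProdEquivSum _).symm.trans ((Equiv.prodComm _ _).trans
        (Equiv.prodCongr (Equiv.refl _) finTwoEquiv.symm)))]
    congr 1
    ext (i | i) (j | j) <;>
      simp [elementaryMatrix, Matrix.one_apply, Matrix.diagonal_mul, Matrix.diagonal_add, h0, h1] <;>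
      ring
  · rw [← Matrix.det_submatrix_equiv_self (lineEquiv n m)]
    -- From the intermediate line `p`, numbered from `0`, a walk moves down one line index per step
    -- and enters the first line after `p + 1` steps, with the factor `-λ`; it never reaches the
    -- last line directly.
    set U : Matrix (Fin n × Fin (m + 1)) (Fin n ⊕ Fin n) K :=
      Matrix.of fun p => Sum.elim (fun j => -lam * (Z ^ (p.2.val + 1)) p.1 j) fun _ => 0 with hU
    set D : Matrix (Fin n × Fin (m + 1)) (Fin n × Fin (m + 1)) K :=
      Matrix.of fun p q => if q.2.val + 1 = p.2.val then Z p.1 q.1 else 0 with hD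
    set C : Matrix (Fin n × Fin (m + 1)) (Fin n ⊕ Fin n) K :=
      Matrix.of fun p => Sum.elim (fun j => if p.2.val = 0 then -lam * Z p.1 j else 0)
        fun _ => 0 with hC
    set B : Matrix (Fin n ⊕ Fin n) (Fin n × Fin (m + 1)) K :=
      Matrix.of fun s p => if p.2.val = m then
        Sum.elim (fun i => x i * Z i p.1) (fun i => Z i p.1) s else 0 with hB
    set A : Matrix (Fin n ⊕ Fin n) (Fin n ⊕ Fin n) K :=
      Matrix.fromBlocks 0 ((Matrix.diagonal x + Matrix.diagonal y) * Z) 0 Z with hA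
    have hT : (1 - Matrix.of fun p q : Fin n × Fin (m + 3) =>
        Z p.1 q.1 * elementaryMatrix (m + 3) lam (x p.1) (y p.1) p.2 q.2).submatrix
          (lineEquiv n m) (lineEquiv n m) = 1 - Matrix.fromBlocks A B C D := by
      rw [← Matrix.submatrix_one_equiv (lineEquiv n m), Matrix.submatrix_sub]
      ext ((i | i) | ⟨i, i'⟩) ((j | j) | ⟨j, j'⟩) <;>
        simp [lineEquiv, elementaryMatrix, hA, hB, hC, hD, Matrix.diagonal_mul,
          Matrix.diagonal_add]
      all_goals
        try simp only [Fin.ext_iff, Fin.val_zero]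
        try intro h
        (try split_ifs) <;> first | (exfalso; omega) | ring
    have hCDU : C + D * U = U := by
      ext ⟨i, i'⟩ (j | j)
      · rw [Matrix.add_apply, Matrix.mul_apply, Fintype.sum_prod_type]
        simp only [hC, hD, hU, Matrix.of_apply, Sum.elim_inl]
        by_cases h : i'.val = 0
        · simp [h]
        · rw [if_neg h, zero_add, pow_succ', Matrix.mul_apply, Finset.mul_sum]
          refine Finset.sum_congr rfl fun l _ => ?_
          rw [Finset.sum_eq_single ⟨i'.val - 1, by omega⟩]
          · simp only [Nat.sub_add_cancel (Nat.one_le_iff_ne_zero.2 h), if_true]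
            ring
          · intro c _ hc
            rw [Ne, Fin.ext_iff] at hc
            rw [if_neg (by simp only at hc; omega), zero_mul]
          · simp
      · simp [Matrix.mul_apply, hC, hU]
    rw [hT, Matrix.det_one_sub_fromBlocks A B C D U hCDU,
      Matrix.det_one_sub_eq_one_of_rank (fun p : Fin n × Fin (m + 1) => -(p.2.val : ℤ)), mul_one]
    · congr 1
      have hBU : B * U = Matrix.fromBlocks (-(lam • (Matrix.diagonal x * Z ^ (m + 2)))) 0
          (-(lam • Z ^ (m + 2))) 0 := by
        ext (i | i) (j | j)
        all_goals
          rw [Matrix.mul_apply, Fintype.sum_prod_type]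
          simp only [hB, hU, Matrix.of_apply, Sum.elim_inl, Sum.elim_inr, mul_zero,
            Finset.sum_const_zero, Matrix.fromBlocks_apply₁₂, Matrix.fromBlocks_apply₂₂,
            Matrix.zero_apply]
        · rw [Matrix.fromBlocks_apply₁₁, Matrix.neg_apply, Matrix.smul_apply, Matrix.diagonal_mul,
            pow_succ', Matrix.mul_apply, Finset.mul_sum, Finset.smul_sum, ← Finset.sum_neg_distrib]
          refine Finset.sum_congr rfl fun l _ => ?_
          rw [Finset.sum_eq_single (Fin.last m)]
          · simp
            ring
          · intro c _ hc
            rw [if_neg (by rwa [Ne, Fin.ext_iff] at hc), zero_mul]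
          · simp
        · rw [Matrix.fromBlocks_apply₂₁, Matrix.neg_apply, Matrix.smul_apply,
            pow_succ', Matrix.mul_apply, Finset.smul_sum, ← Finset.sum_neg_distrib]
          refine Finset.sum_congr rfl fun l _ => ?_
          rw [Finset.sum_eq_single (Fin.last m)]
          · simp
            ring
          · intro c _ hc
            rw [if_neg (by rwa [Ne, Fin.ext_iff] at hc), zero_mul]
          · simp
      rw [hBU, hA, Matrix.fromBlocks_add, ← Matrix.fromBlocks_one, fromBlocks_sub]
      simp
    · rintro ⟨i, i'⟩ ⟨j, j'⟩ h
      simp only [hD, Matrix.of_apply]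
      rw [if_neg]
      simp only at h
      omega

end Monodromy

/-! ### The partition function of `N̄_{k,n}` and the conjugate matrix -/

namespace Nbar

variable {K : Type*} [Field K] {k n : ℕ}

theorem shift_eq_iff {m : ℕ} (hm : m ≤ n) {i j : Fin n} :
    shift m i = j ↔ i.val + m = j.val ∨ i.val + m = j.val + n := by
  rw [Fin.ext_iff]
  change (i.val + m) % n = j.val ↔ _
  by_cases h : i.val + m < n
  · rw [Nat.mod_eq_of_lt h]
    omega
  · rw [Nat.mod_eq_sub_mod (by omega)]
    by_cases h' : i.val + m - n < n
    · rw [Nat.mod_eq_of_lt h']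
      omega
    · omega

theorem ite_shift_eq (z : K) {m : ℕ} (hm : m ≤ n) (i j : Fin n) :
    (if shift m i = j then if n ≤ i.val + m then -z else 1 else 0) =
      (shiftMatrix n z ^ m) i j := by
  rw [shiftMatrix_pow_apply z hm, if_congr (shift_eq_iff hm) rfl rfl]
  split_ifs <;> first | (exfalso; omega) | simp

theorem sum_edgeKind {M : Type*} [AddCommMonoid M] (f : EdgeKind → M) :
    ∑ c, f c = f .left + (f .lower + (f .upper + (f .right + (f .bb + f .ww)))) := by
  change ∑ c ∈ {EdgeKind.left, EdgeKind.lower, EdgeKind.upper, EdgeKind.right, EdgeKind.bb,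
    EdgeKind.ww}, f c = _
  repeat rw [Finset.sum_insert (by decide)]
  rw [Finset.sum_singleton]

open Classical in
theorem transfer_apply (X : Fin n × EdgeKind → K) (i : Fin n) (a : CornerKind)
    (w : Fin n × CornerKind) :
    (torusNetworkNbar k n).transfer X (i, a) w =
      ∑ c, if src (i, c) = (i, a) ∧ tgt k (i, c) = w then X (i, c) else 0 := by
  rw [PerfectTorusNetwork.transfer, Matrix.of_apply, Fintype.sum_prod_type,
    Finset.sum_eq_single i]
  · refine Finset.sum_congr rfl fun c _ => ?_
    congr!
  · intro l _ hl
    refine Finset.sum_eq_zero fun c _ => if_neg fun h => hl ?_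
    refine Eq.trans ?_ (congrArg Prod.fst h.1)
    cases c <;> rfl
  · simp

theorem edgeFactor_eq (hk : 2 ≤ k) (hkn : k ≤ n) (lam z : K) (x y : Fin n → K) (i : Fin n)
    (c : EdgeKind) :
    (torusNetworkNbar k n).edgeFactor lam z (nbarWeight x y) (i, c) = match c with
      | .left => x i
      | .lower => y i
      | .upper => 1
      | .right => 1
      | .bb => (-z) ^ (if n ≤ i.val + 1 then 1 else 0)
      | .ww => -lam * (-z) ^ (if n ≤ i.val + (k - 1) then 1 else 0) := by
  have hi : i.val + 1 = n ↔ n ≤ i.val + 1 := by omega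
  rw [PerfectTorusNetwork.edgeFactor, cutIndex_eq, card_rimTimes_eq hk hkn]
  cases c <;> simp [nbarWeight, hi]

/-- The vertices of the network, sorted by their kind. -/
def vertexEquiv (n : ℕ) : ((Fin n ⊕ Fin n) ⊕ Fin n) ⊕ Fin n ≃ Fin n × CornerKind where
  toFun := Sum.elim (Sum.elim (Sum.elim (fun i => (i, .ul)) fun i => (i, .ur)) fun i => (i, .ll))
    fun i => (i, .lr)
  invFun p := match p with
    | (i, .ul) => Sum.inl (Sum.inl (Sum.inl i))
    | (i, .ur) => Sum.inl (Sum.inl (Sum.inr i))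
    | (i, .ll) => Sum.inl (Sum.inr i)
    | (i, .lr) => Sum.inr i
  left_inv := by rintro (((i | i) | i) | i) <;> rfl
  right_inv := by rintro ⟨i, _ | _ | _ | _⟩ <;> rfl

/-- Sorted by kind of vertex, the transfer matrix has `n × n` blocks, in which black-black edges act
as `Z` and white-white edges as `-λ Z^(k-1)`. Schur complements eliminate `lr`, `ll` and `ul`,
leaving the returns to `ur`. -/
theorem partitionFunction_eq (hk : 2 ≤ k) (hkn : k ≤ n) (x y : Fin n → K) (lam z : K) :
    (torusNetworkNbar k n).partitionFunction lam z (nbarWeight x y) =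
    (1 - shiftMatrix n z + lam • (shiftMatrix n z ^ (k - 1) *
      (Matrix.diagonal x + Matrix.diagonal y * shiftMatrix n z))).det := by
  classical
  rw [(isIdealRim k n).partitionFunction_eq_det lam (Or.inr fun e => by
    rw [cutIndex_eq]; split_ifs <;> simp)]
  set Z := shiftMatrix n z with hZ
  set P := lam • Z ^ (k - 1) with hP
  have hbb : ∀ i j : Fin n, (if shift 1 i = j then
      if n ≤ i.val + 1 then -z else 1 else 0) = Z i j := fun i j => by
    rw [ite_shift_eq z (by omega), pow_one]
  have hww : ∀ i j : Fin n, (if shift (k - 1) i = j then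
      if n ≤ i.val + (k - 1) then lam * z else -lam else 0) = -P i j := fun i j => by
    rw [hP, Matrix.smul_apply, hZ, ← ite_shift_eq z (by omega : k - 1 ≤ n)]
    split_ifs <;> simp
  have hT : (1 - (torusNetworkNbar k n).transfer ((torusNetworkNbar k n).edgeFactor lam z
      (nbarWeight x y))).submatrix (vertexEquiv n) (vertexEquiv n) =
      Matrix.fromBlocks (Matrix.fromBlocks (Matrix.fromBlocks 1 (-1) 0 1) (Matrix.fromRows 0 P)
          (Matrix.fromCols (-Matrix.diagonal x) 0) 1)
        (Matrix.fromRows (Matrix.fromRows 0 (-1)) (-Matrix.diagonal y))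
        (Matrix.fromCols (Matrix.fromCols (-Z) 0) 0) 1 := by
    ext (((i | i) | i) | i) (((j | j) | j) | j) <;>
      simp [vertexEquiv, Matrix.one_apply, transfer_apply, sum_edgeKind, src, tgt,
        edgeFactor_eq hk hkn, hbb, hww, Matrix.diagonal_apply, neg_ite]
  trans (1 - (torusNetworkNbar k n).transfer ((torusNetworkNbar k n).edgeFactor lam z
    (nbarWeight x y))).det
  · congr!
  rw [← Matrix.det_submatrix_equiv_self (vertexEquiv n), hT]
  rw [Matrix.det_fromBlocks_one₂₂, Matrix.fromRows_mul_fromCols, Matrix.fromRows_mul_fromCols,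
    fromBlocks_sub, fromBlocks_sub, Matrix.fromRows_mul, Matrix.mul_fromCols]
  simp only [Matrix.mul_zero, Matrix.zero_mul, sub_zero, neg_mul_neg, Matrix.one_mul]
  rw [Matrix.det_fromBlocks_one₂₂]
  have hr : Matrix.fromRows (0 : Matrix (Fin n) (Fin n) K) P - Matrix.fromRows 0 0 =
      Matrix.fromRows 0 P := by
    ext (i | i) j <;> simp
  have hc : Matrix.fromCols (-Matrix.diagonal x) (0 : Matrix (Fin n) (Fin n) K) -
      Matrix.fromCols (Matrix.diagonal y * Z) 0 =
      Matrix.fromCols (-(Matrix.diagonal x + Matrix.diagonal y * Z)) 0 := by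
    ext i (j | j)
    · simp only [Matrix.sub_apply, Matrix.fromCols_apply_inl, Matrix.neg_apply, Matrix.add_apply]
      ring
    · simp
  rw [hr, hc, Matrix.fromRows_mul_fromCols, fromBlocks_sub]
  simp only [Matrix.mul_zero, Matrix.zero_mul, sub_zero]
  rw [Matrix.det_fromBlocks_one₁₁, hP, ← Matrix.smul_mul]
  congr 1
  noncomm_ring

/-- The factor `1 + z` is `det (1 - Z)`. Once `Z^(k-2) (1 - Z)⁻¹` is moved to the front by `det (1 +
AB) = det (1 + BA)`, it cancels the inverse, because `1 - Z` commutes with powers of `Z`. -/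
theorem one_add_mul_det_conjugateMatrix (hk : 2 ≤ k) (hn : 0 < n) (x y : Fin n → K) (lam z : K)
    (hz : 1 + z ≠ 0) :
    (1 + z) * (1 + lam • conjugateMatrix k x y z).det =
    (1 - shiftMatrix n z + lam • (shiftMatrix n z ^ (k - 1) *
      (Matrix.diagonal x + Matrix.diagonal y * shiftMatrix n z))).det := by
  have hunit : IsUnit (1 - shiftMatrix n z).det := by
    rw [det_one_sub_shiftMatrix hn]
    exact hz.isUnit
  rw [conjugateMatrix, ← det_one_sub_shiftMatrix hn z]
  set Z := shiftMatrix n z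
  set B := Matrix.diagonal x + Matrix.diagonal y * Z
  have hcomm : (1 - Z) * Z ^ (k - 2) = Z ^ (k - 2) * (1 - Z) := by
    rw [sub_mul, mul_sub, one_mul, mul_one, ← pow_succ, ← pow_succ']
  rw [mul_assoc, ← Matrix.smul_mul, Matrix.det_one_add_mul_comm, ← Matrix.det_mul, mul_add, mul_one,
    ← mul_assoc, ← mul_assoc, hcomm, Matrix.mul_nonsing_inv_cancel_right _ _ hunit, Matrix.mul_smul,
    ← mul_assoc, ← pow_succ, show k - 2 + 1 = k - 1 by omega]

end Nbar

theorem mainTheorem7 {K : Type*} [Field K] {V E : Type*} [Fintype V] [Fintype E] :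
    (∀ (N : PerfectTorusNetwork V E), N.IsIdealRim → N.NoContractibleCycles →
      ∀ lam : K, lam ≠ 0 →
        -- the identity of formal power series in the edge weights
        (IsUnit (N.partitionFunction lam (0 : MvPowerSeries N.Piece K)
            (N.edgeWeight MvPowerSeries.X)) ∧
          (1 + (Polynomial.X : Polynomial (MvPowerSeries N.Piece K)) •
              (N.boundaryMeasurement lam).map Polynomial.C).det *
            Polynomial.C (N.partitionFunction lam (0 : MvPowerSeries N.Piece K)
              (N.edgeWeight MvPowerSeries.X)) =
          N.partitionFunction lam (Polynomial.X : Polynomial (MvPowerSeries N.Piece K))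
            (fun e => Polynomial.C (N.edgeWeight MvPowerSeries.X e))) ∧
        -- the identity for edge weights in the field
        ∀ u : N.Piece → K, N.partitionFunction lam (0 : K) (N.edgeWeight u) ≠ 0 →
          ∃ M : Matrix N.RimPoint N.RimPoint K,
            (∀ M', N.IsBoundaryMeasurementAt lam u M' ↔ M' = M) ∧
            (1 + (Polynomial.X : Polynomial K) • M.map Polynomial.C).det =
              Polynomial.C (N.partitionFunction lam (0 : K) (N.edgeWeight u))⁻¹ *
                N.partitionFunction lam (Polynomial.X : Polynomial K)
                  (fun e => Polynomial.C (N.edgeWeight u e))) ∧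
    (∀ (k n : ℕ), 2 ≤ k → k ≤ n →
      (torusNetworkNbar k n).IsIdealRim ∧ (torusNetworkNbar k n).NoContractibleCycles ∧
      ∀ (x y : Fin n → K) (lam z : K),
        (1 + z • monodromyMatrix k x y lam).det =
          (torusNetworkNbar k n).partitionFunction lam z (nbarWeight x y) ∧
        (1 + z ≠ 0 →
          (1 + z • monodromyMatrix k x y lam).det =
            (1 + z) * (1 + lam • conjugateMatrix k x y z).det)) := by
  refine ⟨fun N hrim hnc lam hlam => ⟨⟨hrim.isUnit_partitionFunction hlam,
    N.det_one_add_boundaryMeasurement hrim hnc hlam⟩, fun u hu =>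
    N.exists_boundaryMeasurementAt hrim hnc hlam u hu⟩, fun k n hk hkn =>
    ⟨Nbar.isIdealRim k n, Nbar.noContractibleCycles hk n, fun x y lam z => ?_⟩⟩
  have hn : 0 < n := by omega
  rw [Nbar.partitionFunction_eq hk hkn, det_one_add_monodromyMatrix hk hn]
  exact ⟨rfl, fun hz => (Nbar.one_add_mul_det_conjugateMatrix hk hn x y lam z hz).symm⟩
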